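/- \textbf{Setting.} Let $N=N_n\to\infty$, $T=T_n\to\infty$ and let $K=K_n$ be given sieve dimensions. For each $n$ let $\zeta_1,\dots,\zeta_N$ be latent states, possibly random, with values in a set $\mathcal Z\subseteq\mathbb R^d$; let $(\phi_r)_{r\ge1}$ be an orthonormal system in $L^2(\mathcal Z,\rho)$ for a measure $\rho$ on $\mathcal Z$; and let $h_t=\sum_{r\ge1}\kappa_{t,r}\phi_r$ in $L^2(\rho)$ for $t\le T$, possibly random. Put $M_{it}=h_t(\zeta_i)$, $\beta_i=(\phi_1(\zeta_i),\dots,\phi_K(\zeta_i))'$, $F_t=(\kappa_{t,1},\dots,\kappa_{t,K})'$, let $\beta$ and $F$ be the matrices with rows $\beta_i'$ and $F_t'$, and put $M^R=M-\beta F'$, $S_\beta=N^{-1}\beta'\beta$, $S_F=T^{-1}F'F$, $Q=S_\beta^{1/2}S_F^{1/2}$. Write $\psi_r(\cdot)$ for the $r$-th largest singular value. One observes $\omega_{it}$, and $y_{it}=M_{it}+\varepsilon_{it}$ where $\omega_{it}=1$; given $M$, the variables $\omega_{it}\sim\mathrm{Bernoulli}(p)$ and $\varepsilon_{it}\sim\mathcal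 N(0,\sigma^2)$ are independent of each other and across $(i,t)$ (with $p=p_n\in(0,1]$, $\sigma=\sigma_n$). Let $\mathcal G=\mathcal I\times\mathcal T$ with non-empty $\mathcal I\subseteq\{1,\dots,N\}$, $\mathcal T\subseteq\{1,\dots,T\}$ satisfying $N|\mathcal T|=o(T^2|\mathcal I|^2)$ and $T|\mathcal I|=o(N^2|\mathcal T|^2)$. With $\bar\beta_{\mathcal I}=|\mathcal I|^{-1}\sum_{i\in\mathcal I}\beta_i$ and $\bar F_{\mathcal T}=|\mathcal T|^{-1}\sum_{t\in\mathcal T}F_t$, define $$s_*^2=s_*^2(M,p,\sigma)=\frac{\sigma^2}{p\,|\mathcal T|}\bar\beta_{\mathcal I}'(\beta'\beta)^{-1}\bar\beta_{\mathcal I}+\frac{\sigma^2}{p\,|\mathcal I|}\bar F_{\mathcal T}'(F'F)^{-1}\bar F_{\mathcal T}.$$ \textbf{The class $\mathcal A$.} A sequence of such models belongs to $\mathcal A$ if $\sigma_n$ is bounded above and bounded away from $0$ and there are constants $C$, $\nu>0$, $\delta,g\ge0$, $c>0$ and positive sequences $\eta=\eta_n$, $\psi_{NT}$ such that: (1) almost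 surely $\|h_t\|_{L^2(\rho)}\le C$ for all $t$ and $\max_{i,t}|M^R_{it}|\le CK^{-\nu}$; and $\sup_{\mathcal Z}|\phi_r|\le C$ for $r\le K$; (2) with probability converging to one, $\psi_K(S_\beta)^{-1}<\eta$ and $\psi_K(S_F)^{-1}<\eta$ (both singular values being positive), and $\psi_r(Q)-\psi_{r+1}(Q)\ge cK^{-g}$ for $1\le r\le K-1$; (3) $(NT)^{-1}\sum_{i,t}M_{it}^2=O_P(1)$, $\psi_1(Q)=O_P(K^\delta\psi_K(Q))$, and $\psi_{NT}\asymp\big(K^{-(2\delta+1)}\sum_{i,t}M_{it}^2\big)^{1/2}$ in the sense that each side is $O_P$ of the other; (4) with $m=\min\{|\mathcal I|^{1/2},|\mathcal T|^{1/2}\}$, \begin{align*} m\max\{1,\log N+\log T\}\,\eta^3K^{4+2g+\frac{13}{2}\delta}\max\{\sqrt{N\log N},\sqrt{T\log T}\}&=o(p^{3/2}\min\{N,T\}),\\ m\,\eta^{1/2}K^{1+g+\frac72\delta}\max\{N^{3/2},T^{3/2}\}&=o(p^{3/2}\psi_{NT}^2),\\ m\,\eta^{3/2}\max\{\sqrt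 N,\sqrt T\}&=o(p^{1/2}K^{\nu-2\delta-\frac32}),\\ m\,\eta^{1/2}\max\{\sqrt N,\sqrt T\}\sqrt{NT}&=o(\psi_{NT}\,p^{1/2}K^{\nu-\delta-\frac12}); \end{align*} (5) for some constant $c_0>0$, with probability converging to one, $\sqrt{N\,\bar\beta_{\mathcal I}'(\beta'\beta)^{-1}\bar\beta_{\mathcal I}}\ge c_0$ and $\sqrt{T\,\bar F_{\mathcal T}'(F'F)^{-1}\bar F_{\mathcal T}}\ge c_0$. (These are the norms of $\frac{\sqrt N}{|\mathcal I|}\sum_{i\in\mathcal I}U_i$ and $\frac{\sqrt T}{|\mathcal T|}\sum_{t\in\mathcal T}V_t$, where $U_i',V_t'$ are the rows of the matrices of left and right singular vectors of $\beta F'$.) \textbf{Theorem.} (a) Let $U=U_n(Y,\Omega)$ be a measurable function of the observed entries and of the indicators which is asymptotically unbiased for the group average: for every sequence in $\mathcal A$, with probability converging to one $\mathbb E_{M,p,\sigma}U$ exists, and $\mathbb E_{M,p,\sigma}U-|\mathcal G|^{-1}\sum_{(i,t)\in\mathcal G}M_{it}=o_P(s_*(M,p,\sigma))$, where $\mathbb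 E_{M,p,\sigma}$ is the expectation given $(M,p,\sigma)$. Then for every sequence in $\mathcal A$ $$\liminf_{n\to\infty}\frac{\mathbb E_{M,p,\sigma}\big[U-|\mathcal G|^{-1}\sum_{(i,t)\in\mathcal G}M_{it}\big]^2}{s_*^2(M,p,\sigma)}\ge1$$ with probability converging to one, that is, for every $\epsilon>0$ the probability that the $n$-th ratio is at least $1-\epsilon$ converges to one. (b) For every sequence in $\mathcal A$, $s_*^2$ is the leading term of the asymptotic variance $$\mathcal V_{\mathcal G}=\frac{\sigma^2}{|\mathcal T|^2}\sum_{t\in\mathcal T}\bar\beta_{\mathcal I}'\Big(\sum_{j=1}^N\omega_{jt}\beta_j\beta_j'\Big)^{-1}\bar\beta_{\mathcal I}+\frac{\sigma^2}{|\mathcal I|^2}\sum_{i\in\mathcal I}\bar F_{\mathcal T}'\Big(\sum_{s=1}^T\omega_{is}F_sF_s'\Big)^{-1}\bar F_{\mathcal T},$$ that is, $\mathcal V_{\mathcal G}=s_*^2+o_P(s_*^2)$. -/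

import Mathlib

open Filter MeasureTheory ProbabilityTheory Topology

noncomputable section

/-! ### Matrices -/

/-- The `r`-th largest singular value of a real square matrix, counted from `r = 0`. -/
def psi {k : ℕ} (A : Matrix (Fin k) (Fin k) ℝ) (r : ℕ) : ℝ :=
  (Matrix.toEuclideanLin A).singularValues r

open scoped MatrixOrder in
/-- The positive semidefinite square root of a positive semidefinite matrix. -/
def matSqrt {k : ℕ} (A : Matrix (Fin k) (Fin k) ℝ) : Matrix (Fin k) (Fin k) ℝ :=
  CFC.sqrt A

/-- The quadratic form `v' A v`. -/
def quadForm {k : ℕ} (A : Matrix (Fin k) (Fin k) ℝ) (v : Fin k → ℝ) : ℝ :=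
  v ⬝ᵥ (A.mulVec v)

/-- The average of the rows of `B` with index in `s`. -/
def rowMean {m k : ℕ} (B : Matrix (Fin m) (Fin k) ℝ) (s : Finset (Fin m)) : Fin k → ℝ :=
  fun r => (∑ i ∈ s, B i r) / (s.card : ℝ)

/-- The average of the entries of `A` over the block `I × J`. -/
def blockMean {m l : ℕ} (A : Matrix (Fin m) (Fin l) ℝ) (I : Finset (Fin m))
    (J : Finset (Fin l)) : ℝ :=
  (∑ i ∈ I, ∑ t ∈ J, A i t) / ((I.card : ℝ) * (J.card : ℝ))

/-! ### Stochastic order symbols for sequences of random variables -/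

section StochasticOrder

variable {Ξ : Type*} [MeasurableSpace Ξ]

/-- The event `E n` has probability converging to one. -/
def WithProbToOne (P : Measure Ξ) (E : ℕ → Ξ → Prop) : Prop :=
  Tendsto (fun n => P {ξ | ¬ E n ξ}) atTop (𝓝 0)

/-- `X n = O_P(Y n)`. -/
def BigOP (P : Measure Ξ) (X Y : ℕ → Ξ → ℝ) : Prop :=
  ∀ ε : ℝ, 0 < ε → ∃ B : ℝ, ∀ᶠ n in atTop, P {ξ | ¬ |X n ξ| ≤ B * |Y n ξ|} ≤ ENNReal.ofReal ε

end StochasticOrder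

/-! ### The observation scheme -/

/-- The joint law of the observation indicators and the noise: the pairs `(ω i t, ε i t)` are
independent across `(i, t)`, and `ω i t`, with law Bernoulli(`p`), is independent of `ε i t`,
with law `N(0, σ²)`. -/
def noiseLaw (m l : ℕ) (p : unitInterval) (σ : ℝ) : Measure (Fin m → Fin l → Bool × ℝ) :=
  Measure.pi fun _ => Measure.pi fun _ =>
    (bernoulliMeasure true false p).prod (gaussianReal 0 (Real.toNNReal (σ ^ 2)))

/-- What the statistician sees: the incomplete matrix `Y`, with `Y i t = M i t + ε i t` where
`ω i t = 1` (the missing entries are filled with `0`), and the matrix of the indicators `ω i t`. -/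
def observed {m l : ℕ} (M : Matrix (Fin m) (Fin l) ℝ) (x : Fin m → Fin l → Bool × ℝ) :
    (Fin m → Fin l → ℝ) × (Fin m → Fin l → Bool) :=
  (fun i t => if (x i t).1 = true then M i t + (x i t).2 else 0, fun i t => (x i t).1)

/-- `ω i t` as a real number. -/
def omegaVal {m l : ℕ} (x : Fin m → Fin l → Bool × ℝ) (i : Fin m) (t : Fin l) : ℝ :=
  if (x i t).1 = true then 1 else 0

/-! ### The nonparametric panel model -/

/-- A sequence, indexed by `n`, of nonparametric panel models `M i t = h t (ζ i)` with `N n` units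
and `T n` periods, together with an observation probability and a noise level.
The latent states and the functions `h t` may be random; their randomness lives on `Ξ`. -/
structure PanelModel (Ξ : Type*) [MeasurableSpace Ξ] (N T : ℕ → ℕ) where
  /-- The dimension of the latent states. -/
  d : ℕ
  /-- The set in which the latent states take their values. -/
  Z : ℕ → Set (EuclideanSpace ℝ (Fin d))
  measurableSet_Z : ∀ n, MeasurableSet (Z n)
  /-- The measure on `Z n` that defines the `L²` norm of functions of the latent state. -/
  ρ : ℕ → Measure (EuclideanSpace ℝ (Fin d))
  ρ_compl : ∀ n, ρ n (Z n)ᶜ = 0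
  /-- The basis functions, an orthonormal system in `L²(ρ n)`. -/
  φ : ℕ → ℕ → EuclideanSpace ℝ (Fin d) → ℝ
  measurable_φ : ∀ n r, Measurable (φ n r)
  memLp_φ : ∀ n r, MemLp (φ n r) 2 (ρ n)
  orthonormal_φ : ∀ n r s, ∫ z, φ n r z * φ n s z ∂(ρ n) = if r = s then 1 else 0
  /-- The latent states of the units. -/
  ζ : (n : ℕ) → Fin (N n) → Ξ → EuclideanSpace ℝ (Fin d)
  measurable_ζ : ∀ n i, Measurable (ζ n i)
  ζ_mem : ∀ n i ξ, ζ n i ξ ∈ Z n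
  /-- The time-varying functions of the latent state. -/
  h : (n : ℕ) → Fin (T n) → Ξ → EuclideanSpace ℝ (Fin d) → ℝ
  memLp_h : ∀ n t ξ, MemLp (h n t ξ) 2 (ρ n)
  /-- `h t` is the sum in `L²(ρ n)` of its expansion in the basis. -/
  h_expansion : ∀ n t ξ, Tendsto
    (fun m : ℕ => eLpNorm (fun z => h n t ξ z -
      ∑ r ∈ Finset.range m, (∫ w, h n t ξ w * φ n r w ∂(ρ n)) * φ n r z) 2 (ρ n))
    atTop (𝓝 0)
  measurable_coeff : ∀ n t r, Measurable fun ξ => ∫ w, h n t ξ w * φ n r w ∂(ρ n)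
  measurable_M : ∀ n i t, Measurable fun ξ => h n t ξ (ζ n i ξ)
  /-- The probability that an entry is observed. -/
  p : ℕ → unitInterval
  /-- The standard deviation of the noise. -/
  σ : ℕ → ℝ

namespace PanelModel

variable {Ξ : Type*} [MeasurableSpace Ξ] {N T : ℕ → ℕ} (θ : PanelModel Ξ N T)

/-- The matrix `M i t = h t (ζ i)`. -/
def M (n : ℕ) (ξ : Ξ) : Matrix (Fin (N n)) (Fin (T n)) ℝ :=
  Matrix.of fun i t => θ.h n t ξ (θ.ζ n i ξ)

/-- The loadings `β i = (φ 1 (ζ i), …, φ K (ζ i))`. -/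
def β (k n : ℕ) (ξ : Ξ) : Matrix (Fin (N n)) (Fin k) ℝ :=
  Matrix.of fun i r => θ.φ n r (θ.ζ n i ξ)

/-- The factors `F t = (κ t 1, …, κ t K)`, the first `K` sieve coefficients of `h t`. -/
def F (k n : ℕ) (ξ : Ξ) : Matrix (Fin (T n)) (Fin k) ℝ :=
  Matrix.of fun t r => ∫ w, θ.h n t ξ w * θ.φ n r w ∂(θ.ρ n)

/-- The sieve approximation error `M - β F'`. -/
def MR (k n : ℕ) (ξ : Ξ) : Matrix (Fin (N n)) (Fin (T n)) ℝ :=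
  θ.M n ξ - θ.β k n ξ * (θ.F k n ξ).transpose

/-- `S_β = N⁻¹ ∑ β i (β i)'`. -/
def Sβ (k n : ℕ) (ξ : Ξ) : Matrix (Fin k) (Fin k) ℝ :=
  (N n : ℝ)⁻¹ • ((θ.β k n ξ).transpose * θ.β k n ξ)

/-- `S_F = T⁻¹ ∑ F t (F t)'`. -/
def SF (k n : ℕ) (ξ : Ξ) : Matrix (Fin k) (Fin k) ℝ :=
  (T n : ℝ)⁻¹ • ((θ.F k n ξ).transpose * θ.F k n ξ)

/-- `Q = S_β^{1/2} S_F^{1/2}`. -/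
def Q (k n : ℕ) (ξ : Ξ) : Matrix (Fin k) (Fin k) ℝ :=
  matSqrt (θ.Sβ k n ξ) * matSqrt (θ.SF k n ξ)

/-- The sieve assumptions, with constants `C`, `ν`, `δ`, `g`, `c` and a sequence `η n`. -/
structure SieveAssumption (P : Measure Ξ) (K : ℕ → ℕ) (C ν δ g c : ℝ) (η : ℕ → ℝ) : Prop where
  norm_h : ∀ n, ∀ᵐ ξ ∂P, ∀ t, eLpNorm (θ.h n t ξ) 2 (θ.ρ n) ≤ ENNReal.ofReal C
  approx_error : ∀ n, ∀ᵐ ξ ∂P, ∀ i t, |θ.MR (K n) n ξ i t| ≤ C * (K n : ℝ) ^ (-ν)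
  basis_bounded : ∀ n r, r < K n → ∀ z ∈ θ.Z n, |θ.φ n r z| ≤ C
  min_eig_β : WithProbToOne P fun n ξ =>
    0 < psi (θ.Sβ (K n) n ξ) (K n - 1) ∧ (psi (θ.Sβ (K n) n ξ) (K n - 1))⁻¹ < η n
  min_eig_F : WithProbToOne P fun n ξ =>
    0 < psi (θ.SF (K n) n ξ) (K n - 1) ∧ (psi (θ.SF (K n) n ξ) (K n - 1))⁻¹ < η n
  mean_sq : BigOP P (fun n ξ => ((N n : ℝ) * (T n : ℝ))⁻¹ * ∑ i, ∑ t, (θ.M n ξ i t) ^ 2)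
    fun _ _ => 1
  condition_number : BigOP P (fun n ξ => psi (θ.Q (K n) n ξ) 0)
    fun n ξ => (K n : ℝ) ^ δ * psi (θ.Q (K n) n ξ) (K n - 1)
  gap : WithProbToOne P fun n ξ => ∀ r, r + 1 < K n →
    c * (K n : ℝ) ^ (-g) ≤ psi (θ.Q (K n) n ξ) r - psi (θ.Q (K n) n ξ) (r + 1)

/-- `ψ_NT ≍ (K^{-(2δ+1)} ∑ h t (ζ i)²)^{1/2}`. -/
def SignalStrength (P : Measure Ξ) (K : ℕ → ℕ) (δ : ℝ) (ψ : ℕ → ℝ) : Prop :=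
  BigOP P (fun n _ => ψ n)
      (fun n ξ => √((K n : ℝ) ^ (-(2 * δ + 1)) * ∑ i, ∑ t, (θ.M n ξ i t) ^ 2)) ∧
    BigOP P (fun n ξ => √((K n : ℝ) ^ (-(2 * δ + 1)) * ∑ i, ∑ t, (θ.M n ξ i t) ^ 2))
      (fun n _ => ψ n)

end PanelModel

/-- The conditions on the size of the parameters and the signal-to-noise ratio, for the common
observation probability `p n` (so that `p_max = p_min` and `γ = 1`), entries observed independently
(so that the clusters are singletons and `ϑ = 1`), and groups with `a n` units and `b n` periods. -/
structure ParameterSize (N T K a b : ℕ → ℕ) (p η ψ : ℕ → ℝ) (ν δ g : ℝ) : Prop where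
  sample : (fun n => min (√(a n : ℝ)) (√(b n : ℝ)) *
      max 1 (Real.log (N n) + Real.log (T n)) * (η n) ^ 3 *
      (K n : ℝ) ^ (4 + 2 * g + 13 / 2 * δ) *
      max (√((N n : ℝ) * Real.log (N n))) (√((T n : ℝ) * Real.log (T n))))
    =o[atTop] fun n => (p n) ^ (3 / 2 : ℝ) * min (N n : ℝ) (T n : ℝ)
  signal : (fun n => min (√(a n : ℝ)) (√(b n : ℝ)) * (η n) ^ (1 / 2 : ℝ) *
      (K n : ℝ) ^ (1 + g + 7 / 2 * δ) * max ((N n : ℝ) ^ (3 / 2 : ℝ)) ((T n : ℝ) ^ (3 / 2 : ℝ)))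
    =o[atTop] fun n => (p n) ^ (3 / 2 : ℝ) * (ψ n) ^ 2
  smooth : (fun n => min (√(a n : ℝ)) (√(b n : ℝ)) * (η n) ^ (3 / 2 : ℝ) *
      max (√(N n : ℝ)) (√(T n : ℝ)))
    =o[atTop] fun n => (p n) ^ (1 / 2 : ℝ) * (K n : ℝ) ^ (ν - 2 * δ - 3 / 2)
  smooth_signal : (fun n => min (√(a n : ℝ)) (√(b n : ℝ)) * (η n) ^ (1 / 2 : ℝ) *
      max (√(N n : ℝ)) (√(T n : ℝ)) * √((N n : ℝ) * (T n : ℝ)))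
    =o[atTop] fun n => ψ n * (p n) ^ (1 / 2 : ℝ) * (K n : ℝ) ^ (ν - δ - 1 / 2)

namespace PanelModel

variable {Ξ : Type*} [MeasurableSpace Ξ] {N T : ℕ → ℕ} (θ : PanelModel Ξ N T)

/-- `βbar' (β'β)⁻¹ βbar`, where `βbar` is the mean of the loadings over `I`. It is the squared norm
of `|I|⁻¹ ∑_{i ∈ I} U i`, with `U i` the `i`-th row of the left singular vectors of `β F'`. -/
def leverageβ (k n : ℕ) (I : Finset (Fin (N n))) (ξ : Ξ) : ℝ :=
  quadForm ((θ.β k n ξ).transpose * θ.β k n ξ)⁻¹ (rowMean (θ.β k n ξ) I)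

/-- `Fbar' (F'F)⁻¹ Fbar`, where `Fbar` is the mean of the factors over `J`. It is the squared norm
of `|J|⁻¹ ∑_{t ∈ J} V t`, with `V t` the `t`-th row of the right singular vectors of `β F'`. -/
def leverageF (k n : ℕ) (J : Finset (Fin (T n))) (ξ : Ξ) : ℝ :=
  quadForm ((θ.F k n ξ).transpose * θ.F k n ξ)⁻¹ (rowMean (θ.F k n ξ) J)

/-- The bound `s_*²(M, p, σ)`. -/
def sStarSq (k n : ℕ) (I : Finset (Fin (N n))) (J : Finset (Fin (T n))) (ξ : Ξ) : ℝ :=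
  (θ.σ n) ^ 2 / (θ.p n : ℝ) * (1 / (J.card : ℝ)) * θ.leverageβ k n I ξ +
    (θ.σ n) ^ 2 / (θ.p n : ℝ) * (1 / (I.card : ℝ)) * θ.leverageF k n J ξ

/-- The asymptotic variance `𝒱_𝒢` of the estimator of the group average. -/
def asympVar (k n : ℕ) (I : Finset (Fin (N n))) (J : Finset (Fin (T n))) (ξ : Ξ)
    (x : Fin (N n) → Fin (T n) → Bool × ℝ) : ℝ :=
  (θ.σ n) ^ 2 / (J.card : ℝ) ^ 2 * ∑ t ∈ J, quadForm
      (∑ j, omegaVal x j t • Matrix.vecMulVec (θ.β k n ξ j) (θ.β k n ξ j))⁻¹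
      (rowMean (θ.β k n ξ) I) +
    (θ.σ n) ^ 2 / (I.card : ℝ) ^ 2 * ∑ i ∈ I, quadForm
      (∑ s, omegaVal x i s • Matrix.vecMulVec (θ.F k n ξ s) (θ.F k n ξ s))⁻¹
      (rowMean (θ.F k n ξ) J)

/-- The class `𝒜` of sequences of models, for the sieve dimensions `K n` and groups `I n × J n`. -/
structure InClass (P : Measure Ξ) (K : ℕ → ℕ) (I : (n : ℕ) → Finset (Fin (N n)))
    (J : (n : ℕ) → Finset (Fin (T n))) : Prop where
  p_pos : ∀ n, 0 < (θ.p n : ℝ)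
  noise_level : ∃ c C : ℝ, 0 < c ∧ ∀ n, c ≤ θ.σ n ∧ θ.σ n ≤ C
  sieve : ∃ (C ν δ g c : ℝ) (η ψ : ℕ → ℝ), 0 < ν ∧ 0 ≤ δ ∧ 0 ≤ g ∧ 0 < c ∧ (∀ n, 0 < η n) ∧
    (∀ n, 0 < ψ n) ∧ θ.SieveAssumption P K C ν δ g c η ∧ θ.SignalStrength P K δ ψ ∧
    ParameterSize N T K (fun n => (I n).card) (fun n => (J n).card) (fun n => (θ.p n : ℝ))
      η ψ ν δ g
  /-- The group means of the singular vectors of `β F'` do not degenerate. -/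
  nondegenerate : ∃ c : ℝ, 0 < c ∧
    (WithProbToOne P fun n ξ => c ≤ √((N n : ℝ) * θ.leverageβ (K n) n (I n) ξ)) ∧
    (WithProbToOne P fun n ξ => c ≤ √((T n : ℝ) * θ.leverageF (K n) n (J n) ξ))

/-- The expectation `E_{M,p,σ} U(Y, Ω)`, given the matrix `M`. -/
def meanU (n : ℕ) (U : (Fin (N n) → Fin (T n) → ℝ) × (Fin (N n) → Fin (T n) → Bool) → ℝ)
    (ξ : Ξ) : ℝ :=
  ∫ x, U (observed (θ.M n ξ) x) ∂(noiseLaw (N n) (T n) (θ.p n) (θ.σ n))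

/-- The mean squared error `E_{M,p,σ} [U(Y, Ω) - |𝒢|⁻¹ ∑ M i t]²`, given the matrix `M`. -/
def mse (n : ℕ) (U : (Fin (N n) → Fin (T n) → ℝ) × (Fin (N n) → Fin (T n) → Bool) → ℝ)
    (I : Finset (Fin (N n))) (J : Finset (Fin (T n))) (ξ : Ξ) : ENNReal :=
  ∫⁻ x, ENNReal.ofReal ((U (observed (θ.M n ξ) x) - blockMean (θ.M n ξ) I J) ^ 2)
    ∂(noiseLaw (N n) (T n) (θ.p n) (θ.σ n))

/-- Asymptotic unbiasedness along `θ`: `E_{M,p,σ} U(Y, Ω)` exists with probability converging to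
one, and `E_{M,p,σ} U(Y, Ω) - |𝒢|⁻¹ ∑ M i t = o(s_*(M, p, σ))` in probability. -/
def AsympUnbiased (P : Measure Ξ) (K : ℕ → ℕ) (I : (n : ℕ) → Finset (Fin (N n)))
    (J : (n : ℕ) → Finset (Fin (T n)))
    (U : (n : ℕ) → (Fin (N n) → Fin (T n) → ℝ) × (Fin (N n) → Fin (T n) → Bool) → ℝ) : Prop :=
  ∀ ε : ℝ, 0 < ε → WithProbToOne P fun n ξ =>
    Integrable (fun x => U n (observed (θ.M n ξ) x))
      (noiseLaw (N n) (T n) (θ.p n) (θ.σ n)) ∧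
    |θ.meanU n (U n) ξ - blockMean (θ.M n ξ) (I n) (J n)| ≤
      ε * √(θ.sStarSq (K n) n (I n) (J n) ξ)

end PanelModel

end

/-! ### Sequences of events -/

section StochasticOrderLemmas

variable {Ξ : Type*} [MeasurableSpace Ξ] {P : Measure Ξ}

/-! Part (a) is a local two-point argument. Each sequence θ in the class has a neighbour θ' in the
class whose mean matrix differs by a small Δ, and `U` is nearly unbiased under both. Hence E'U - EU
is nearly the block mean of Δ, and the Hammersley–Chapman–Robbins inequality `sq_integral_sub_le`
bounds the mean squared error below by (E'U - EU)²/χ². Here χ² is the chi-square divergence of the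
two laws of the data, about p‖Δ‖²/σ² when the entries of Δ are small
(`PanelModel.exp_divergence_le`). The bound is best for Δ along the projection of u_I u_J' on the
tangent space at βF' of the matrices of rank K, where u_I and u_J are the weight vectors of the
group means.

Let g and f be the projections of u_I and u_J on the column spaces of β and F, with residuals b and
d. The tangent projection is bf' + gd' + gf'; its squared norm is nearly L = `totalLev`, and s_*² =
σ²L/p. The part gf', whose squared norm is a product of two leverages, is negligible
(`PertSetup.leverage_mul_le`) and is dropped. The rest is realised by rotating the two column
spaces: each of β and F receives a rank-one change with a second-order correction that leaves β'β
and F'F exactly as they were (`LowerBdd.gram_rot`). So S_β, S_F, Q and all conditions on their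
singular values survive unchanged. With ‖Δ‖ about R = τσ/√p, the block mean of Δ is about R√L = τ
s_* and χ² is about τ². The ratio is about s_*², with an error that vanishes as n grows and then τ
decreases.

The neighbour has to be a model of the same kind. A state is extended by a sequence x of shifts, the
r-th basis function becomes φ_r(z) + x_r, and ρ is carried by x = 0. Loadings can then move freely
while L²(ρ) and the sieve error stay the same (`PanelModel.shifted`, `PanelModel.shifted_MR`). The
rate conditions make the perturbation small (`SmallStep.of_rateBound`), nondegeneracy makes it small
relative to the leverages, and the signal condition makes it small relative to M; this gives
`PanelModel.InClass.leastFav`.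

For part (b), Hoeffding's inequality and a union bound show that with high probability all thinned
Gram matrices lie between (1 - ε) and (1 + ε) times p β'β (respectively p F'F) in the semidefinite
order. Their inverses are then relatively close to those of p β'β and p F'F
(`LowerBdd.abs_quadForm_sub_le`), and averaging over the group gives s_*². -/

theorem WithProbToOne.mono {E E' : ℕ → Ξ → Prop} (h : WithProbToOne P E)
    (hE : ∀ᶠ n in atTop, ∀ ξ, E n ξ → E' n ξ) : WithProbToOne P E' := by
  refine tendsto_of_tendsto_of_tendsto_of_le_of_le' tendsto_const_nhds h
    (Eventually.of_forall fun _ => zero_le) ?_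
  filter_upwards [hE] with n hn
  exact measure_mono fun ξ hξ hE' => hξ (hn ξ hE')

theorem WithProbToOne.and {E E' : ℕ → Ξ → Prop} (h : WithProbToOne P E)
    (h' : WithProbToOne P E') : WithProbToOne P fun n ξ => E n ξ ∧ E' n ξ := by
  have h2 : Tendsto (fun n => P {ξ | ¬ E n ξ} + P {ξ | ¬ E' n ξ}) atTop (𝓝 0) := by
    simpa using Tendsto.add (show Tendsto _ _ _ from h) (show Tendsto _ _ _ from h')
  refine tendsto_of_tendsto_of_tendsto_of_le_of_le tendsto_const_nhds h2
    (fun _ => zero_le) fun n => ?_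
  refine (measure_mono fun ξ hξ => ?_).trans (measure_union_le _ _)
  by_cases hE : E n ξ
  · exact Or.inr fun hE' => hξ ⟨hE, hE'⟩
  · exact Or.inl hE

theorem WithProbToOne.of_ae {E : ℕ → Ξ → Prop} (h : ∀ n, ∀ᵐ ξ ∂P, E n ξ) :
    WithProbToOne P E := by
  have : (fun n => P {ξ | ¬ E n ξ}) = fun _ => 0 := funext fun n => ae_iff.mp (h n)
  unfold WithProbToOne
  rw [this]
  exact tendsto_const_nhds

/-- Whenever `A n` fails the event is empty and its complement has probability one, which can happen
only finitely often. This extracts deterministic facts, such as `1 ≤ K n` and a lower bound on η,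
from conditions that hold only on random events. -/
theorem WithProbToOne.eventually_of_const [IsProbabilityMeasure P] {E : ℕ → Ξ → Prop}
    {A : ℕ → Prop} (h : WithProbToOne P E) (hA : ∀ n ξ, E n ξ → A n) : ∀ᶠ n in atTop, A n := by
  have h1 : ∀ᶠ n in atTop, P {ξ | ¬ E n ξ} < 1 := h.eventually_lt_const zero_lt_one
  filter_upwards [h1] with n hn
  by_contra hA'
  have : {ξ | ¬ E n ξ} = Set.univ := Set.eq_univ_of_forall fun ξ hξ => hA' (hA n ξ hξ)
  simp [this] at hn

/-- Carries the O_P conditions over to the perturbed model, whose norms are comparable to the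
original ones with high probability. -/
theorem BigOP.mono {X Y X' Y' : ℕ → Ξ → ℝ} (h : BigOP P X Y) {c : ℝ} (hc : 0 ≤ c)
    (hX : WithProbToOne P fun n ξ => |X' n ξ| ≤ c * |X n ξ| ∧ |Y n ξ| ≤ c * |Y' n ξ|) :
    BigOP P X' Y' := by
  intro ε hε
  obtain ⟨B, hB⟩ := h (ε / 2) (by positivity)
  refine ⟨c * (|B| * c), ?_⟩
  have h1 : ∀ᶠ n in atTop, P {ξ | ¬ (|X' n ξ| ≤ c * |X n ξ| ∧ |Y n ξ| ≤ c * |Y' n ξ|)} <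
      ENNReal.ofReal (ε / 2) := Tendsto.eventually_lt_const (by simpa using hε) hX
  filter_upwards [hB, h1] with n hn hn1
  calc _ ≤ P ({ξ | ¬ |X n ξ| ≤ B * |Y n ξ|} ∪
        {ξ | ¬ (|X' n ξ| ≤ c * |X n ξ| ∧ |Y n ξ| ≤ c * |Y' n ξ|)}) := by
        refine measure_mono fun ξ hξ => ?_
        by_contra hcon
        simp only [Set.mem_union, Set.mem_ofPred_eq, not_or, not_not] at hcon
        obtain ⟨ha, hb, hd⟩ := hcon
        refine hξ ?_
        calc |X' n ξ| ≤ c * |X n ξ| := hb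
          _ ≤ c * (|B| * |Y n ξ|) := by
            gcongr
            exact ha.trans (by gcongr; exact le_abs_self B)
          _ ≤ c * (|B| * (c * |Y' n ξ|)) := by gcongr
          _ = _ := by ring
    _ ≤ _ := measure_union_le _ _
    _ ≤ ENNReal.ofReal (ε / 2) + ENNReal.ofReal (ε / 2) := add_le_add hn hn1.le
    _ = ENNReal.ofReal ε := by
      rw [← ENNReal.ofReal_add (by positivity) (by positivity), add_halves]

/-- A ratio that is bounded in probability by a diverging sequence's reciprocal vanishes. -/
theorem BigOP.exists_bound {X Y : ℕ → Ξ → ℝ} (h : BigOP P X Y) {r : ℕ → ℝ}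
    (hr : Tendsto r atTop atTop) :
    WithProbToOne P fun n ξ => |X n ξ| ≤ r n * |Y n ξ| := by
  refine ENNReal.tendsto_nhds_zero.2 fun δ hδ => ?_
  obtain ⟨ε, hε, hεδ⟩ : ∃ ε : ℝ, 0 < ε ∧ ENNReal.ofReal ε ≤ δ := by
    by_cases hd : δ = ⊤
    · exact ⟨1, one_pos, by simp [hd]⟩
    · exact ⟨δ.toReal, ENNReal.toReal_pos hδ.ne' hd, ENNReal.ofReal_toReal_le⟩
  obtain ⟨B, hB⟩ := h ε hε
  filter_upwards [hB, hr.eventually_ge_atTop B] with n hn hBn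
  refine (measure_mono (t := {ξ | ¬ |X n ξ| ≤ B * |Y n ξ|}) fun ξ hξ => ?_).trans (hn.trans hεδ)
  exact fun hcon : |X n ξ| ≤ B * |Y n ξ| => hξ (hcon.trans (by gcongr))

end StochasticOrderLemmas

/-! ### Euclidean norms of tuples -/

section Vnorm

variable {ι κ : Type*} [Fintype ι] [Fintype κ]

/-- The Euclidean norm of a tuple. -/
noncomputable def vnorm (v : ι → ℝ) : ℝ := ‖WithLp.toLp 2 v‖

theorem vnorm_nonneg (v : ι → ℝ) : 0 ≤ vnorm v := norm_nonneg _

theorem vnorm_sq' (v : ι → ℝ) : vnorm v ^ 2 = ∑ i, v i ^ 2 := by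
  simp [vnorm, EuclideanSpace.norm_sq_eq]

theorem vnorm_sq (v : ι → ℝ) : vnorm v ^ 2 = v ⬝ᵥ v := by
  rw [vnorm_sq']
  simp [dotProduct, sq]

theorem abs_dotProduct_le (v w : ι → ℝ) : |v ⬝ᵥ w| ≤ vnorm v * vnorm w := by
  have h := abs_real_inner_le_norm (WithLp.toLp 2 w) (WithLp.toLp 2 v)
  rw [EuclideanSpace.inner_toLp_toLp] at h
  simpa [vnorm, mul_comm] using h

theorem dotProduct_le_vnorm (v w : ι → ℝ) : v ⬝ᵥ w ≤ vnorm v * vnorm w :=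
  (le_abs_self _).trans (abs_dotProduct_le v w)

theorem vnorm_add_le (v w : ι → ℝ) : vnorm (v + w) ≤ vnorm v + vnorm w := by
  simpa [vnorm] using norm_add_le (WithLp.toLp 2 v) (WithLp.toLp 2 w)

theorem vnorm_sub_le (v w : ι → ℝ) : vnorm (v - w) ≤ vnorm v + vnorm w := by
  simpa [vnorm] using norm_sub_le (WithLp.toLp 2 v) (WithLp.toLp 2 w)

theorem vnorm_smul (c : ℝ) (v : ι → ℝ) : vnorm (c • v) = |c| * vnorm v := by
  simp [vnorm, norm_smul]

theorem abs_le_vnorm (v : ι → ℝ) (i : ι) : |v i| ≤ vnorm v := by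
  simpa [vnorm] using PiLp.norm_apply_le (WithLp.toLp 2 v) i

theorem vnorm_le_of_abs_le {v : ι → ℝ} {C : ℝ} (hC : 0 ≤ C) (h : ∀ i, |v i| ≤ C) :
    vnorm v ≤ √(Fintype.card ι) * C := by
  refine abs_le_of_sq_le_sq' ?_ (by positivity) |>.2
  rw [vnorm_sq', mul_pow, Real.sq_sqrt (by positivity)]
  calc _ ≤ ∑ _i : ι, C ^ 2 := Finset.sum_le_sum fun i _ => sq_le_sq' (by
        linarith [neg_abs_le (v i), h i]) ((le_abs_self _).trans (h i))
    _ = _ := by simp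

theorem sum_abs_le_vnorm (v : ι → ℝ) : ∑ i, |v i| ≤ √(Fintype.card ι) * vnorm v := by
  have h := dotProduct_le_vnorm (fun _ : ι => (1 : ℝ)) (fun i => |v i|)
  have h1 : vnorm (fun i => |v i|) = vnorm v := by
    have : vnorm (fun i => |v i|) ^ 2 = vnorm v ^ 2 := by simp [vnorm_sq']
    exact (sq_eq_sq₀ (vnorm_nonneg _) (vnorm_nonneg _)).1 this
  refine le_trans ?_ (h.trans ?_)
  · simp [dotProduct]
  · rw [h1]
    gcongr
    · exact vnorm_nonneg _
    · simpa using vnorm_le_of_abs_le (v := fun _ : ι => (1 : ℝ)) zero_le_one (by simp)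

theorem vnorm_outer (v : ι → ℝ) (w : κ → ℝ) :
    vnorm (fun z : ι × κ => v z.1 * w z.2) = vnorm v * vnorm w := by
  have : vnorm (fun z : ι × κ => v z.1 * w z.2) ^ 2 = (vnorm v * vnorm w) ^ 2 := by
    rw [mul_pow, vnorm_sq', vnorm_sq', vnorm_sq', Fintype.sum_prod_type, Finset.sum_mul_sum]
    simp [mul_pow]
  exact (sq_eq_sq₀ (vnorm_nonneg _) (mul_nonneg (vnorm_nonneg _) (vnorm_nonneg _))).1 this

theorem vnorm_le_iff_sq_le {v : ι → ℝ} {c : ℝ} (hc : 0 ≤ c) : vnorm v ≤ c ↔ v ⬝ᵥ v ≤ c ^ 2 := by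
  rw [← vnorm_sq, sq_le_sq₀ (vnorm_nonneg _) hc]

theorem vnorm_eq_sqrt (v : ι → ℝ) : vnorm v = √(v ⬝ᵥ v) := by
  rw [← vnorm_sq, Real.sqrt_sq (vnorm_nonneg _)]

end Vnorm

/-! ### Matrices with a lower bound -/

section LowerBound

open Matrix

variable {m k : ℕ}

/-- The matrix `B'B`. -/
abbrev gramMat (B : Matrix (Fin m) (Fin k) ℝ) : Matrix (Fin k) (Fin k) ℝ := B.transpose * B

/-- `B` is bounded below: `|y|² ≤ a |B y|²`. -/
def LowerBdd (B : Matrix (Fin m) (Fin k) ℝ) (a : ℝ) : Prop :=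
  ∀ y : Fin k → ℝ, y ⬝ᵥ y ≤ a * ((B *ᵥ y) ⬝ᵥ (B *ᵥ y))

theorem dotProduct_gram_mulVec (B : Matrix (Fin m) (Fin k) ℝ) (x y : Fin k → ℝ) :
    x ⬝ᵥ (gramMat B *ᵥ y) = (B *ᵥ x) ⬝ᵥ (B *ᵥ y) := by
  rw [← mulVec_mulVec, dotProduct_mulVec, vecMul_transpose]

variable {B : Matrix (Fin m) (Fin k) ℝ} {a : ℝ}

theorem LowerBdd.isUnit_det (h : LowerBdd B a) : IsUnit (gramMat B).det := by
  rw [isUnit_iff_ne_zero]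
  intro h0
  obtain ⟨v, hv, hv0⟩ := exists_mulVec_eq_zero_iff.2 h0
  have h1 := h v
  rw [← dotProduct_gram_mulVec, hv0, dotProduct_zero, mul_zero] at h1
  exact hv (dotProduct_self_eq_zero.1 (le_antisymm h1 (by rw [← vnorm_sq]; positivity)))

theorem LowerBdd.gram_mulVec_inv (h : LowerBdd B a) (v : Fin k → ℝ) :
    gramMat B *ᵥ ((gramMat B)⁻¹ *ᵥ v) = v := by
  rw [mulVec_mulVec, mul_nonsing_inv _ h.isUnit_det, one_mulVec]

theorem LowerBdd.quadForm_eq (h : LowerBdd B a) (v : Fin k → ℝ) :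
    quadForm (gramMat B)⁻¹ v = vnorm (B *ᵥ ((gramMat B)⁻¹ *ᵥ v)) ^ 2 := by
  rw [vnorm_sq, ← dotProduct_gram_mulVec, h.gram_mulVec_inv, dotProduct_comm]
  rfl

theorem LowerBdd.vnorm_inv_le (h : LowerBdd B a) (ha : 0 ≤ a) (v : Fin k → ℝ) :
    vnorm ((gramMat B)⁻¹ *ᵥ v) ≤ √a * vnorm (B *ᵥ ((gramMat B)⁻¹ *ᵥ v)) := by
  rw [vnorm_le_iff_sq_le (mul_nonneg (by positivity) (vnorm_nonneg _)), mul_pow,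
    Real.sq_sqrt ha, vnorm_sq]
  exact h _

/-- With w the lifted vector, |w|² = v'(B'B)⁻¹v ≤ |v| |(B'B)⁻¹v| ≤ |v| √a |w|, and one factor |w|
cancels. -/
theorem LowerBdd.vnorm_lift_le (h : LowerBdd B a) (ha : 0 ≤ a) (v : Fin k → ℝ) :
    vnorm (B *ᵥ ((gramMat B)⁻¹ *ᵥ v)) ≤ √a * vnorm v := by
  have h1 : vnorm (B *ᵥ ((gramMat B)⁻¹ *ᵥ v)) ^ 2 ≤
      vnorm v * (√a * vnorm (B *ᵥ ((gramMat B)⁻¹ *ᵥ v))) := by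
    rw [← h.quadForm_eq]
    refine (dotProduct_le_vnorm _ _).trans ?_
    gcongr
    · exact vnorm_nonneg _
    · exact h.vnorm_inv_le ha v
  rcases (vnorm_nonneg (B *ᵥ ((gramMat B)⁻¹ *ᵥ v))).eq_or_lt' with h0 | h0
  · rw [h0]; exact mul_nonneg (by positivity) (vnorm_nonneg _)
  · nlinarith

theorem LowerBdd.quadForm_le (h : LowerBdd B a) (ha : 0 ≤ a) (v : Fin k → ℝ) :
    quadForm (gramMat B)⁻¹ v ≤ a * vnorm v ^ 2 := by
  rw [h.quadForm_eq]
  calc _ ≤ (√a * vnorm v) ^ 2 := pow_le_pow_left₀ (vnorm_nonneg _) (h.vnorm_lift_le ha v) 2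
    _ = _ := by rw [mul_pow, Real.sq_sqrt ha]

theorem LowerBdd.mono {b : ℝ} (h : LowerBdd B a) (hab : a ≤ b) : LowerBdd B b := fun y =>
  (h y).trans (mul_le_mul_of_nonneg_right hab (by rw [← vnorm_sq]; positivity))

/-- The quadratic form of `B'B` is at least that of its smallest singular value. -/
theorem psi_mul_vnorm_le {k : ℕ} (A : Matrix (Fin k) (Fin k) ℝ) (y : Fin k → ℝ) :
    psi A (k - 1) * vnorm y ≤ vnorm (A *ᵥ y) := by
  rcases Nat.eq_zero_or_pos k with rfl | hk
  · have : y = 0 := Subsingleton.elim _ _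
    have h0 : vnorm y = 0 := by rw [this]; simp [vnorm]
    rw [h0, mul_zero]; exact vnorm_nonneg _
  set L := Matrix.toEuclideanLin A with hL
  have hn : Module.finrank ℝ (EuclideanSpace ℝ (Fin k)) = k := by simp
  set S := LinearMap.adjoint L ∘ₗ L with hS
  have hsym : S.IsSymmetric := L.isSymmetric_adjoint_comp_self
  set Y : EuclideanSpace ℝ (Fin k) := WithLp.toLp 2 y
  -- Singular values are counted from zero in decreasing order, so the one at `k - 1` is the
  -- smallest and its square bounds every eigenvalue of the adjoint composed with `L` from below.
  have hval : ∀ i : Fin k, psi A (k - 1) ^ 2 ≤ hsym.eigenvalues hn i := by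
    intro i
    have h1 := L.sq_singularValues_of_lt hn (i := k - 1) (by omega)
    have h2 := hsym.eigenvalues_antitone hn (show i ≤ ⟨k - 1, by omega⟩ from by
      rw [Fin.le_def]; simp only; omega)
    unfold psi
    rw [← hL, h1]
    exact h2
  have key : psi A (k - 1) ^ 2 * ‖Y‖ ^ 2 ≤ ‖L Y‖ ^ 2 := by
    have e1 : ‖L Y‖ ^ 2 = inner ℝ (S Y) Y := by
      rw [hS, LinearMap.comp_apply, LinearMap.adjoint_inner_left, real_inner_self_eq_norm_sq]
    have e2 : inner ℝ (S Y) Y = ∑ i, hsym.eigenvalues hn i *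
        (hsym.eigenvectorBasis hn).repr Y i ^ 2 := by
      rw [← (hsym.eigenvectorBasis hn).repr.inner_map_map, PiLp.inner_apply]
      refine Finset.sum_congr rfl fun i _ => ?_
      rw [hsym.eigenvectorBasis_apply_self_apply hn]
      simp; ring
    have e3 : ‖Y‖ ^ 2 = ∑ i, (hsym.eigenvectorBasis hn).repr Y i ^ 2 := by
      rw [← (hsym.eigenvectorBasis hn).repr.norm_map, EuclideanSpace.norm_sq_eq]
      simp
    rw [e1, e2, e3, Finset.mul_sum]
    exact Finset.sum_le_sum fun i _ => mul_le_mul_of_nonneg_right (hval i) (sq_nonneg _)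
  have e4 : L Y = WithLp.toLp 2 (A *ᵥ y) := by
    simp [hL, Y]
  rw [← mul_pow, e4] at key
  exact abs_le_of_sq_le_sq' key (norm_nonneg _) |>.2

/-- With z = S⁻¹y, Cauchy–Schwarz in the form of S gives |y|⁴ ≤ (y'Sy)(z'Sz). Since z'Sz = z'y ≤
q⁻¹|y|², with q the smallest singular value, a factor |y|² cancels. -/
theorem lowerBdd_of_psi {N : ℕ} {η : ℝ} (hN : 0 < N) (B : Matrix (Fin N) (Fin k) ℝ)
    (hpos : 0 < psi ((N : ℝ)⁻¹ • (B.transpose * B)) (k - 1))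
    (hη : (psi ((N : ℝ)⁻¹ • (B.transpose * B)) (k - 1))⁻¹ < η) :
    LowerBdd B (η / N) := by
  set S := (N : ℝ)⁻¹ • (B.transpose * B) with hS
  set q := psi S (k - 1) with hq
  have hN' : (0 : ℝ) < N := by exact_mod_cast hN
  have hform : ∀ x y, x ⬝ᵥ (S *ᵥ y) = (N : ℝ)⁻¹ * ((B *ᵥ x) ⬝ᵥ (B *ᵥ y)) := by
    intro x y
    rw [hS, smul_mulVec, dotProduct_smul, dotProduct_gram_mulVec, smul_eq_mul]
  have hunit : IsUnit S.det := by
    rw [isUnit_iff_ne_zero]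
    intro h0
    obtain ⟨v, hv, hv0⟩ := exists_mulVec_eq_zero_iff.2 h0
    have h1 := psi_mul_vnorm_le S v
    have h2 : vnorm (S *ᵥ v) = 0 := by rw [hv0]; simp [vnorm]
    rw [h2, ← hq] at h1
    have h3 : vnorm v = 0 := le_antisymm (by by_contra hc; push Not at hc; nlinarith)
      (vnorm_nonneg _)
    refine hv (dotProduct_self_eq_zero.1 ?_)
    rw [← vnorm_sq, h3]; simp
  have hmain : LowerBdd B (q⁻¹ / N) := by
    intro y
    set z := S⁻¹ *ᵥ y with hz
    have hSz : S *ᵥ z = y := by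
      rw [hz, mulVec_mulVec, mul_nonsing_inv _ hunit, one_mulVec]
    have h1 : y ⬝ᵥ y = (N : ℝ)⁻¹ * ((B *ᵥ y) ⬝ᵥ (B *ᵥ z)) := by rw [← hform, hSz]
    have h2 : z ⬝ᵥ y = (N : ℝ)⁻¹ * ((B *ᵥ z) ⬝ᵥ (B *ᵥ z)) := by rw [← hform, hSz]
    have h3 : vnorm z ≤ q⁻¹ * vnorm y := by
      have := psi_mul_vnorm_le S z
      rw [hSz] at this
      rw [inv_mul_eq_div, le_div_iff₀ hpos, mul_comm]; exact this
    have h4 : z ⬝ᵥ y ≤ q⁻¹ * vnorm y ^ 2 := by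
      refine (dotProduct_le_vnorm z y).trans ?_
      nlinarith [vnorm_nonneg y]
    have h5 : (y ⬝ᵥ y) ^ 2 ≤ ((N : ℝ)⁻¹ * vnorm (B *ᵥ y) ^ 2) * ((N : ℝ)⁻¹ * vnorm (B *ᵥ z) ^ 2) := by
      have := abs_dotProduct_le (B *ᵥ y) (B *ᵥ z)
      rw [h1, mul_pow]
      have h6 : ((B *ᵥ y) ⬝ᵥ (B *ᵥ z)) ^ 2 ≤ (vnorm (B *ᵥ y) * vnorm (B *ᵥ z)) ^ 2 := by
        rw [← sq_abs]; exact pow_le_pow_left₀ (abs_nonneg _) this 2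
      calc _ ≤ (N : ℝ)⁻¹ ^ 2 * (vnorm (B *ᵥ y) * vnorm (B *ᵥ z)) ^ 2 := by gcongr
        _ = _ := by ring
    rw [vnorm_sq (B *ᵥ z), ← h2] at h5
    rw [vnorm_sq] at h4
    rw [vnorm_sq] at h5
    rw [div_mul_eq_mul_div, mul_div_assoc, div_eq_inv_mul]
    set Y := y ⬝ᵥ y
    set W := (N : ℝ)⁻¹ * ((B *ᵥ y) ⬝ᵥ (B *ᵥ y))
    have hY : 0 ≤ Y := by rw [show Y = vnorm y ^ 2 from (vnorm_sq y).symm]; positivity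
    have hW : 0 ≤ W := by
      rw [show W = (N : ℝ)⁻¹ * vnorm (B *ᵥ y) ^ 2 by rw [vnorm_sq]]; positivity
    rcases hY.eq_or_lt' with h0 | h0
    · rw [h0]; positivity
    · have h7 : Y * Y ≤ (q⁻¹ * W) * Y := by nlinarith
      exact le_of_mul_le_mul_right h7 h0
  exact hmain.mono (by gcongr)

end LowerBound

/-! ### Rotating the loadings and the factors -/

section Rotation

open Matrix

variable {m l k : ℕ}

/-- The vector of weights of the mean over `I`. -/
noncomputable def unifVec (I : Finset (Fin m)) : Fin m → ℝ :=
  fun i => if i ∈ I then (I.card : ℝ)⁻¹ else 0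

/-- The coefficients of the least squares projection of `unifVec I` on the columns of `B`. -/
noncomputable def coefVec (B : Matrix (Fin m) (Fin k) ℝ) (I : Finset (Fin m)) : Fin k → ℝ :=
  (gramMat B)⁻¹ *ᵥ rowMean B I

/-- The shortest vector `w` with `B' w = v`. -/
noncomputable def liftVec (B : Matrix (Fin m) (Fin k) ℝ) (v : Fin k → ℝ) : Fin m → ℝ :=
  B *ᵥ ((gramMat B)⁻¹ *ᵥ v)

/-- The least squares projection of `unifVec I` on the columns of `B`. -/
noncomputable def projVec (B : Matrix (Fin m) (Fin k) ℝ) (I : Finset (Fin m)) : Fin m → ℝ :=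
  B *ᵥ coefVec B I

/-- The residual of the projection of `unifVec I` on the columns of `B`. -/
noncomputable def residVec (B : Matrix (Fin m) (Fin k) ℝ) (I : Finset (Fin m)) : Fin m → ℝ :=
  unifVec I - projVec B I

/-- The squared norm of the projection of `unifVec I` on the columns of `B`. -/
noncomputable def leverage (B : Matrix (Fin m) (Fin k) ℝ) (I : Finset (Fin m)) : ℝ :=
  quadForm (gramMat B)⁻¹ (rowMean B I)

/-- The coefficient of the direction `w` in a rotation that moves `w` by `s b` orthogonally. -/
noncomputable def rotCoef (s : ℝ) (b w : Fin m → ℝ) : ℝ :=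
  (1 - √(1 - s ^ 2 * (w ⬝ᵥ w) * (b ⬝ᵥ b))) / (w ⬝ᵥ w)

/-- The direction in which the rows of `B` move along `v` when the column space of `B` is rotated
in the plane of `liftVec B v` and `residVec B I`. -/
noncomputable def rotVec (s : ℝ) (B : Matrix (Fin m) (Fin k) ℝ) (I : Finset (Fin m))
    (v : Fin k → ℝ) : Fin m → ℝ :=
  s • residVec B I - rotCoef s (residVec B I) (liftVec B v) • liftVec B v

theorem unifVec_dotProduct (I : Finset (Fin m)) (v : Fin m → ℝ) :
    unifVec I ⬝ᵥ v = (∑ i ∈ I, v i) / (I.card : ℝ) := by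
  simp [unifVec, dotProduct, ite_mul, Finset.sum_ite_mem, ← Finset.mul_sum, div_eq_inv_mul]

theorem rowMean_eq (B : Matrix (Fin m) (Fin k) ℝ) (I : Finset (Fin m)) :
    rowMean B I = B.transpose *ᵥ unifVec I := by
  ext r
  rw [mulVec, dotProduct_comm, unifVec_dotProduct]
  rfl

theorem vnorm_unifVec {I : Finset (Fin m)} (hI : I.Nonempty) :
    vnorm (unifVec I) = (√(I.card : ℝ))⁻¹ := by
  have h : (0 : ℝ) < I.card := by exact_mod_cast hI.card_pos
  rw [vnorm_eq_sqrt, unifVec_dotProduct, ← Real.sqrt_inv]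
  congr 1
  rw [Finset.sum_congr rfl fun i hi => show unifVec I i = (I.card : ℝ)⁻¹ from if_pos hi]
  simp; field_simp

theorem blockMean_eq (A : Matrix (Fin m) (Fin l) ℝ) (I : Finset (Fin m)) (J : Finset (Fin l)) :
    blockMean A I J = unifVec I ⬝ᵥ (A *ᵥ unifVec J) := by
  have h : ∀ i, (A *ᵥ unifVec J) i = (∑ t ∈ J, A i t) / (J.card : ℝ) := fun i => by
    rw [mulVec, dotProduct_comm, unifVec_dotProduct]
  rw [unifVec_dotProduct, blockMean]
  simp_rw [h]
  rw [← Finset.sum_div, div_div, mul_comm (J.card : ℝ)]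

variable {B : Matrix (Fin m) (Fin k) ℝ} {a : ℝ} {I : Finset (Fin m)}

theorem projVec_eq_liftVec (B : Matrix (Fin m) (Fin k) ℝ) (I : Finset (Fin m)) :
    projVec B I = liftVec B (rowMean B I) := rfl

theorem LowerBdd.transpose_liftVec (h : LowerBdd B a) (v : Fin k → ℝ) :
    B.transpose *ᵥ liftVec B v = v := by
  rw [liftVec, mulVec_mulVec]; exact h.gram_mulVec_inv v

theorem LowerBdd.leverage_eq (h : LowerBdd B a) (I : Finset (Fin m)) :
    leverage B I = vnorm (projVec B I) ^ 2 := h.quadForm_eq _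

theorem LowerBdd.leverage_nonneg (h : LowerBdd B a) (I : Finset (Fin m)) : 0 ≤ leverage B I := by
  rw [h.leverage_eq]; positivity

theorem LowerBdd.transpose_residVec (h : LowerBdd B a) (I : Finset (Fin m)) :
    B.transpose *ᵥ residVec B I = 0 := by
  rw [residVec, mulVec_sub, projVec_eq_liftVec, h.transpose_liftVec, rowMean_eq, sub_self]

theorem LowerBdd.mulVec_dot_residVec (h : LowerBdd B a) (y : Fin k → ℝ) :
    (B *ᵥ y) ⬝ᵥ residVec B I = 0 := by
  rw [dotProduct_comm, dotProduct_mulVec, ← mulVec_transpose, h.transpose_residVec, zero_dotProduct]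

theorem unifVec_eq_add (B : Matrix (Fin m) (Fin k) ℝ) (I : Finset (Fin m)) :
    unifVec I = projVec B I + residVec B I := by simp [residVec]

theorem LowerBdd.unifVec_dot_residVec (h : LowerBdd B a) :
    unifVec I ⬝ᵥ residVec B I = vnorm (residVec B I) ^ 2 := by
  rw [unifVec_eq_add B I, add_dotProduct, projVec, h.mulVec_dot_residVec, zero_add, vnorm_sq]

theorem LowerBdd.unifVec_dot_projVec (h : LowerBdd B a) :
    unifVec I ⬝ᵥ projVec B I = leverage B I := by
  conv_lhs => rw [unifVec_eq_add B I]
  rw [add_dotProduct, dotProduct_comm (residVec B I), h.leverage_eq, vnorm_sq]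
  simp only [projVec, h.mulVec_dot_residVec, add_zero]

theorem LowerBdd.vnorm_residVec_sq (h : LowerBdd B a) (hI : I.Nonempty) :
    vnorm (residVec B I) ^ 2 = (I.card : ℝ)⁻¹ - leverage B I := by
  have h1 : vnorm (unifVec I) ^ 2 = vnorm (projVec B I) ^ 2 + vnorm (residVec B I) ^ 2 := by
    have h2 : projVec B I ⬝ᵥ residVec B I = 0 := h.mulVec_dot_residVec _
    conv_lhs => rw [unifVec_eq_add B I]
    rw [vnorm_sq, vnorm_sq, vnorm_sq, add_dotProduct, dotProduct_add, dotProduct_add, h2,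
      dotProduct_comm (residVec B I) (projVec B I), h2]
    ring
  rw [vnorm_unifVec hI, inv_pow, Real.sq_sqrt (by positivity), ← h.leverage_eq] at h1
  linarith

theorem LowerBdd.vnorm_residVec_le (h : LowerBdd B a) (hI : I.Nonempty) :
    vnorm (residVec B I) ≤ (√(I.card : ℝ))⁻¹ := by
  refine abs_le_of_sq_le_sq' ?_ (by positivity) |>.2
  rw [h.vnorm_residVec_sq hI, inv_pow, Real.sq_sqrt (by positivity)]
  linarith [h.leverage_nonneg I]

theorem rotCoef_nonneg (s : ℝ) (b w : Fin m → ℝ) : 0 ≤ rotCoef s b w := by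
  have hw : 0 ≤ w ⬝ᵥ w := by rw [← vnorm_sq]; positivity
  have hb : 0 ≤ b ⬝ᵥ b := by rw [← vnorm_sq]; positivity
  refine div_nonneg ?_ hw
  have : √(1 - s ^ 2 * (w ⬝ᵥ w) * (b ⬝ᵥ b)) ≤ 1 :=
    Real.sqrt_le_one.2 (by have : 0 ≤ s ^ 2 * (w ⬝ᵥ w) * (b ⬝ᵥ b) := by positivity
                           linarith)
  linarith

/-- From 1 - √(1 - t) ≤ t on [0, 1]: the correction along w is of second order in the angle s. -/
theorem rotCoef_mul_le {s : ℝ} {b w : Fin m → ℝ} (h1 : s ^ 2 * (w ⬝ᵥ w) * (b ⬝ᵥ b) ≤ 1) :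
    rotCoef s b w * vnorm w ≤ s ^ 2 * vnorm b ^ 2 * vnorm w := by
  have hw : 0 ≤ w ⬝ᵥ w := by rw [← vnorm_sq]; positivity
  have hb : 0 ≤ b ⬝ᵥ b := by rw [← vnorm_sq]; positivity
  rcases hw.eq_or_lt' with h0 | h0
  · have : vnorm w = 0 := by rw [vnorm_eq_sqrt, h0, Real.sqrt_zero]
    simp [this]
  · refine mul_le_mul_of_nonneg_right ?_ (vnorm_nonneg w)
    rw [rotCoef, div_le_iff₀ h0, vnorm_sq]
    have h3 : 0 ≤ s ^ 2 * (w ⬝ᵥ w) * (b ⬝ᵥ b) := by positivity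
    have h2 : 1 - s ^ 2 * (w ⬝ᵥ w) * (b ⬝ᵥ b) ≤ √(1 - s ^ 2 * (w ⬝ᵥ w) * (b ⬝ᵥ b)) :=
      Real.le_sqrt_of_sq_le (by nlinarith)
    nlinarith

/-- `rotCoef` is the smaller root of this quadratic equation, which says that the terms added to the
Gram matrix cancel. -/
theorem rotCoef_identity {s : ℝ} {b w : Fin m → ℝ} (hw : w ⬝ᵥ w ≠ 0)
    (h1 : s ^ 2 * (w ⬝ᵥ w) * (b ⬝ᵥ b) ≤ 1) :
    rotCoef s b w ^ 2 * (w ⬝ᵥ w) - 2 * rotCoef s b w + s ^ 2 * (b ⬝ᵥ b) = 0 := by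
  rw [rotCoef]
  have h2 := Real.sq_sqrt (sub_nonneg.2 h1)
  set r := √(1 - s ^ 2 * (w ⬝ᵥ w) * (b ⬝ᵥ b))
  field_simp
  linear_combination h2

/-- Put p = s b - γ w with b the residual and w the lift of v. Since B'b = 0 and B'w = v, B'p = -γv;
since b ⊥ w, |p|² = s²|b|² + γ²|w|². The Gram matrix of B + pv' therefore gains (|p|² - 2γ) vv', and
γ was chosen to make this zero. The bound on s is what makes the square root in γ real. -/
theorem LowerBdd.gram_rot (h : LowerBdd B a) {s : ℝ} (v : Fin k → ℝ)
    (h1 : s ^ 2 * (liftVec B v ⬝ᵥ liftVec B v) * (residVec B I ⬝ᵥ residVec B I) ≤ 1) :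
    gramMat (B + vecMulVec (rotVec s B I v) v) = gramMat B := by
  by_cases hw : liftVec B v ⬝ᵥ liftVec B v = 0
  · have : v = 0 := by
      rw [← h.transpose_liftVec v, dotProduct_self_eq_zero.1 hw, mulVec_zero]
    rw [this]
    have h0 : ∀ p : Fin m → ℝ, vecMulVec p (0 : Fin k → ℝ) = 0 := fun p => by
      ext; simp [vecMulVec]
    rw [h0, add_zero]
  set p := rotVec s B I v with hp
  set γ := rotCoef s (residVec B I) (liftVec B v)
  have hBp : B.transpose *ᵥ p = -γ • v := by
    rw [hp, rotVec, mulVec_sub, mulVec_smul, mulVec_smul, h.transpose_liftVec,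
      h.transpose_residVec, smul_zero, zero_sub, neg_smul]
  have hpp : p ⬝ᵥ p = s ^ 2 * (residVec B I ⬝ᵥ residVec B I) +
      γ ^ 2 * (liftVec B v ⬝ᵥ liftVec B v) := by
    have h0 : liftVec B v ⬝ᵥ residVec B I = 0 := h.mulVec_dot_residVec _
    rw [hp, rotVec, sub_dotProduct, dotProduct_sub, dotProduct_sub]
    simp only [smul_dotProduct, dotProduct_smul, smul_eq_mul, h0,
      dotProduct_comm (residVec B I) (liftVec B v)]
    ring
  have hid := rotCoef_identity hw h1
  ext r q
  have hr : ∀ r, ∑ i, B i r * p i = -γ * v r := fun r => by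
    have := congrFun hBp r
    simpa [mulVec, dotProduct] using this
  simp only [gramMat, mul_apply, transpose_apply, Matrix.add_apply, vecMulVec_apply]
  have e : ∀ i, (B i r + p i * v r) * (B i q + p i * v q) = B i r * B i q +
      (B i r * p i) * v q + (B i q * p i) * v r + (p i * p i) * (v r * v q) := fun i => by ring
  simp_rw [e, Finset.sum_add_distrib, ← Finset.sum_mul]
  rw [hr, hr, show ∑ i, p i * p i = p ⬝ᵥ p from rfl, hpp]
  linear_combination (v r * v q) * hid

end Rotation

/-! ### Size of the rotation of one factor. -/

section RotationBounds

open Matrix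

variable {m l k : ℕ} {B : Matrix (Fin m) (Fin k) ℝ} {F : Matrix (Fin l) (Fin k) ℝ}
  {I : Finset (Fin m)} {J : Finset (Fin l)} {a a' R : ℝ}

theorem LowerBdd.rotCoef_mul_vnorm_le {s κ : ℝ} (hs : 0 ≤ s) (v : Fin k → ℝ)
    (hκ : s * vnorm (residVec B I) * vnorm (liftVec B v) ≤ κ) (hκ1 : κ ≤ 1) :
    rotCoef s (residVec B I) (liftVec B v) * vnorm (liftVec B v) ≤
      κ * (s * vnorm (residVec B I)) := by
  have h0 : 0 ≤ s * vnorm (residVec B I) := mul_nonneg hs (vnorm_nonneg _)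
  have h1 : 0 ≤ s * vnorm (residVec B I) * vnorm (liftVec B v) := mul_nonneg h0 (vnorm_nonneg _)
  refine (rotCoef_mul_le ?_).trans ?_
  · rw [← vnorm_sq, ← vnorm_sq]
    have := pow_le_one₀ h1 (hκ.trans hκ1) (n := 2)
    linarith [this, show (s * vnorm (residVec B I) * vnorm (liftVec B v)) ^ 2 =
      s ^ 2 * vnorm (liftVec B v) ^ 2 * vnorm (residVec B I) ^ 2 by ring]
  · calc _ = (s * vnorm (residVec B I) * vnorm (liftVec B v)) * (s * vnorm (residVec B I)) := by ring
      _ ≤ _ := by gcongr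

theorem vnorm_rotVec_le {s κ : ℝ} (hs : 0 ≤ s) (v : Fin k → ℝ)
    (hκ : s * vnorm (residVec B I) * vnorm (liftVec B v) ≤ κ) (hκ1 : κ ≤ 1) :
    vnorm (rotVec s B I v) ≤ 2 * (s * vnorm (residVec B I)) := by
  have h0 : 0 ≤ s * vnorm (residVec B I) := mul_nonneg hs (vnorm_nonneg _)
  have h1 := LowerBdd.rotCoef_mul_vnorm_le hs v hκ hκ1
  refine (vnorm_sub_le _ _).trans ?_
  rw [vnorm_smul, vnorm_smul, abs_of_nonneg hs, abs_of_nonneg (rotCoef_nonneg _ _ _)]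
  nlinarith

theorem abs_unifVec_dot_rotVec_le {s κ : ℝ} (hI : I.Nonempty) (hs : 0 ≤ s) (v : Fin k → ℝ)
    (hκ : s * vnorm (residVec B I) * vnorm (liftVec B v) ≤ κ) (hκ1 : κ ≤ 1) :
    |unifVec I ⬝ᵥ rotVec s B I v| ≤ 2 * (s * vnorm (residVec B I)) * (√(I.card : ℝ))⁻¹ := by
  refine (abs_dotProduct_le _ _).trans ?_
  rw [vnorm_unifVec hI, mul_comm]
  gcongr
  exact vnorm_rotVec_le hs v hκ hκ1

theorem LowerBdd.abs_unifVec_dot_rotVec_sub_le (h : LowerBdd B a) {s κ : ℝ} (hI : I.Nonempty)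
    (hs : 0 ≤ s) (v : Fin k → ℝ)
    (hκ : s * vnorm (residVec B I) * vnorm (liftVec B v) ≤ κ) (hκ1 : κ ≤ 1) :
    |unifVec I ⬝ᵥ rotVec s B I v - s * vnorm (residVec B I) ^ 2| ≤
      κ * (s * vnorm (residVec B I)) * (√(I.card : ℝ))⁻¹ := by
  rw [rotVec, dotProduct_sub, dotProduct_smul, dotProduct_smul, h.unifVec_dot_residVec, smul_eq_mul,
    sub_sub_cancel_left, smul_eq_mul, abs_neg, abs_mul, abs_of_nonneg (rotCoef_nonneg _ _ _)]
  calc _ ≤ rotCoef s (residVec B I) (liftVec B v) *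
        ((√(I.card : ℝ))⁻¹ * vnorm (liftVec B v)) := by
        refine mul_le_mul_of_nonneg_left ?_ (rotCoef_nonneg _ _ _)
        rw [← vnorm_unifVec hI]
        exact abs_dotProduct_le _ _
    _ = rotCoef s (residVec B I) (liftVec B v) * vnorm (liftVec B v) * (√(I.card : ℝ))⁻¹ := by ring
    _ ≤ _ := by
        refine mul_le_mul_of_nonneg_right ?_ (by positivity)
        exact LowerBdd.rotCoef_mul_vnorm_le hs v hκ hκ1

/-- The squared norm, up to a negligible term, of the projection of the weights of a group mean on
the tangent space at `B F'` of the matrices of rank `k`. -/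
noncomputable def totalLev (B : Matrix (Fin m) (Fin k) ℝ) (F : Matrix (Fin l) (Fin k) ℝ)
    (I : Finset (Fin m)) (J : Finset (Fin l)) : ℝ :=
  leverage B I / (J.card : ℝ) + leverage F J / (I.card : ℝ)

theorem totalLev_comm : totalLev B F I J = totalLev F B J I := add_comm _ _

/-- The angle of the rotation, scaled to a perturbation of size `R`. -/
noncomputable def rotStep (R : ℝ) (B : Matrix (Fin m) (Fin k) ℝ) (F : Matrix (Fin l) (Fin k) ℝ)
    (I : Finset (Fin m)) (J : Finset (Fin l)) : ℝ := R / √(totalLev B F I J)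

theorem rotStep_comm : rotStep R B F I J = rotStep R F B J I := by rw [rotStep, totalLev_comm]; rfl

/-- The change of the loadings `B` in the least favourable direction. -/
noncomputable def rotPert (R : ℝ) (B : Matrix (Fin m) (Fin k) ℝ) (F : Matrix (Fin l) (Fin k) ℝ)
    (I : Finset (Fin m)) (J : Finset (Fin l)) : Matrix (Fin m) (Fin k) ℝ :=
  vecMulVec (rotVec (rotStep R B F I J) B I (coefVec F J)) (coefVec F J)

theorem rotStep_nonneg (hR : 0 ≤ R) : 0 ≤ rotStep R B F I J := div_nonneg hR (Real.sqrt_nonneg _)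

theorem rotStep_sq_mul (hL : 0 < totalLev B F I J) :
    rotStep R B F I J ^ 2 * totalLev B F I J = R ^ 2 := by
  rw [rotStep, div_pow, Real.sq_sqrt hL.le, div_mul_cancel₀ _ hL.ne']

/-- The step satisfies s²L = R², and L contains the summand |f|²/|I| with f the projection of the
weights of J. -/
theorem LowerBdd.rotStep_mul_proj_le (hB : LowerBdd B a) (hF : LowerBdd F a') (hR : 0 ≤ R)
    (hL : 0 < totalLev B F I J) :
    rotStep R B F I J * (√(I.card : ℝ))⁻¹ * vnorm (projVec F J) ≤ R := by
  refine abs_le_of_sq_le_sq' ?_ hR |>.2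
  rw [← rotStep_sq_mul (R := R) (B := B) (F := F) (I := I) (J := J) hL, mul_pow, mul_pow, inv_pow,
    Real.sq_sqrt (by positivity), ← hF.leverage_eq, mul_assoc]
  refine mul_le_mul_of_nonneg_left ?_ (sq_nonneg _)
  have h1 : 0 ≤ leverage B I / (J.card : ℝ) := div_nonneg (hB.leverage_nonneg I) (by positivity)
  rw [inv_mul_eq_div, totalLev]
  linarith

theorem LowerBdd.rotStep_mul_resid_mul_proj_le (hB : LowerBdd B a) (hF : LowerBdd F a')
    (hI : I.Nonempty) (hR : 0 ≤ R) (hL : 0 < totalLev B F I J) :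
    rotStep R B F I J * vnorm (residVec B I) * vnorm (projVec F J) ≤ R := by
  refine le_trans ?_ (hB.rotStep_mul_proj_le hF hR hL)
  gcongr
  · exact vnorm_nonneg _
  · exact rotStep_nonneg hR
  · exact hB.vnorm_residVec_le hI

theorem LowerBdd.vnorm_coefVec_le (hF : LowerBdd F a') (ha' : 0 ≤ a') (J : Finset (Fin l)) :
    vnorm (coefVec F J) ≤ √a' * vnorm (projVec F J) := hF.vnorm_inv_le ha' _

theorem LowerBdd.rotStep_mul_resid_mul_coef_le (hB : LowerBdd B a) (hF : LowerBdd F a')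
    (ha' : 0 ≤ a') (hI : I.Nonempty) (hR : 0 ≤ R) (hL : 0 < totalLev B F I J) :
    rotStep R B F I J * vnorm (residVec B I) * vnorm (coefVec F J) ≤ √a' * R := by
  have h0 : 0 ≤ rotStep R B F I J * vnorm (residVec B I) :=
    mul_nonneg (rotStep_nonneg hR) (vnorm_nonneg _)
  calc _ ≤ rotStep R B F I J * vnorm (residVec B I) * (√a' * vnorm (projVec F J)) := by
        gcongr
        exact hF.vnorm_coefVec_le ha' J
    _ = √a' * (rotStep R B F I J * vnorm (residVec B I) * vnorm (projVec F J)) := by ring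
    _ ≤ _ := by
        refine mul_le_mul_of_nonneg_left ?_ (by positivity)
        exact hB.rotStep_mul_resid_mul_proj_le hF hI hR hL

/-- The left side is the sine of the rotation angle. The quantity κ = √a √a' R that bounds it is the
small parameter of all second-order estimates below. -/
theorem LowerBdd.rotStep_mul_resid_mul_lift_le (hB : LowerBdd B a) (hF : LowerBdd F a')
    (ha : 0 ≤ a) (ha' : 0 ≤ a') (hI : I.Nonempty) (hR : 0 ≤ R) (hL : 0 < totalLev B F I J) :
    rotStep R B F I J * vnorm (residVec B I) * vnorm (liftVec B (coefVec F J)) ≤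
      √a * √a' * R := by
  have h0 : 0 ≤ rotStep R B F I J * vnorm (residVec B I) :=
    mul_nonneg (rotStep_nonneg hR) (vnorm_nonneg _)
  calc _ ≤ rotStep R B F I J * vnorm (residVec B I) * (√a * vnorm (coefVec F J)) := by
        gcongr
        exact hB.vnorm_lift_le ha _
    _ = √a * (rotStep R B F I J * vnorm (residVec B I) * vnorm (coefVec F J)) := by ring
    _ ≤ √a * (√a' * R) := by
        refine mul_le_mul_of_nonneg_left ?_ (by positivity)
        exact hB.rotStep_mul_resid_mul_coef_le hF ha' hI hR hL
    _ = _ := by ring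

variable (hB : LowerBdd B a) (hF : LowerBdd F a') (ha : 0 ≤ a) (ha' : 0 ≤ a')
  (hI : I.Nonempty) (hJ : J.Nonempty) (hR : 0 ≤ R) (hL : 0 < totalLev B F I J)
  (hκ : √a * √a' * R ≤ 1)

include hB hF ha ha' hI hR hL hκ

theorem gram_add_rotPert : gramMat (B + rotPert R B F I J) = gramMat B := by
  refine hB.gram_rot _ ?_
  have h1 := hB.rotStep_mul_resid_mul_lift_le hF ha ha' hI hR hL
  have h2 : 0 ≤ rotStep R B F I J * vnorm (residVec B I) * vnorm (liftVec B (coefVec F J)) :=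
    mul_nonneg (mul_nonneg (rotStep_nonneg hR) (vnorm_nonneg _)) (vnorm_nonneg _)
  rw [← vnorm_sq, ← vnorm_sq]
  calc _ = (rotStep R B F I J * vnorm (residVec B I) * vnorm (liftVec B (coefVec F J))) ^ 2 := by
        ring
    _ ≤ 1 := pow_le_one₀ h2 (h1.trans hκ)

theorem vnorm_rotVec_mul_coef_le :
    vnorm (rotVec (rotStep R B F I J) B I (coefVec F J)) * vnorm (coefVec F J) ≤
      2 * (√a' * R) := by
  have h1 := vnorm_rotVec_le (rotStep_nonneg hR) (coefVec F J)
    (hB.rotStep_mul_resid_mul_lift_le hF ha ha' hI hR hL) hκ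
  have h2 := hB.rotStep_mul_resid_mul_coef_le hF ha' hI hR hL
  calc _ ≤ 2 * (rotStep R B F I J * vnorm (residVec B I)) * vnorm (coefVec F J) := by
        gcongr
        exact vnorm_nonneg _
    _ ≤ _ := by linarith

theorem sum_abs_rotPert_le (i : Fin m) :
    ∑ r, |rotPert R B F I J i r| ≤ √(k : ℝ) * (2 * (√a' * R)) := by
  have h1 := vnorm_rotVec_mul_coef_le hB hF ha ha' hI hR hL hκ
  simp_rw [rotPert, vecMulVec_apply, abs_mul]
  rw [← Finset.mul_sum]
  calc _ ≤ vnorm (rotVec (rotStep R B F I J) B I (coefVec F J)) *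
        (√(k : ℝ) * vnorm (coefVec F J)) := by
        gcongr
        · exact vnorm_nonneg _
        · exact abs_le_vnorm _ i
        · simpa using sum_abs_le_vnorm (coefVec F J)
    _ = √(k : ℝ) * (vnorm (rotVec (rotStep R B F I J) B I (coefVec F J)) *
        vnorm (coefVec F J)) := by ring
    _ ≤ _ := by gcongr

/-- The rotation changes the norm of the projected weights by little. -/
theorem abs_sqrt_leverage_sub_le :
    |√(leverage (B + rotPert R B F I J) I) - √(leverage B I)| ≤ 2 * (√a * √a' * R) := by
  set p := rotVec (rotStep R B F I J) B I (coefVec F J) with hp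
  have hlift := hB.rotStep_mul_resid_mul_lift_le hF ha ha' hI hR hL
  have h1 : rowMean (B + rotPert R B F I J) I =
      rowMean B I + (unifVec I ⬝ᵥ p) • coefVec F J := by
    rw [rowMean_eq, rowMean_eq, transpose_add, add_mulVec]
    congr 1
    rw [rotPert, transpose_vecMulVec, vecMulVec_mulVec, dotProduct_comm]
    simp [hp]
  -- As the Gram matrix is unchanged, only the row mean moves, along `coefVec F J`. The new leverage
  -- is then the squared norm of the old projection plus a multiple of a lift, and the triangle
  -- inequality finishes.
  have h2 : leverage (B + rotPert R B F I J) I =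
      vnorm (projVec B I + (unifVec I ⬝ᵥ p) • liftVec B (coefVec F J)) ^ 2 := by
    rw [leverage, gram_add_rotPert hB hF ha ha' hI hR hL hκ, h1, hB.quadForm_eq, mulVec_add,
      mulVec_add, mulVec_smul, mulVec_smul]
    rfl
  rw [h2, hB.leverage_eq, Real.sqrt_sq (vnorm_nonneg _), Real.sqrt_sq (vnorm_nonneg _)]
  have h3 : |vnorm (projVec B I + (unifVec I ⬝ᵥ p) • liftVec B (coefVec F J)) -
      vnorm (projVec B I)| ≤ vnorm ((unifVec I ⬝ᵥ p) • liftVec B (coefVec F J)) := by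
    have := abs_norm_sub_norm_le (WithLp.toLp 2 (projVec B I +
      (unifVec I ⬝ᵥ p) • liftVec B (coefVec F J))) (WithLp.toLp 2 (projVec B I))
    simpa [vnorm] using this
  refine h3.trans ?_
  rw [vnorm_smul]
  have h4 := abs_unifVec_dot_rotVec_le hI (rotStep_nonneg hR) (coefVec F J) hlift hκ
  have h5 : (√(I.card : ℝ))⁻¹ ≤ 1 := inv_le_one_of_one_le₀
    (Real.one_le_sqrt.2 (by exact_mod_cast hI.card_pos))
  have h6 : 0 ≤ rotStep R B F I J * vnorm (residVec B I) :=
    mul_nonneg (rotStep_nonneg hR) (vnorm_nonneg _)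
  calc _ ≤ 2 * (rotStep R B F I J * vnorm (residVec B I)) * (√(I.card : ℝ))⁻¹ *
        vnorm (liftVec B (coefVec F J)) := by
        gcongr
        exact vnorm_nonneg _
    _ ≤ 2 * (rotStep R B F I J * vnorm (residVec B I)) * 1 *
        vnorm (liftVec B (coefVec F J)) := by
        gcongr
        exact vnorm_nonneg _
    _ ≤ _ := by linarith

end RotationBounds

/-! ### The perturbed product: its norm, its entries and its block mean. -/

section RotationOfProduct

open Matrix

variable {m l k : ℕ} {B : Matrix (Fin m) (Fin k) ℝ} {F : Matrix (Fin l) (Fin k) ℝ}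
  {I : Finset (Fin m)} {J : Finset (Fin l)} {a a' R : ℝ}

/-- The change of `B F'` when both the loadings and the factors are rotated. -/
noncomputable def prodPert (R : ℝ) (B : Matrix (Fin m) (Fin k) ℝ) (F : Matrix (Fin l) (Fin k) ℝ)
    (I : Finset (Fin m)) (J : Finset (Fin l)) : Matrix (Fin m) (Fin l) ℝ :=
  (B + rotPert R B F I J) * (F + rotPert R F B J I).transpose - B * F.transpose

theorem prodPert_apply (i : Fin m) (t : Fin l) :
    prodPert R B F I J i t =
      rotVec (rotStep R B F I J) B I (coefVec F J) i * projVec F J t +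
      projVec B I i * rotVec (rotStep R F B J I) F J (coefVec B I) t +
      (coefVec F J ⬝ᵥ coefVec B I) * (rotVec (rotStep R B F I J) B I (coefVec F J) i *
        rotVec (rotStep R F B J I) F J (coefVec B I) t) := by
  simp only [prodPert, rotPert, Matrix.sub_apply, mul_apply, transpose_apply, Matrix.add_apply,
    vecMulVec_apply, projVec, mulVec, dotProduct]
  rw [← Finset.sum_sub_distrib, Finset.mul_sum, Finset.sum_mul, Finset.sum_mul,
    ← Finset.sum_add_distrib, ← Finset.sum_add_distrib]
  refine Finset.sum_congr rfl fun r _ => ?_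
  ring

variable (hB : LowerBdd B a) (hF : LowerBdd F a') (ha : 0 ≤ a) (ha' : 0 ≤ a')
  (hI : I.Nonempty) (hJ : J.Nonempty) (hR : 0 ≤ R) (hL : 0 < totalLev B F I J)
  (hκ : √a * √a' * R ≤ 1)

include hB hF ha ha' hI hJ hR hL hκ

/-- The bilinear term of the perturbation is of second order: pairing each rotation vector with the
coefficient vector it multiplies gives a factor 2√a' R and a factor 2√a R. -/
theorem abs_coef_mul_rotVec_mul_rotVec_le :
    |coefVec F J ⬝ᵥ coefVec B I| * (vnorm (rotVec (rotStep R B F I J) B I (coefVec F J)) *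
      vnorm (rotVec (rotStep R F B J I) F J (coefVec B I))) ≤ 4 * (√a * √a' * R) * R := by
  have h1 := vnorm_rotVec_mul_coef_le hB hF ha ha' hI hR hL hκ
  have h2 := vnorm_rotVec_mul_coef_le hF hB ha' ha hJ hR (by rwa [totalLev_comm])
    (by rwa [mul_comm √a'])
  calc _ ≤ (vnorm (coefVec F J) * vnorm (coefVec B I)) *
        (vnorm (rotVec (rotStep R B F I J) B I (coefVec F J)) *
        vnorm (rotVec (rotStep R F B J I) F J (coefVec B I))) := by
        refine mul_le_mul_of_nonneg_right (abs_dotProduct_le _ _) ?_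
        exact mul_nonneg (vnorm_nonneg _) (vnorm_nonneg _)
    _ = (vnorm (rotVec (rotStep R B F I J) B I (coefVec F J)) * vnorm (coefVec F J)) *
        (vnorm (rotVec (rotStep R F B J I) F J (coefVec B I)) * vnorm (coefVec B I)) := by ring
    _ ≤ (2 * (√a' * R)) * (2 * (√a * R)) :=
        mul_le_mul h1 h2 (mul_nonneg (vnorm_nonneg _) (vnorm_nonneg _)) (by positivity)
    _ = _ := by ring

/-- The leading term is s(bf' + gd'), with b, d the residuals and g, f the projections. Because g ⊥
b its squared norm is s²(L - 2xy) ≤ R², with x, y the two leverages. The two corrections along the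
lifts contribute κR each and the bilinear term 4κR, which gives the 6. -/
theorem vnorm_prodPert_le :
    vnorm (fun z : Fin m × Fin l => prodPert R B F I J z.1 z.2) ≤
      R * (1 + 6 * (√a * √a' * R)) := by
  set κ := √a * √a' * R with hκd
  set s := rotStep R B F I J with hs
  have hs' : rotStep R F B J I = s := rotStep_comm
  have hL' : 0 < totalLev F B J I := by rwa [totalLev_comm]
  have hκ' : √a' * √a * R ≤ κ := by rw [hκd, mul_comm √a']
  set b := residVec B I
  set b' := residVec F J
  set f := projVec F J
  set g := projVec B I
  set w := liftVec B (coefVec F J)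
  set w' := liftVec F (coefVec B I)
  set γ := rotCoef s b w
  set γ' := rotCoef s b' w'
  set p := rotVec s B I (coefVec F J)
  set p' := rotVec s F J (coefVec B I)
  have hs0 : 0 ≤ s := rotStep_nonneg hR
  have hb := hB.rotStep_mul_resid_mul_lift_le hF ha ha' hI hR hL
  have hb' := hF.rotStep_mul_resid_mul_lift_le hB ha' ha hJ hR hL'
  rw [hs'] at hb'
  have hbf := hB.rotStep_mul_resid_mul_proj_le hF hI hR hL
  have hbf' := hF.rotStep_mul_resid_mul_proj_le hB hJ hR hL'
  rw [hs'] at hbf'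
  have hγ := LowerBdd.rotCoef_mul_vnorm_le hs0 _ hb hκ
  have hγ' := LowerBdd.rotCoef_mul_vnorm_le hs0 _ (hb'.trans hκ') hκ
  have h3 := abs_coef_mul_rotVec_mul_rotVec_le hB hF ha ha' hI hJ hR hL hκ
  rw [hs'] at h3
  have hκ0 : 0 ≤ κ := by positivity
  have hdec : (fun z : Fin m × Fin l => prodPert R B F I J z.1 z.2) =
      s • ((fun z => b z.1 * f z.2) + fun z => g z.1 * b' z.2) -
      γ • (fun z => w z.1 * f z.2) - γ' • (fun z => g z.1 * w' z.2) +
      (coefVec F J ⬝ᵥ coefVec B I) • fun z => p z.1 * p' z.2 := by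
    funext z
    rw [prodPert_apply, hs', ← hs]
    have e1 : p z.1 = s * b z.1 - γ * w z.1 := rfl
    have e2 : p' z.2 = s * b' z.2 - γ' * w' z.2 := rfl
    simp only [Pi.add_apply, Pi.sub_apply, Pi.smul_apply, smul_eq_mul]
    change p z.1 * f z.2 + g z.1 * p' z.2 + _ * (p z.1 * p' z.2) = _
    linear_combination f z.2 * e1 + g z.1 * e2
  have hmain : vnorm (s • ((fun z : Fin m × Fin l => b z.1 * f z.2) +
      fun z => g z.1 * b' z.2)) ≤ R := by
    refine abs_le_of_sq_le_sq' ?_ hR |>.2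
    have hgb : g ⬝ᵥ b = 0 := hB.mulVec_dot_residVec _
    rw [vnorm_smul, mul_pow, sq_abs, vnorm_sq, add_dotProduct, dotProduct_add, dotProduct_add,
      ← vnorm_sq, ← vnorm_sq, vnorm_outer, vnorm_outer,
      dotProduct_comm (fun z : Fin m × Fin l => g z.1 * b' z.2)]
    have hx : (fun z : Fin m × Fin l => b z.1 * f z.2) ⬝ᵥ (fun z => g z.1 * b' z.2) = 0 := by
      have : (fun z : Fin m × Fin l => b z.1 * f z.2) ⬝ᵥ (fun z => g z.1 * b' z.2) =
          (g ⬝ᵥ b) * (f ⬝ᵥ b') := by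
        rw [dotProduct, dotProduct, dotProduct, Fintype.sum_prod_type, Finset.sum_mul_sum]
        refine Finset.sum_congr rfl fun i _ => Finset.sum_congr rfl fun t _ => ?_
        ring
      rw [this, hgb, zero_mul]
    rw [hx, add_zero, zero_add, mul_pow, mul_pow, hB.vnorm_residVec_sq hI,
      hF.vnorm_residVec_sq hJ, ← hB.leverage_eq, ← hF.leverage_eq,
      ← rotStep_sq_mul (R := R) hL]
    refine mul_le_mul_of_nonneg_left ?_ (sq_nonneg _)
    rw [totalLev]
    have := mul_nonneg (hB.leverage_nonneg I) (hF.leverage_nonneg J)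
    rw [div_eq_inv_mul, div_eq_inv_mul]
    linarith [mul_comm (leverage B I) (leverage F J)]
  rw [hdec]
  refine (vnorm_add_le _ _).trans ?_
  have hγw : vnorm (γ • fun z : Fin m × Fin l => w z.1 * f z.2) ≤ κ * R := by
    rw [vnorm_smul, vnorm_outer, abs_of_nonneg (rotCoef_nonneg _ _ _), ← mul_assoc]
    calc _ ≤ κ * (s * vnorm b) * vnorm f := by
          refine mul_le_mul_of_nonneg_right hγ (vnorm_nonneg _)
      _ = κ * (s * vnorm b * vnorm f) := by ring
      _ ≤ _ := by gcongr
  have hγw' : vnorm (γ' • fun z : Fin m × Fin l => g z.1 * w' z.2) ≤ κ * R := by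
    rw [vnorm_smul, vnorm_outer, abs_of_nonneg (rotCoef_nonneg _ _ _), mul_comm (vnorm g),
      ← mul_assoc]
    calc _ ≤ κ * (s * vnorm b') * vnorm g := by
          refine mul_le_mul_of_nonneg_right hγ' (vnorm_nonneg _)
      _ = κ * (s * vnorm b' * vnorm g) := by ring
      _ ≤ _ := by gcongr
  have h4 : vnorm ((coefVec F J ⬝ᵥ coefVec B I) • fun z : Fin m × Fin l => p z.1 * p' z.2) ≤
      4 * κ * R := by
    rw [vnorm_smul, vnorm_outer]
    exact h3
  have h5 := vnorm_sub_le (s • ((fun z : Fin m × Fin l => b z.1 * f z.2) +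
      fun z => g z.1 * b' z.2) - γ • (fun z => w z.1 * f z.2)) (γ' • fun z => g z.1 * w' z.2)
  have h6 := vnorm_sub_le (s • ((fun z : Fin m × Fin l => b z.1 * f z.2) +
      fun z => g z.1 * b' z.2)) (γ • fun z => w z.1 * f z.2)
  linarith

theorem abs_prodPert_le {c : ℝ} (hc : ∀ i, vnorm (B i) ≤ c) (hc' : ∀ t, vnorm (F t) ≤ c)
    (i : Fin m) (t : Fin l) :
    |prodPert R B F I J i t| ≤ 2 * c * (√a' * R) + 2 * c * (√a * R) + 4 * (√a * √a' * R) * R := by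
  have hL' : 0 < totalLev F B J I := by rwa [totalLev_comm]
  have h1 := vnorm_rotVec_mul_coef_le hB hF ha ha' hI hR hL hκ
  have h2 := vnorm_rotVec_mul_coef_le hF hB ha' ha hJ hR hL' (by rwa [mul_comm √a'])
  have h3 := abs_coef_mul_rotVec_mul_rotVec_le hB hF ha ha' hI hJ hR hL hκ
  set p := rotVec (rotStep R B F I J) B I (coefVec F J)
  set p' := rotVec (rotStep R F B J I) F J (coefVec B I)
  have hf : |projVec F J t| ≤ c * vnorm (coefVec F J) :=
    (abs_dotProduct_le _ _).trans (mul_le_mul_of_nonneg_right (hc' t) (vnorm_nonneg _))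
  have hg : |projVec B I i| ≤ c * vnorm (coefVec B I) :=
    (abs_dotProduct_le _ _).trans (mul_le_mul_of_nonneg_right (hc i) (vnorm_nonneg _))
  have hc0 : 0 ≤ c := (vnorm_nonneg _).trans (hc i)
  rw [prodPert_apply]
  refine (abs_add_le _ _).trans (add_le_add ((abs_add_le _ _).trans (add_le_add ?_ ?_)) ?_)
  · rw [abs_mul]
    calc _ ≤ vnorm p * (c * vnorm (coefVec F J)) := by
          gcongr
          · exact vnorm_nonneg _
          · exact abs_le_vnorm _ _
      _ = c * (vnorm p * vnorm (coefVec F J)) := by ring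
      _ ≤ c * (2 * (√a' * R)) := by gcongr
      _ = _ := by ring
  · rw [abs_mul]
    calc _ ≤ (c * vnorm (coefVec B I)) * vnorm p' := by
          gcongr
          · exact mul_nonneg hc0 (vnorm_nonneg _)
          · exact abs_le_vnorm _ _
      _ = c * (vnorm p' * vnorm (coefVec B I)) := by ring
      _ ≤ c * (2 * (√a * R)) := by gcongr
      _ = _ := by ring
  · rw [abs_mul, abs_mul]
    refine le_trans ?_ h3
    gcongr
    · exact vnorm_nonneg _
    · exact abs_le_vnorm _ _
    · exact abs_le_vnorm _ _

/-- Pairing the leading term with the weights gives s(L - 2xy), and sL = R√L. The losses are 2δ from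
the product xy of the leverages, κ from the corrections along the lifts, and 4κ/√x from the bilinear
term. -/
theorem le_blockMean_prodPert {δ : ℝ} (hδ : leverage B I * leverage F J ≤ δ * totalLev B F I J)
    (hlev : 0 < leverage B I) :
    R * √(totalLev B F I J) *
      (1 - 2 * δ - √a * √a' * R - 4 * (√a * √a' * R) / √(leverage B I)) ≤
      blockMean (prodPert R B F I J) I J := by
  set κ := √a * √a' * R with hκd
  set s := rotStep R B F I J with hs
  have hs' : rotStep R F B J I = s := rotStep_comm
  have hL' : 0 < totalLev F B J I := by rwa [totalLev_comm]
  have hκ' : √a' * √a * R ≤ κ := by rw [hκd, mul_comm √a']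
  have hs0 : 0 ≤ s := rotStep_nonneg hR
  have hb := hB.rotStep_mul_resid_mul_lift_le hF ha ha' hI hR hL
  have hb' := hF.rotStep_mul_resid_mul_lift_le hB ha' ha hJ hR hL'
  rw [hs'] at hb'
  have hP := (abs_le.1 (hB.abs_unifVec_dot_rotVec_sub_le hI hs0 _ hb hκ)).1
  have hP' := (abs_le.1 (hF.abs_unifVec_dot_rotVec_sub_le hJ hs0 _ (hb'.trans hκ') hκ)).1
  have h3 := abs_coef_mul_rotVec_mul_rotVec_le hB hF ha ha' hI hJ hR hL hκ
  rw [hs'] at h3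
  set p := rotVec s B I (coefVec F J)
  set p' := rotVec s F J (coefVec B I)
  set x := leverage B I with hx
  set y := leverage F J with hy
  have hx0 : 0 ≤ x := hB.leverage_nonneg I
  have hy0 : 0 ≤ y := hF.leverage_nonneg J
  have hκ0 : 0 ≤ κ := by positivity
  set L := totalLev B F I J with hLd
  have hIc : (0 : ℝ) < I.card := by exact_mod_cast hI.card_pos
  have hJc : (0 : ℝ) < J.card := by exact_mod_cast hJ.card_pos
  have hdec : blockMean (prodPert R B F I J) I J =
      (unifVec I ⬝ᵥ p) * y + x * (unifVec J ⬝ᵥ p') +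
      (coefVec F J ⬝ᵥ coefVec B I) * ((unifVec I ⬝ᵥ p) * (unifVec J ⬝ᵥ p')) := by
    have hmat : prodPert R B F I J = vecMulVec p (projVec F J) + vecMulVec (projVec B I) p' +
        (coefVec F J ⬝ᵥ coefVec B I) • vecMulVec p p' := by
      ext i t
      rw [prodPert_apply, hs', ← hs]
      simp only [Matrix.add_apply, Matrix.smul_apply, vecMulVec_apply, smul_eq_mul]
      rfl
    have hy1 : projVec F J ⬝ᵥ unifVec J = y := by
      rw [dotProduct_comm, hF.unifVec_dot_projVec]
    have hx1 : unifVec I ⬝ᵥ projVec B I = x := hB.unifVec_dot_projVec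
    rw [blockMean_eq, hmat, add_mulVec, add_mulVec, smul_mulVec, vecMulVec_mulVec,
      vecMulVec_mulVec, vecMulVec_mulVec, dotProduct_add, dotProduct_add]
    simp only [op_smul_eq_smul, dotProduct_smul, smul_eq_mul, hy1, hx1,
      dotProduct_comm p' (unifVec J)]
    ring
  have hinv : ∀ c : ℝ, 0 < c → (√c)⁻¹ * (√c)⁻¹ = c⁻¹ := fun c hc => by
    rw [← mul_inv, Real.mul_self_sqrt hc.le]
  have hbI := hB.vnorm_residVec_le hI
  have hbJ := hF.vnorm_residVec_le hJ
  have hterm1 : s * ((I.card : ℝ)⁻¹ - x) * y - κ * s * ((I.card : ℝ)⁻¹ * y) ≤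
      (unifVec I ⬝ᵥ p) * y := by
    rw [hB.vnorm_residVec_sq hI] at hP
    have : κ * (s * vnorm (residVec B I)) * (√(I.card : ℝ))⁻¹ ≤ κ * s * (I.card : ℝ)⁻¹ := by
      rw [← hinv _ hIc]
      calc _ = κ * s * (vnorm (residVec B I) * (√(I.card : ℝ))⁻¹) := by ring
        _ ≤ _ := by gcongr
    have h9 : s * ((I.card : ℝ)⁻¹ - x) - κ * s * (I.card : ℝ)⁻¹ ≤ unifVec I ⬝ᵥ p := by
      linarith
    have := mul_le_mul_of_nonneg_right h9 hy0
    linarith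
  have hterm2 : s * ((J.card : ℝ)⁻¹ - y) * x - κ * s * ((J.card : ℝ)⁻¹ * x) ≤
      x * (unifVec J ⬝ᵥ p') := by
    rw [hF.vnorm_residVec_sq hJ] at hP'
    have : κ * (s * vnorm (residVec F J)) * (√(J.card : ℝ))⁻¹ ≤ κ * s * (J.card : ℝ)⁻¹ := by
      rw [← hinv _ hJc]
      calc _ = κ * s * (vnorm (residVec F J) * (√(J.card : ℝ))⁻¹) := by ring
        _ ≤ _ := by gcongr
    have h9 : s * ((J.card : ℝ)⁻¹ - y) - κ * s * (J.card : ℝ)⁻¹ ≤ unifVec J ⬝ᵥ p' := by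
      linarith
    have := mul_le_mul_of_nonneg_left h9 hx0
    linarith
  have hterm3 : |(coefVec F J ⬝ᵥ coefVec B I) * ((unifVec I ⬝ᵥ p) * (unifVec J ⬝ᵥ p'))| ≤
      4 * κ * R * (√(J.card : ℝ))⁻¹ := by
    rw [abs_mul, abs_mul]
    have hI1 : vnorm (unifVec I) ≤ 1 := by
      rw [vnorm_unifVec hI]
      exact inv_le_one_of_one_le₀ (Real.one_le_sqrt.2 (by exact_mod_cast hI.card_pos))
    have e1 : |unifVec I ⬝ᵥ p| ≤ vnorm p :=
      (abs_dotProduct_le _ _).trans (mul_le_of_le_one_left (vnorm_nonneg _) hI1)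
    have e2 : |unifVec J ⬝ᵥ p'| ≤ (√(J.card : ℝ))⁻¹ * vnorm p' := by
      rw [← vnorm_unifVec hJ]; exact abs_dotProduct_le _ _
    calc _ ≤ |coefVec F J ⬝ᵥ coefVec B I| * (vnorm p * ((√(J.card : ℝ))⁻¹ * vnorm p')) := by
          gcongr
          exact vnorm_nonneg _
      _ = |coefVec F J ⬝ᵥ coefVec B I| * (vnorm p * vnorm p') * (√(J.card : ℝ))⁻¹ := by ring
      _ ≤ _ := by gcongr
  have hsL : s * L = R * √L := by
    rw [hs, rotStep, ← hLd, div_mul_eq_mul_div, mul_div_assoc, Real.div_sqrt]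
  -- L contains the summand x/|J|. This expresses the bilinear error in the unit R√L of the main
  -- term.
  have hJL : (√(J.card : ℝ))⁻¹ ≤ √L / √x := by
    rw [le_div_iff₀ (Real.sqrt_pos.2 hlev), ← Real.sqrt_inv, ← Real.sqrt_mul (by positivity)]
    refine Real.sqrt_le_sqrt ?_
    rw [hLd, totalLev, inv_mul_eq_div]
    have : 0 ≤ y / (I.card : ℝ) := by positivity
    linarith
  have hterm3' : -(4 * κ * R * (√L / √x)) ≤
      (coefVec F J ⬝ᵥ coefVec B I) * ((unifVec I ⬝ᵥ p) * (unifVec J ⬝ᵥ p')) := by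
    refine le_trans ?_ (abs_le.1 hterm3).1
    rw [neg_le_neg_iff]
    gcongr
  rw [hdec]
  have hLe : L = (J.card : ℝ)⁻¹ * x + (I.card : ℝ)⁻¹ * y := by
    rw [hLd, totalLev, div_eq_inv_mul, div_eq_inv_mul]
  have hsδ : s * (x * y) ≤ s * (δ * L) := mul_le_mul_of_nonneg_left hδ hs0
  have e4 : R * √L * (1 - 2 * δ - κ - 4 * κ / √x) =
      s * L - 2 * (s * (δ * L)) - κ * (s * L) - 4 * κ * R * (√L / √x) := by
    rw [show s * (δ * L) = δ * (s * L) by ring, hsL]; ring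
  have e5 : s * L = s * ((J.card : ℝ)⁻¹ * x) + s * ((I.card : ℝ)⁻¹ * y) := by rw [hLe]; ring
  rw [e4]
  have e6 : κ * (s * L) = κ * s * ((J.card : ℝ)⁻¹ * x) + κ * s * ((I.card : ℝ)⁻¹ * y) := by
    rw [e5]; ring
  nlinarith

end RotationOfProduct

/-! ### Gram matrices of randomly thinned rows. -/

section Thinning

open Matrix

variable {m k : ℕ} {B B' : Matrix (Fin m) (Fin k) ℝ} {a : ℝ}

/-- If `B'' B'` is relatively close to `p B'B`, so are the inverses. -/
theorem LowerBdd.abs_quadForm_sub_le (hB : LowerBdd B a) (ha : 0 ≤ a) {p ε : ℝ} (hp : 0 < p)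
    (hε : 0 ≤ ε) (hε2 : ε ≤ 1 / 2)
    (hclose : ∀ y : Fin k → ℝ, |vnorm (B' *ᵥ y) ^ 2 - p * vnorm (B *ᵥ y) ^ 2| ≤
      ε * p * vnorm (B *ᵥ y) ^ 2) (v : Fin k → ℝ) :
    |quadForm (gramMat B')⁻¹ v - p⁻¹ * quadForm (gramMat B)⁻¹ v| ≤
      2 * ε * (p⁻¹ * quadForm (gramMat B)⁻¹ v) := by
  have hlow : ∀ y, (1 - ε) * p * vnorm (B *ᵥ y) ^ 2 ≤ vnorm (B' *ᵥ y) ^ 2 := fun y => by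
    have := (abs_le.1 (hclose y)).1
    linarith
  have hupp : ∀ y, vnorm (B' *ᵥ y) ^ 2 ≤ (1 + ε) * p * vnorm (B *ᵥ y) ^ 2 := fun y => by
    have := (abs_le.1 (hclose y)).2
    linarith
  have h1ε : 0 < (1 - ε) * p := by apply mul_pos _ hp; linarith
  have hB' : LowerBdd B' (a / ((1 - ε) * p)) := fun y => by
    refine (hB y).trans ?_
    rw [← vnorm_sq, ← vnorm_sq, div_mul_eq_mul_div, le_div_iff₀ h1ε, mul_assoc]
    refine mul_le_mul_of_nonneg_left ?_ ha
    linarith [hlow y]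
  set x := (gramMat B')⁻¹ *ᵥ v with hx
  set z := (gramMat B)⁻¹ *ᵥ v with hz
  have hgx : gramMat B' *ᵥ x = v := hB'.gram_mulVec_inv v
  have hgz : gramMat B *ᵥ z = v := hB.gram_mulVec_inv v
  rw [hB'.quadForm_eq, hB.quadForm_eq, ← hx, ← hz]
  set q' := vnorm (B' *ᵥ x) ^ 2 with hq'
  set q := vnorm (B *ᵥ z) ^ 2 with hq
  have e1 : q' = x ⬝ᵥ v := by rw [hq', vnorm_sq, ← dotProduct_gram_mulVec, hgx]
  have e2 : q = z ⬝ᵥ v := by rw [hq, vnorm_sq, ← dotProduct_gram_mulVec, hgz]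
  have hq0 : 0 ≤ q := by positivity
  have hq'0 : 0 ≤ q' := by positivity
  have sqle : ∀ u w : Fin m → ℝ, (u ⬝ᵥ w) ^ 2 ≤ vnorm u ^ 2 * vnorm w ^ 2 := fun u w => by
    rw [← sq_abs, ← mul_pow]
    exact pow_le_pow_left₀ (abs_nonneg _) (abs_dotProduct_le u w) 2
  -- Inversion reverses the order. Here q' = x'v = ⟨Bx, Bz⟩, so Cauchy–Schwarz bounds q'² by |Bx|²
  -- q, and |Bx|² is at most q'/((1 - ε)p). The other direction is symmetric.
  have u1 : (1 - ε) * p * q' ≤ q := by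
    have h1 : q' ^ 2 ≤ vnorm (B *ᵥ x) ^ 2 * q := by
      rw [e1, ← hgz, dotProduct_gram_mulVec]; exact sqle _ _
    have h2 := hlow x
    rcases hq'0.eq_or_lt' with h0 | h0
    · rw [h0, mul_zero]; exact hq0
    · refine le_of_mul_le_mul_right ?_ h0
      calc (1 - ε) * p * q' * q' = (1 - ε) * p * q' ^ 2 := by ring
        _ ≤ (1 - ε) * p * (vnorm (B *ᵥ x) ^ 2 * q) := by gcongr
        _ = ((1 - ε) * p * vnorm (B *ᵥ x) ^ 2) * q := by ring
        _ ≤ q' * q := by gcongr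
        _ = q * q' := mul_comm _ _
  have u2 : q ≤ (1 + ε) * p * q' := by
    have h1 : q ^ 2 ≤ vnorm (B' *ᵥ z) ^ 2 * q' := by
      rw [e2, ← hgx, dotProduct_gram_mulVec]; exact sqle _ _
    have h2 := hupp z
    rcases hq0.eq_or_lt' with h0 | h0
    · rw [h0]; positivity
    · refine le_of_mul_le_mul_right ?_ h0
      calc q * q = q ^ 2 := by ring
        _ ≤ vnorm (B' *ᵥ z) ^ 2 * q' := h1
        _ ≤ ((1 + ε) * p * q) * q' := by gcongr
        _ = _ := by ring
  have hqp : q = p * (p⁻¹ * q) := by rw [mul_inv_cancel_left₀ hp.ne']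
  set Q := p⁻¹ * q
  have hQ0 : 0 ≤ Q := by positivity
  have u1' : (1 - ε) * q' ≤ Q := by
    refine le_of_mul_le_mul_left ?_ hp
    rw [← hqp]; linarith
  have u2' : Q ≤ (1 + ε) * q' := by
    refine le_of_mul_le_mul_left ?_ hp
    rw [← hqp]; linarith
  -- For ε ≤ 1/2 both 1/(1 - ε) ≤ 1 + 2ε and 1/(1 + ε) ≥ 1 - 2ε hold.
  rw [abs_le]
  constructor <;> nlinarith

/-- Thinning the rows of `B` changes `B'B` relatively little if the entries of `B'B` do. -/
theorem LowerBdd.abs_quadForm_thinned_sub_le (hB : LowerBdd B a) (ha : 0 ≤ a) {p ε x : ℝ}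
    (hp : 0 < p) (hε : 0 ≤ ε) (hε2 : ε ≤ 1 / 2) (w : Fin m → ℝ) (hw : ∀ j, w j * w j = w j)
    (hx : ∀ r s, |∑ j, (w j - p) * (B j r * B j s)| ≤ x) (hxa : x * k * a ≤ ε * p)
    (v : Fin k → ℝ) :
    |quadForm (∑ j, w j • vecMulVec (B j) (B j))⁻¹ v - p⁻¹ * quadForm (gramMat B)⁻¹ v| ≤
      2 * ε * (p⁻¹ * quadForm (gramMat B)⁻¹ v) := by
  -- The weights are idempotent, so the weighted sum of outer products is itself a Gram matrix.
  set B' : Matrix (Fin m) (Fin k) ℝ := fun j r => w j * B j r with hB'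
  have hG : ∑ j, w j • vecMulVec (B j) (B j) = gramMat B' := by
    ext r s
    rw [Matrix.sum_apply, gramMat, mul_apply]
    refine Finset.sum_congr rfl fun j _ => ?_
    change w j * (B j r * B j s) = (w j * B j r) * (w j * B j s)
    linear_combination -(B j r * B j s) * hw j
  rw [hG]
  refine hB.abs_quadForm_sub_le ha hp hε hε2 (fun y => ?_) v
  rcases Nat.eq_zero_or_pos k with rfl | hk
  · have : y = 0 := Subsingleton.elim _ _
    simp [this, vnorm]
  have hx0 : 0 ≤ x := (abs_nonneg _).trans (hx ⟨0, hk⟩ ⟨0, hk⟩)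
  have hBy : ∀ j, (B' *ᵥ y) j = w j * (B *ᵥ y) j := fun j => by
    simp [hB', mulVec, dotProduct, Finset.mul_sum, mul_assoc]
  have e1 : vnorm (B' *ᵥ y) ^ 2 - p * vnorm (B *ᵥ y) ^ 2 =
      ∑ r, ∑ s, (y r * y s) * ∑ j, (w j - p) * (B j r * B j s) := by
    rw [vnorm_sq', vnorm_sq', Finset.mul_sum, ← Finset.sum_sub_distrib]
    have e2 : ∀ j, (B' *ᵥ y) j ^ 2 - p * (B *ᵥ y) j ^ 2 =
        ∑ r, ∑ s, (y r * y s) * ((w j - p) * (B j r * B j s)) := fun j => by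
      rw [hBy]
      have e3 : (B *ᵥ y) j ^ 2 = ∑ r, ∑ s, (B j r * y r) * (B j s * y s) := by
        rw [sq, mulVec, dotProduct, Finset.sum_mul_sum]
      calc _ = (w j - p) * (B *ᵥ y) j ^ 2 := by linear_combination (B *ᵥ y) j ^ 2 * hw j
        _ = _ := by
          rw [e3, Finset.mul_sum]
          refine Finset.sum_congr rfl fun r _ => ?_
          rw [Finset.mul_sum]
          refine Finset.sum_congr rfl fun s _ => ?_
          ring
    simp_rw [e2]
    rw [Finset.sum_comm]
    refine Finset.sum_congr rfl fun r _ => ?_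
    rw [Finset.sum_comm]
    refine Finset.sum_congr rfl fun s _ => ?_
    rw [Finset.mul_sum]
  rw [e1]
  calc _ ≤ ∑ r, ∑ s, |y r| * |y s| * x := by
        refine (Finset.abs_sum_le_sum_abs _ _).trans (Finset.sum_le_sum fun r _ => ?_)
        refine (Finset.abs_sum_le_sum_abs _ _).trans (Finset.sum_le_sum fun s _ => ?_)
        rw [abs_mul, abs_mul]
        exact mul_le_mul_of_nonneg_left (hx r s) (by positivity)
    _ = (∑ r, |y r|) ^ 2 * x := by
        rw [sq, Finset.sum_mul_sum, Finset.sum_mul]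
        exact Finset.sum_congr rfl fun r _ => by rw [Finset.sum_mul]
    _ ≤ (√(k : ℝ) * vnorm y) ^ 2 * x := by
        gcongr
        simpa using sum_abs_le_vnorm y
    _ = x * k * vnorm y ^ 2 := by rw [mul_pow, Real.sq_sqrt (by positivity)]; ring
    _ ≤ x * k * (a * vnorm (B *ᵥ y) ^ 2) := by
        have := hB y
        rw [← vnorm_sq, ← vnorm_sq] at this
        gcongr
    _ ≤ _ := by
        rw [← mul_assoc]
        gcongr

end Thinning

/-! ### Concentration of the thinned sums -/

section Concentration

/-- Each summand `w j * c j` lies in [-D, D], so after centring it is sub-Gaussian with parameter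
D². The two tails come from c and -c. -/
theorem hoeffding_weighted {Ω ι : Type*} [MeasurableSpace Ω] [Fintype ι] {μ : Measure Ω}
    [IsProbabilityMeasure μ] {w : ι → Ω → ℝ} (hind : iIndepFun w μ) (hm : ∀ j, Measurable (w j))
    (h01 : ∀ j z, w j z ∈ Set.Icc (0 : ℝ) 1) {p : ℝ} (hmean : ∀ j, ∫ z, w j z ∂μ = p)
    {c : ι → ℝ} {D x : ℝ} (hc : ∀ j, |c j| ≤ D) (hD : 0 ≤ D) (hx : 0 ≤ x) :
    μ.real {z | x ≤ |∑ j, (w j z - p) * c j|} ≤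
      2 * Real.exp (-x ^ 2 / (2 * (Fintype.card ι * D ^ 2))) := by
  have key : ∀ c : ι → ℝ, (∀ j, |c j| ≤ D) →
      μ.real {z | x ≤ ∑ j, (w j z - p) * c j} ≤
        Real.exp (-x ^ 2 / (2 * (Fintype.card ι * D ^ 2))) := by
    intro c hc
    have hs : ∀ j ∈ (Finset.univ : Finset ι), HasSubgaussianMGF (fun z => (w j z - p) * c j)
        ((‖D - -D‖₊ / 2) ^ 2) μ := by
      intro j _
      have h1 := hasSubgaussianMGF_of_mem_Icc (μ := μ) (X := fun z => w j z * c j) (a := -D)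
        (b := D) ((hm j).mul_const _).aemeasurable (ae_of_all _ fun z => by
          have h := h01 j z
          have : |w j z * c j| ≤ D := by
            rw [abs_mul, abs_of_nonneg h.1]
            exact (mul_le_of_le_one_left (abs_nonneg _) h.2).trans (hc j)
          exact abs_le.1 this)
      convert h1 using 2 with z
      rw [integral_mul_const, hmean]; ring
    have hind' : iIndepFun (fun j z => (w j z - p) * c j) μ :=
      hind.comp (fun j y => (y - p) * c j) fun j => by fun_prop
    refine (HasSubgaussianMGF.measure_sum_ge_le_of_iIndepFun hind' hs hx).trans (le_of_eq ?_)
    have : ((‖D - -D‖₊ / 2 : NNReal) : ℝ) = D := by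
      push_cast
      rw [Real.norm_of_nonneg (by linarith)]; ring
    rw [NNReal.coe_sum, Finset.sum_const, nsmul_eq_mul, NNReal.coe_pow, this, Finset.card_univ]
  have h1 := key c hc
  have h2 := key (fun j => -c j) fun j => by rw [abs_neg]; exact hc j
  calc _ ≤ μ.real ({z | x ≤ ∑ j, (w j z - p) * c j} ∪ {z | x ≤ ∑ j, (w j z - p) * -c j}) := by
        refine measureReal_mono fun z hz => ?_
        rcases le_abs.1 (show x ≤ |∑ j, (w j z - p) * c j| from hz) with h | h
        · exact Or.inl h
        · refine Or.inr ?_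
          simpa using h
    _ ≤ _ := measureReal_union_le _ _
    _ ≤ _ := by linarith

variable {m l : ℕ} {p : unitInterval} {σ : ℝ}

instance isProbabilityMeasure_noiseLaw : IsProbabilityMeasure (noiseLaw m l p σ) := by
  unfold noiseLaw; infer_instance

theorem measurable_entry (i : Fin m) (t : Fin l) :
    Measurable fun x : Fin m → Fin l → Bool × ℝ => x i t :=
  (measurable_pi_apply t).comp (measurable_pi_apply i)

theorem measurable_omegaVal (i : Fin m) (t : Fin l) : Measurable fun x => omegaVal x i t := by
  unfold omegaVal
  refine Measurable.ite ?_ measurable_const measurable_const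
  exact (measurable_entry i t).fst (measurableSet_singleton true)

theorem measurePreserving_entry (i : Fin m) (t : Fin l) :
    MeasurePreserving (fun x : Fin m → Fin l → Bool × ℝ => x i t) (noiseLaw m l p σ)
      ((bernoulliMeasure true false p).prod (gaussianReal 0 (Real.toNNReal (σ ^ 2)))) :=
  (measurePreserving_eval (fun _ : Fin l =>
    (bernoulliMeasure true false p).prod (gaussianReal 0 (Real.toNNReal (σ ^ 2)))) t).comp
    (measurePreserving_eval (fun _ : Fin m => Measure.pi fun _ : Fin l =>
    (bernoulliMeasure true false p).prod (gaussianReal 0 (Real.toNNReal (σ ^ 2)))) i)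

theorem integral_omegaVal (i : Fin m) (t : Fin l) :
    ∫ x, omegaVal x i t ∂(noiseLaw m l p σ) = p := by
  have h1 : Measurable fun z : Bool × ℝ => if z.1 = true then (1 : ℝ) else 0 :=
    Measurable.ite (measurable_fst (measurableSet_singleton true)) measurable_const measurable_const
  have h := (measurePreserving_entry (p := p) (σ := σ) i t).map_eq
  have h2 : ∫ x, omegaVal x i t ∂(noiseLaw m l p σ) =
      ∫ z : Bool × ℝ, (if z.1 = true then (1 : ℝ) else 0)
        ∂((bernoulliMeasure true false p).prod (gaussianReal 0 (Real.toNNReal (σ ^ 2)))) := by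
    rw [← h, integral_map (measurable_entry i t).aemeasurable h1.aestronglyMeasurable]; rfl
  have h3 : ∫ z : Bool × ℝ, (if z.1 = true then (1 : ℝ) else 0)
        ∂((bernoulliMeasure true false p).prod (gaussianReal 0 (Real.toNNReal (σ ^ 2)))) =
      ∫ b, (if b = true then (1 : ℝ) else 0) ∂(bernoulliMeasure true false p) := by
    have := integral_fun_fst (μ := bernoulliMeasure true false p)
      (ν := gaussianReal 0 (Real.toNNReal (σ ^ 2))) (fun b : Bool => if b = true then (1 : ℝ) else 0)
    simpa using this
  rw [h2, h3, integral_bernoulliMeasure]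
  simp

theorem iIndepFun_col (t : Fin l) :
    iIndepFun (fun j (x : Fin m → Fin l → Bool × ℝ) => x j t) (noiseLaw m l p σ) := by
  have h := iIndepFun_pi (μ := fun _ : Fin m => Measure.pi fun _ : Fin l =>
    (bernoulliMeasure true false p).prod (gaussianReal 0 (Real.toNNReal (σ ^ 2))))
    (X := fun _ y => y t) (fun _ => (measurable_pi_apply t).aemeasurable)
  exact h

/-- The noise law is a product over units of products over periods. Within a row the outer product
is first reduced to the marginal law of that row, which is again a product. -/
theorem iIndepFun_row (i : Fin m) :
    iIndepFun (fun s (x : Fin m → Fin l → Bool × ℝ) => x i s) (noiseLaw m l p σ) := by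
  rw [iIndepFun_iff_map_fun_eq_pi_map (fun s => (measurable_entry i s).aemeasurable)]
  have h : (noiseLaw m l p σ).map (fun x => x i) = _ := (measurePreserving_eval _ i).map_eq
  change (noiseLaw m l p σ).map (fun x => x i) = _
  rw [h]
  congr 1
  funext s
  exact (measurePreserving_entry i s).map_eq.symm

theorem omegaVal_mem (x : Fin m → Fin l → Bool × ℝ) (i : Fin m) (t : Fin l) :
    omegaVal x i t ∈ Set.Icc (0 : ℝ) 1 := by
  unfold omegaVal; split_ifs <;> simp

theorem measurable_indicatorVal : Measurable fun z : Bool × ℝ => if z.1 = true then (1 : ℝ) else 0 :=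
  Measurable.ite (measurable_fst (measurableSet_singleton true)) measurable_const measurable_const

/-- The union bound over a family of weighted sums of independent observation indicators. -/
theorem noiseLaw_union_tail {ι κ : Type*} [Fintype ι] [Fintype κ]
    (w : κ → ι → (Fin m → Fin l → Bool × ℝ) → ℝ)
    (hw : ∀ a j, ∃ i t, w a j = fun x => omegaVal x i t)
    (hind : ∀ a, iIndepFun (w a) (noiseLaw m l p σ)) {c : κ → ι → ℝ} {D x : ℝ}
    (hc : ∀ a j, |c a j| ≤ D) (hD : 0 ≤ D) (hx : 0 ≤ x) :
    noiseLaw m l p σ {z | ∃ a, x ≤ |∑ j, (w a j z - p) * c a j|} ≤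
      ENNReal.ofReal (Fintype.card κ *
        (2 * Real.exp (-x ^ 2 / (2 * (Fintype.card ι * D ^ 2))))) := by
  have h1 : ∀ a, (noiseLaw m l p σ).real {z | x ≤ |∑ j, (w a j z - p) * c a j|} ≤
      2 * Real.exp (-x ^ 2 / (2 * (Fintype.card ι * D ^ 2))) := fun a => by
    refine hoeffding_weighted (hind a) (fun j => ?_) (fun j z => ?_) (fun j => ?_) (hc a) hD hx
    · obtain ⟨i, t, h⟩ := hw a j; rw [h]; exact measurable_omegaVal i t
    · obtain ⟨i, t, h⟩ := hw a j; rw [h]; exact omegaVal_mem z i t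
    · obtain ⟨i, t, h⟩ := hw a j; rw [h]; exact integral_omegaVal i t
  rw [show {z | ∃ a, x ≤ |∑ j, (w a j z - p) * c a j|} =
    ⋃ a, {z | x ≤ |∑ j, (w a j z - p) * c a j|} by ext; simp]
  refine (measure_iUnion_fintype_le _ _).trans ?_
  calc _ ≤ ∑ _a : κ, ENNReal.ofReal (2 * Real.exp (-x ^ 2 / (2 * (Fintype.card ι * D ^ 2)))) := by
        refine Finset.sum_le_sum fun a _ => ?_
        rw [← ofReal_measureReal]
        exact ENNReal.ofReal_le_ofReal (h1 a)
    _ = _ := by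
        rw [Finset.sum_const, nsmul_eq_mul, ENNReal.ofReal_mul (by positivity)]
        simp

theorem noiseLaw_col_tail {k : ℕ} {B : Matrix (Fin m) (Fin k) ℝ} {C x : ℝ}
    (hC : ∀ j r, |B j r| ≤ C) (hx : 0 ≤ x) :
    noiseLaw m l p σ {z | ∃ a : Fin l × Fin k × Fin k,
        x ≤ |∑ j, (omegaVal z j a.1 - p) * (B j a.2.1 * B j a.2.2)|} ≤
      ENNReal.ofReal ((l * (k * k) : ℕ) *
        (2 * Real.exp (-x ^ 2 / (2 * (m * (C ^ 2) ^ 2))))) := by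
  have h := noiseLaw_union_tail (m := m) (l := l) (p := p) (σ := σ) (ι := Fin m)
    (κ := Fin l × Fin k × Fin k) (fun a j z => omegaVal z j a.1) (fun a j => ⟨j, a.1, rfl⟩)
    (fun a => (iIndepFun_col a.1).comp _ fun _ => measurable_indicatorVal)
    (c := fun a j => B j a.2.1 * B j a.2.2) (D := C ^ 2) (x := x) (fun a j => by
      rw [abs_mul, sq]
      exact mul_le_mul (hC _ _) (hC _ _) (abs_nonneg _) ((abs_nonneg _).trans (hC j a.2.1)))
    (by positivity) hx
  simpa using h

theorem noiseLaw_row_tail {k : ℕ} {F : Matrix (Fin l) (Fin k) ℝ} {C x : ℝ}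
    (hC : ∀ j r, |F j r| ≤ C) (hx : 0 ≤ x) :
    noiseLaw m l p σ {z | ∃ a : Fin m × Fin k × Fin k,
        x ≤ |∑ s, (omegaVal z a.1 s - p) * (F s a.2.1 * F s a.2.2)|} ≤
      ENNReal.ofReal ((m * (k * k) : ℕ) *
        (2 * Real.exp (-x ^ 2 / (2 * (l * (C ^ 2) ^ 2))))) := by
  have h := noiseLaw_union_tail (m := m) (l := l) (p := p) (σ := σ) (ι := Fin l)
    (κ := Fin m × Fin k × Fin k) (fun a j z => omegaVal z a.1 j) (fun a j => ⟨a.1, j, rfl⟩)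
    (fun a => (iIndepFun_row a.1).comp _ fun _ => measurable_indicatorVal)
    (c := fun a j => F j a.2.1 * F j a.2.2) (D := C ^ 2) (x := x) (fun a j => by
      rw [abs_mul, sq]
      exact mul_le_mul (hC _ _) (hC _ _) (abs_nonneg _) ((abs_nonneg _).trans (hC j a.2.1)))
    (by positivity) hx
  simpa using h

end Concentration

/-! ### The likelihood ratio of two matrices of means -/

section Likelihood

open scoped NNReal ENNReal

theorem lintegral_pi_prod {ι : Type*} [Fintype ι] {α : ι → Type*} [∀ i, MeasurableSpace (α i)]
    {μ : ∀ i, Measure (α i)} [∀ i, IsProbabilityMeasure (μ i)] {f : ∀ i, α i → ℝ≥0∞}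
    (hf : ∀ i, Measurable (f i)) :
    ∫⁻ x, ∏ i, f i (x i) ∂(Measure.pi μ) = ∏ i, ∫⁻ y, f i y ∂(μ i) := by
  have hind : iIndepFun (fun i x => f i (x i)) (Measure.pi μ) :=
    iIndepFun_pi fun i => (hf i).aemeasurable
  rw [lintegral_prod_eq_prod_lintegral_of_indepFun _ _ hind
    fun i => (hf i).comp (measurable_pi_apply i)]
  refine Finset.prod_congr rfl fun i _ => ?_
  exact (measurePreserving_eval μ i).lintegral_comp (hf i)

/-- Both sides agree on measurable rectangles, where the indicator of the rectangle times the
density is a product of functions of single coordinates. -/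
theorem pi_withDensity {ι : Type*} [Fintype ι] {α : ι → Type*} [∀ i, MeasurableSpace (α i)]
    {μ : ∀ i, Measure (α i)} [∀ i, IsProbabilityMeasure (μ i)] {f : ∀ i, α i → ℝ≥0∞}
    (hf : ∀ i, Measurable (f i)) [∀ i, SigmaFinite ((μ i).withDensity (f i))] :
    Measure.pi (fun i => (μ i).withDensity (f i)) =
      (Measure.pi μ).withDensity fun x => ∏ i, f i (x i) := by
  refine Measure.pi_eq fun s hs => ?_
  rw [withDensity_apply _ (MeasurableSet.univ_pi hs), ← lintegral_indicator (.univ_pi hs)]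
  have h : ∀ x : ∀ i, α i, (Set.univ.pi s).indicator (fun x => ∏ i, f i (x i)) x =
      ∏ i, (s i).indicator (f i) (x i) := fun x => by
    by_cases hx : x ∈ Set.univ.pi s
    · rw [Set.indicator_of_mem hx]
      exact Finset.prod_congr rfl fun i _ => (Set.indicator_of_mem (hx i trivial) _).symm
    · rw [Set.indicator_of_notMem hx]
      simp only [Set.mem_pi, Set.mem_univ, true_imp_iff, not_forall] at hx
      obtain ⟨i, hi⟩ := hx
      exact (Finset.prod_eq_zero (Finset.mem_univ i) (Set.indicator_of_notMem hi _)).symm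
  simp_rw [h]
  rw [lintegral_pi_prod fun i => (hf i).indicator (hs i)]
  refine Finset.prod_congr rfl fun i _ => ?_
  rw [lintegral_indicator (hs i), withDensity_apply _ (hs i)]

/-- The density of `N(δ, v)` with respect to `N(0, v)`. -/
noncomputable def gaussRatio (v : ℝ≥0) (δ y : ℝ) : ℝ := Real.exp (δ * y / v - δ ^ 2 / (2 * v))

@[fun_prop]
theorem measurable_gaussRatio (v : ℝ≥0) (δ : ℝ) : Measurable (gaussRatio v δ) := by
  unfold gaussRatio; fun_prop

theorem gaussianReal_withDensity {v : ℝ≥0} (hv : v ≠ 0) (δ : ℝ) :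
    (gaussianReal 0 v).withDensity (fun y => ENNReal.ofReal (gaussRatio v δ y)) =
      gaussianReal δ v := by
  rw [gaussianReal_of_var_ne_zero _ hv, gaussianReal_of_var_ne_zero _ hv,
    ← withDensity_mul _ (measurable_gaussianPDF 0 v) (by fun_prop)]
  congr 1
  funext y
  rw [Pi.mul_apply, gaussianPDF, gaussianPDF,
    ← ENNReal.ofReal_mul (gaussianPDFReal_nonneg 0 v y)]
  congr 1
  rw [gaussianPDFReal, gaussianPDFReal, gaussRatio, mul_assoc, ← Real.exp_add]
  have : (v : ℝ) ≠ 0 := by exact_mod_cast hv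
  congr 2
  field_simp
  ring

theorem lintegral_gaussRatio {v : ℝ≥0} (hv : v ≠ 0) (δ : ℝ) :
    ∫⁻ y, ENNReal.ofReal (gaussRatio v δ y) ∂(gaussianReal 0 v) = 1 := by
  rw [← setLIntegral_univ, ← withDensity_apply _ MeasurableSet.univ, gaussianReal_withDensity hv]
  exact measure_univ

/-- Completing the square: the squared ratio for the shift δ is e^{δ²/v} times the ratio for the
shift 2δ, which integrates to one. -/
theorem lintegral_gaussRatio_sq {v : ℝ≥0} (hv : v ≠ 0) (δ : ℝ) :
    ∫⁻ y, ENNReal.ofReal (gaussRatio v δ y) ^ 2 ∂(gaussianReal 0 v) =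
      ENNReal.ofReal (Real.exp (δ ^ 2 / v)) := by
  have h : ∀ y, ENNReal.ofReal (gaussRatio v δ y) ^ 2 =
      ENNReal.ofReal (Real.exp (δ ^ 2 / v)) * ENNReal.ofReal (gaussRatio v (2 * δ) y) := fun y => by
    rw [gaussRatio, gaussRatio, ← ENNReal.ofReal_pow (Real.exp_pos _).le,
      ← ENNReal.ofReal_mul (Real.exp_pos _).le]
    congr 1
    rw [← Real.exp_nat_mul, ← Real.exp_add]
    have : (v : ℝ) ≠ 0 := by exact_mod_cast hv
    congr 1
    push_cast
    field_simp
    ring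
  simp_rw [h]
  rw [lintegral_const_mul _ (by fun_prop), lintegral_gaussRatio hv, mul_one]

/-- The law of an indicator and an error. -/
noncomputable abbrev siteLaw (p : unitInterval) (v : ℝ≥0) : Measure (Bool × ℝ) :=
  (bernoulliMeasure true false p).prod (gaussianReal 0 v)

/-- Shift the error by `δ` when the entry is observed. -/
noncomputable def siteShift (δ : ℝ) (z : Bool × ℝ) : Bool × ℝ :=
  (z.1, if z.1 = true then z.2 + δ else z.2)

/-- The likelihood ratio of one entry, when its mean changes by `δ`. -/
noncomputable def siteRatio (v : ℝ≥0) (δ : ℝ) (z : Bool × ℝ) : ℝ :=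
  if z.1 = true then gaussRatio v δ z.2 else 1

theorem siteRatio_nonneg (v : ℝ≥0) (δ : ℝ) (z : Bool × ℝ) : 0 ≤ siteRatio v δ z := by
  unfold siteRatio gaussRatio; split_ifs <;> positivity

@[fun_prop]
theorem measurable_siteShift (δ : ℝ) : Measurable (siteShift δ) := by
  unfold siteShift
  refine Measurable.prodMk measurable_fst (Measurable.ite ?_ (by fun_prop) measurable_snd)
  exact measurable_fst (measurableSet_singleton true)

@[fun_prop]
theorem measurable_siteRatio (v : ℝ≥0) (δ : ℝ) : Measurable (siteRatio v δ) := by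
  unfold siteRatio
  exact Measurable.ite (measurable_fst (measurableSet_singleton true)) (by fun_prop)
    measurable_const

theorem lintegral_siteLaw (p : unitInterval) (v : ℝ≥0) {f : Bool × ℝ → ℝ≥0∞} (hf : Measurable f) :
    ∫⁻ z, f z ∂(siteLaw p v) = unitInterval.toNNReal p * ∫⁻ y, f (true, y) ∂(gaussianReal 0 v) +
      unitInterval.toNNReal (unitInterval.symm p) * ∫⁻ y, f (false, y) ∂(gaussianReal 0 v) := by
  rw [siteLaw, lintegral_prod _ hf.aemeasurable, bernoulliMeasure_def, lintegral_add_measure,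
    lintegral_smul_measure, lintegral_smul_measure, lintegral_dirac, lintegral_dirac]
  rfl

theorem toNNReal_add_symm (p : unitInterval) :
    (unitInterval.toNNReal p : ℝ≥0∞) + unitInterval.toNNReal (unitInterval.symm p) = 1 := by
  rw [← ENNReal.coe_add, ← ENNReal.coe_one]
  congr 1
  ext
  simp

theorem lintegral_siteRatio (p : unitInterval) {v : ℝ≥0} (hv : v ≠ 0) (δ : ℝ) :
    ∫⁻ z, ENNReal.ofReal (siteRatio v δ z) ∂(siteLaw p v) = 1 := by
  rw [lintegral_siteLaw p v (by fun_prop)]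
  simp only [siteRatio, if_true, Bool.false_eq_true, if_false, lintegral_gaussRatio hv, mul_one,
    ENNReal.ofReal_one, lintegral_const, measure_univ, toNNReal_add_symm]

/-- The exact value is p e^{δ²/v} + 1 - p. The bound 1 + x ≤ eˣ puts it in a form in which the
product over entries becomes a sum in the exponent. -/
theorem lintegral_siteRatio_sq_le (p : unitInterval) {v : ℝ≥0} (hv : v ≠ 0) (δ : ℝ) :
    ∫⁻ z, ENNReal.ofReal (siteRatio v δ z) ^ 2 ∂(siteLaw p v) ≤
      ENNReal.ofReal (Real.exp (p * (Real.exp (δ ^ 2 / v) - 1))) := by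
  rw [lintegral_siteLaw p v (by fun_prop)]
  simp only [siteRatio, if_true, Bool.false_eq_true, if_false, lintegral_gaussRatio_sq hv, mul_one,
    ENNReal.ofReal_one, one_pow, lintegral_const, measure_univ]
  have h1 : ∀ q : unitInterval, (unitInterval.toNNReal q : ℝ≥0∞) = ENNReal.ofReal (q : ℝ) :=
    fun q => by rw [ENNReal.ofReal]; congr 1; ext; simp [q.2.1]
  rw [h1, h1, ← ENNReal.ofReal_mul p.2.1, ← ENNReal.ofReal_add
    (mul_nonneg p.2.1 (Real.exp_pos _).le) (unitInterval.symm p).2.1]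
  refine ENNReal.ofReal_le_ofReal ?_
  have := Real.add_one_le_exp ((p : ℝ) * (Real.exp (δ ^ 2 / v) - 1))
  have e : ((unitInterval.symm p : unitInterval) : ℝ) = 1 - p := rfl
  rw [e]
  linarith

theorem map_siteShift (p : unitInterval) {v : ℝ≥0} (hv : v ≠ 0) (δ : ℝ) :
    (siteLaw p v).map (siteShift δ) =
      (siteLaw p v).withDensity fun z => ENNReal.ofReal (siteRatio v δ z) := by
  refine Measure.ext_of_lintegral _ fun f hf => ?_
  rw [lintegral_map hf (by fun_prop), lintegral_withDensity_eq_lintegral_mul _ (by fun_prop) hf,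
    lintegral_siteLaw p v (f := fun z => f (siteShift δ z)) (hf.comp (measurable_siteShift δ)),
    lintegral_siteLaw p v (by fun_prop)]
  have hf1 : Measurable fun y => f (true, y) := by fun_prop
  have h1 : ∫⁻ y, f (true, y + δ) ∂(gaussianReal 0 v) =
      ∫⁻ y, ENNReal.ofReal (gaussRatio v δ y) * f (true, y) ∂(gaussianReal 0 v) := by
    have := lintegral_map (μ := gaussianReal 0 v) hf1 (show Measurable fun y : ℝ => y + δ by fun_prop)
    rw [← this, gaussianReal_map_add_const, zero_add, ← gaussianReal_withDensity hv,
      lintegral_withDensity_eq_lintegral_mul _ (by fun_prop) hf1]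
    rfl
  simp only [siteShift, siteRatio, Pi.mul_apply, if_true, Bool.false_eq_true, if_false, h1,
    ENNReal.ofReal_one, one_mul]

variable {m l : ℕ}

/-- The likelihood ratio of the observed entries, when the matrix of means changes by `Δ`. -/
noncomputable def likRatio (v : ℝ≥0) (Δ : Matrix (Fin m) (Fin l) ℝ)
    (x : Fin m → Fin l → Bool × ℝ) : ℝ := ∏ i, ∏ t, siteRatio v (Δ i t) (x i t)

theorem likRatio_nonneg (v : ℝ≥0) (Δ : Matrix (Fin m) (Fin l) ℝ) (x : Fin m → Fin l → Bool × ℝ) :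
    0 ≤ likRatio v Δ x :=
  Finset.prod_nonneg fun _ _ => Finset.prod_nonneg fun _ _ => siteRatio_nonneg _ _ _

theorem ofReal_likRatio (v : ℝ≥0) (Δ : Matrix (Fin m) (Fin l) ℝ) (x : Fin m → Fin l → Bool × ℝ) :
    ENNReal.ofReal (likRatio v Δ x) =
      ∏ i, ∏ t, ENNReal.ofReal (siteRatio v (Δ i t) (x i t)) := by
  rw [likRatio, ENNReal.ofReal_prod_of_nonneg (f := fun i => ∏ t, siteRatio v (Δ i t) (x i t))
    fun _ _ => Finset.prod_nonneg fun _ _ => siteRatio_nonneg _ _ _]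
  exact Finset.prod_congr rfl fun i _ =>
    ENNReal.ofReal_prod_of_nonneg fun _ _ => siteRatio_nonneg _ _ _

@[fun_prop]
theorem measurable_likRatio (v : ℝ≥0) (Δ : Matrix (Fin m) (Fin l) ℝ) :
    Measurable (likRatio v Δ) := by
  unfold likRatio
  exact Finset.measurable_prod _ fun i _ => Finset.measurable_prod _ fun t _ =>
    (measurable_siteRatio v _).comp (measurable_entry i t)

variable {p : unitInterval} {σ : ℝ}

theorem noiseLaw_eq (p : unitInterval) (σ : ℝ) : noiseLaw m l p σ =
    Measure.pi fun _ => Measure.pi fun _ => siteLaw p (Real.toNNReal (σ ^ 2)) := rfl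

theorem isProbabilityMeasure_siteRatio (p : unitInterval) {v : ℝ≥0} (hv : v ≠ 0) (δ : ℝ) :
    IsProbabilityMeasure ((siteLaw p v).withDensity fun z => ENNReal.ofReal (siteRatio v δ z)) :=
  ⟨by rw [withDensity_apply _ MeasurableSet.univ, setLIntegral_univ, lintegral_siteRatio p hv]⟩

/-- The change of measure for one entry is tensorised twice, over periods and then over units. -/
theorem map_shift_noiseLaw (hσ : 0 < σ) (Δ : Matrix (Fin m) (Fin l) ℝ) :
    (noiseLaw m l p σ).map (fun x i t => siteShift (Δ i t) (x i t)) =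
      (noiseLaw m l p σ).withDensity
        fun x => ENNReal.ofReal (likRatio (Real.toNNReal (σ ^ 2)) Δ x) := by
  set v := Real.toNNReal (σ ^ 2) with hv'
  have hv : v ≠ 0 := by rw [hv', ne_eq, Real.toNNReal_eq_zero]; push Not; positivity
  have hP := fun i t => isProbabilityMeasure_siteRatio p hv (Δ i t)
  simp_rw [ofReal_likRatio]
  rw [noiseLaw_eq, ← hv']
  have hm : ∀ i : Fin m, Measurable fun (y : Fin l → Bool × ℝ) t => siteShift (Δ i t) (y t) :=
    fun i => measurable_pi_lambda _ fun t => by fun_prop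
  have hrow : ∀ i, (Measure.pi fun _ : Fin l => siteLaw p v).map
      (fun y t => siteShift (Δ i t) (y t)) = (Measure.pi fun _ : Fin l => siteLaw p v).withDensity
        fun y => ∏ t, ENNReal.ofReal (siteRatio v (Δ i t) (y t)) := fun i => by
    rw [← pi_withDensity (μ := fun _ : Fin l => siteLaw p v)
      (f := fun t z => ENNReal.ofReal (siteRatio v (Δ i t) z)) (fun t => by fun_prop)]
    have : ∀ t, SigmaFinite ((siteLaw p v).map (siteShift (Δ i t))) := fun t => by
      rw [map_siteShift p hv]; infer_instance
    rw [Measure.pi_map_pi (μ := fun _ : Fin l => siteLaw p v) fun t =>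
      (measurable_siteShift (Δ i t)).aemeasurable]
    simp_rw [map_siteShift p hv]
  have hP2 : ∀ i, IsProbabilityMeasure ((Measure.pi fun _ : Fin l => siteLaw p v).map
      (fun y t => siteShift (Δ i t) (y t))) := fun i =>
    Measure.isProbabilityMeasure_map (hm i).aemeasurable
  have h1 := Measure.pi_map_pi (μ := fun _ : Fin m => Measure.pi fun _ : Fin l => siteLaw p v)
    (f := fun i y t => siteShift (Δ i t) (y t)) fun i => (hm i).aemeasurable
  rw [h1]
  simp_rw [hrow]
  have : ∀ i, SigmaFinite ((Measure.pi fun _ : Fin l => siteLaw p v).withDensity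
      fun y => ∏ t, ENNReal.ofReal (siteRatio v (Δ i t) (y t))) := fun i => by
    rw [← hrow]; infer_instance
  rw [pi_withDensity (μ := fun _ : Fin m => Measure.pi fun _ : Fin l => siteLaw p v)
    (f := fun i y => ∏ t, ENNReal.ofReal (siteRatio v (Δ i t) (y t))) fun i =>
      Finset.measurable_prod _ fun t _ => by fun_prop]

theorem lintegral_likRatio (hσ : 0 < σ) (Δ : Matrix (Fin m) (Fin l) ℝ) :
    ∫⁻ x, ENNReal.ofReal (likRatio (Real.toNNReal (σ ^ 2)) Δ x) ∂(noiseLaw m l p σ) = 1 := by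
  rw [← setLIntegral_univ, ← withDensity_apply _ MeasurableSet.univ, ← map_shift_noiseLaw hσ]
  have : IsProbabilityMeasure ((noiseLaw m l p σ).map fun x i t => siteShift (Δ i t) (x i t)) :=
    Measure.isProbabilityMeasure_map (measurable_pi_lambda _ fun i => measurable_pi_lambda _
      fun t => (measurable_siteShift _).comp (measurable_entry i t)).aemeasurable
  exact measure_univ

theorem lintegral_likRatio_sq_le (hσ : 0 < σ) (Δ : Matrix (Fin m) (Fin l) ℝ) :
    ∫⁻ x, ENNReal.ofReal (likRatio (Real.toNNReal (σ ^ 2)) Δ x) ^ 2 ∂(noiseLaw m l p σ) ≤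
      ENNReal.ofReal (Real.exp (p * ∑ i, ∑ t, (Real.exp (Δ i t ^ 2 / σ ^ 2) - 1))) := by
  set v := Real.toNNReal (σ ^ 2) with hv'
  have hv : v ≠ 0 := by rw [hv', ne_eq, Real.toNNReal_eq_zero]; push Not; positivity
  have hvr : (v : ℝ) = σ ^ 2 := Real.coe_toNNReal _ (by positivity)
  simp_rw [ofReal_likRatio, ← Finset.prod_pow]
  rw [noiseLaw_eq, ← hv', lintegral_pi_prod
    (μ := fun _ : Fin m => Measure.pi fun _ : Fin l => siteLaw p v)
    (f := fun i y => ∏ t, ENNReal.ofReal (siteRatio v (Δ i t) (y t)) ^ 2) fun i =>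
      Finset.measurable_prod _ fun t _ => by fun_prop]
  simp_rw [Finset.mul_sum, Real.exp_sum]
  rw [ENNReal.ofReal_prod_of_nonneg fun _ _ => by positivity]
  refine Finset.prod_le_prod' fun i _ => ?_
  rw [lintegral_pi_prod (μ := fun _ : Fin l => siteLaw p v)
    (f := fun t z => ENNReal.ofReal (siteRatio v (Δ i t) z) ^ 2) fun t => by fun_prop,
    ENNReal.ofReal_prod_of_nonneg fun _ _ => by positivity]
  refine Finset.prod_le_prod' fun t _ => ?_
  rw [← hvr]
  exact lintegral_siteRatio_sq_le p hv _

/-- Changing the means by Δ is the same as shifting the errors of the observed entries. The law of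
the data under M + Δ thus becomes a change of measure of the noise, with the same data map for both
models. -/
theorem observed_shift (M Δ : Matrix (Fin m) (Fin l) ℝ) (x : Fin m → Fin l → Bool × ℝ) :
    observed M (fun i t => siteShift (Δ i t) (x i t)) = observed (M + Δ) x := by
  refine Prod.ext ?_ rfl
  funext i t
  simp only [observed, siteShift, Matrix.add_apply]
  split_ifs
  · ring
  · rfl

theorem measurable_observed (M : Matrix (Fin m) (Fin l) ℝ) : Measurable (observed M) := by
  refine Measurable.prodMk ?_ ?_
  · refine measurable_pi_lambda _ fun i => measurable_pi_lambda _ fun t => ?_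
    refine Measurable.ite ((measurable_entry i t).fst (measurableSet_singleton true)) ?_
      measurable_const
    exact (measurable_entry i t).snd.const_add _
  · exact measurable_pi_lambda _ fun i => measurable_pi_lambda _ fun t => (measurable_entry i t).fst

end Likelihood

/-! ### Chi-square lower bound on the mean squared error. -/

section HammersleyChapmanRobbins

open scoped ENNReal

/-- The Hammersley–Chapman–Robbins inequality. -/
theorem sq_integral_sub_le {Ω : Type*} [MeasurableSpace Ω] {μ : Measure Ω} [IsProbabilityMeasure μ]
    {X L : Ω → ℝ} (hX : Measurable X) (hL : Measurable L) (hL0 : ∀ x, 0 ≤ L x)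
    (hL1 : ∫⁻ x, ENNReal.ofReal (L x) ∂μ = 1) {V : ℝ} (hV : 0 < V)
    (hL2 : ∫⁻ x, ENNReal.ofReal (L x) ^ 2 ∂μ ≤ ENNReal.ofReal (1 + V)) (c : ℝ) :
    ENNReal.ofReal ((∫ x, X x ∂(μ.withDensity fun x => ENNReal.ofReal (L x)) - ∫ x, X x ∂μ) ^ 2) ≤
      (∫⁻ x, ENNReal.ofReal ((X x - c) ^ 2) ∂μ) * ENNReal.ofReal V := by
  -- An infinite second moment makes the bound trivial. A finite one makes X square integrable, so
  -- all the means below exist.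
  by_cases htop : ∫⁻ x, ENNReal.ofReal ((X x - c) ^ 2) ∂μ = ⊤
  · rw [htop, ENNReal.top_mul (by simpa using hV)]
    exact le_top
  have hLint : Integrable L μ := by
    rw [← lintegral_ofReal_ne_top_iff_integrable hL.aestronglyMeasurable (ae_of_all _ hL0), hL1]
    exact ENNReal.one_ne_top
  have hL1' : ∫ x, L x ∂μ = 1 := by
    rw [integral_eq_lintegral_of_nonneg_ae (ae_of_all _ hL0) hL.aestronglyMeasurable, hL1]
    rfl
  have hLsq : ∀ x, ENNReal.ofReal (L x) ^ 2 = ENNReal.ofReal (L x ^ 2) := fun x =>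
    (ENNReal.ofReal_pow (hL0 x) 2).symm
  simp_rw [hLsq] at hL2
  have hLsqint : Integrable (fun x => L x ^ 2) μ := by
    rw [← lintegral_ofReal_ne_top_iff_integrable (by fun_prop) (ae_of_all _ fun x => sq_nonneg _)]
    exact ne_top_of_le_ne_top ENNReal.ofReal_ne_top hL2
  have hL2' : ∫ x, L x ^ 2 ∂μ ≤ 1 + V := by
    rw [integral_eq_lintegral_of_nonneg_ae (ae_of_all _ fun x => sq_nonneg _) (by fun_prop)]
    exact ENNReal.toReal_le_of_le_ofReal (by linarith) hL2
  have hXsqint : Integrable (fun x => (X x - c) ^ 2) μ := by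
    rw [← lintegral_ofReal_ne_top_iff_integrable (by fun_prop) (ae_of_all _ fun x => sq_nonneg _)]
    exact htop
  have hXL2 : MemLp (fun x => X x - c) 2 μ := (memLp_two_iff_integrable_sq (by fun_prop)).2 hXsqint
  have hLL2 : MemLp (fun x => L x - 1) 2 μ :=
    ((memLp_two_iff_integrable_sq (by fun_prop)).2 hLsqint).sub (memLp_const 1)
  have hXint : Integrable X μ := by
    have h := (hXL2.integrable (by norm_num)).add (integrable_const c)
    exact h.congr (ae_of_all _ fun x => by simp)
  have hprod : Integrable (fun x => (X x - c) * (L x - 1)) μ := hXL2.integrable_mul hLL2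
  -- The density has integral one, so X may be centred at any constant c. Taking c to be the target
  -- makes the second moment the mean squared error rather than the variance.
  have hdiff : ∫ x, X x ∂(μ.withDensity fun x => ENNReal.ofReal (L x)) - ∫ x, X x ∂μ =
      ∫ x, (X x - c) * (L x - 1) ∂μ := by
    rw [integral_withDensity_eq_integral_toReal_smul (by fun_prop)
      (ae_of_all _ fun _ => ENNReal.ofReal_lt_top)]
    have e1 : ∀ x, (ENNReal.ofReal (L x)).toReal • X x =
        (X x - c) * (L x - 1) + (X x + (c * L x - c)) := fun x => by
      rw [ENNReal.toReal_ofReal (hL0 x), smul_eq_mul]; ring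
    simp_rw [e1]
    have i2 : Integrable (fun x => c * L x - c) μ := (hLint.const_mul c).sub (integrable_const c)
    have i1 : Integrable (fun x => X x + (c * L x - c)) μ := hXint.add i2
    rw [integral_add hprod i1, integral_add hXint i2,
      integral_sub (hLint.const_mul c) (integrable_const c), integral_const_mul, hL1']
    simp
  have hXval : ∫⁻ x, ENNReal.ofReal ((X x - c) ^ 2) ∂μ = ENNReal.ofReal (∫ x, (X x - c) ^ 2 ∂μ) :=
    (ofReal_integral_eq_lintegral_ofReal hXsqint (ae_of_all _ fun x => sq_nonneg _)).symm
  rw [hdiff, hXval, ← ENNReal.ofReal_mul (integral_nonneg fun x => sq_nonneg _)]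
  refine ENNReal.ofReal_le_ofReal ?_
  set D := ∫ x, (X x - c) * (L x - 1) ∂μ with hD
  set A := ∫ x, (X x - c) ^ 2 ∂μ with hA
  have hBint : Integrable (fun x => (L x - 1) ^ 2) μ := hLL2.integrable_sq
  have hB : ∫ x, (L x - 1) ^ 2 ∂μ ≤ V := by
    have e2 : ∀ x, (L x - 1) ^ 2 = L x ^ 2 + (1 - 2 * L x) := fun x => by ring
    simp_rw [e2]
    have i1 : Integrable (fun x => 1 - 2 * L x) μ := (integrable_const 1).sub (hLint.const_mul 2)
    rw [integral_add hLsqint i1,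
      integral_sub (integrable_const 1) (hLint.const_mul 2), integral_const_mul, hL1']
    simp
    linarith
  -- Cauchy–Schwarz: expanding this nonnegative integral gives V(AV - D²) ≥ 0.
  have hquad : 0 ≤ ∫ x, (V * (X x - c) - D * (L x - 1)) ^ 2 ∂μ := integral_nonneg fun x => sq_nonneg _
  have e3 : ∫ x, (V * (X x - c) - D * (L x - 1)) ^ 2 ∂μ =
      V ^ 2 * A - 2 * V * D * D + D ^ 2 * ∫ x, (L x - 1) ^ 2 ∂μ := by
    have e4 : ∀ x, (V * (X x - c) - D * (L x - 1)) ^ 2 = V ^ 2 * (X x - c) ^ 2 -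
        (2 * V * D) * ((X x - c) * (L x - 1)) + D ^ 2 * (L x - 1) ^ 2 := fun x => by ring
    simp_rw [e4]
    have i1 : Integrable (fun x => V ^ 2 * (X x - c) ^ 2 -
        (2 * V * D) * ((X x - c) * (L x - 1))) μ := (hXsqint.const_mul _).sub (hprod.const_mul _)
    rw [integral_add i1 (hBint.const_mul _),
      integral_sub (hXsqint.const_mul _) (hprod.const_mul _), integral_const_mul,
      integral_const_mul, integral_const_mul]
  rw [e3] at hquad
  have h5 : D ^ 2 * ∫ x, (L x - 1) ^ 2 ∂μ ≤ D ^ 2 * V := by gcongr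
  have h6 : 0 ≤ V * (A * V - D ^ 2) := by nlinarith
  have := nonneg_of_mul_nonneg_right h6 hV
  linarith

variable {m l : ℕ} {p : unitInterval} {σ : ℝ}

/-- The lower bound for the mean squared error that comes from a change `Δ` of the means. -/
theorem sq_mean_sub_le_mse (hσ : 0 < σ) (M Δ : Matrix (Fin m) (Fin l) ℝ)
    {U : (Fin m → Fin l → ℝ) × (Fin m → Fin l → Bool) → ℝ} (hU : Measurable U) {V : ℝ} (hV : 0 < V)
    (hVΔ : Real.exp (p * ∑ i, ∑ t, (Real.exp (Δ i t ^ 2 / σ ^ 2) - 1)) ≤ 1 + V) (c : ℝ) :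
    ENNReal.ofReal ((∫ x, U (observed (M + Δ) x) ∂(noiseLaw m l p σ) -
        ∫ x, U (observed M x) ∂(noiseLaw m l p σ)) ^ 2) ≤
      (∫⁻ x, ENNReal.ofReal ((U (observed M x) - c) ^ 2) ∂(noiseLaw m l p σ)) *
        ENNReal.ofReal V := by
  have hUm : Measurable fun x => U (observed M x) := hU.comp (measurable_observed M)
  have h := sq_integral_sub_le (μ := noiseLaw m l p σ) hUm
    (measurable_likRatio (Real.toNNReal (σ ^ 2)) Δ) (likRatio_nonneg _ _)
    (lintegral_likRatio hσ Δ) hV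
    ((lintegral_likRatio_sq_le hσ Δ).trans (ENNReal.ofReal_le_ofReal hVΔ)) c
  have hm : Measurable fun (x : Fin m → Fin l → Bool × ℝ) i t => siteShift (Δ i t) (x i t) :=
    measurable_pi_lambda _ fun i => measurable_pi_lambda _
      fun t => (measurable_siteShift _).comp (measurable_entry i t)
  rw [← map_shift_noiseLaw hσ, integral_map hm.aemeasurable hUm.aestronglyMeasurable] at h
  simp_rw [observed_shift] at h
  exact h

end HammersleyChapmanRobbins

/-! ### Models with shifted loadings and factors -/

section StateExtension

/-- Uncountable standard Borel spaces are isomorphic, so a state together with infinitely many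
shifts can be coded as a point of a line. The sequence factor keeps the space uncountable even for d
= 0. -/
theorem not_countable_extendedState (d : ℕ) :
    ¬ Countable (EuclideanSpace ℝ (Fin d) × (ℕ → ℝ)) := fun h =>
  not_countable_iff.2 (inferInstanceAs (Uncountable ℝ))
    (Function.Injective.countable (f := fun x : ℝ =>
      ((0 : EuclideanSpace ℝ (Fin d)), fun _ : ℕ => x)) fun x y hxy => by
        simpa using congrFun (congrArg Prod.snd hxy) 0)

theorem not_countable_realLine : ¬ Countable (EuclideanSpace ℝ (Fin 1)) := fun h =>
  not_countable_iff.2 (inferInstanceAs (Uncountable ℝ))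
    (Function.Injective.countable (f := fun x : ℝ =>
      (WithLp.toLp 2 fun _ => x : EuclideanSpace ℝ (Fin 1))) fun x y hxy => by
        simpa using congrArg (fun v : EuclideanSpace ℝ (Fin 1) => v 0) hxy)

/-- A Borel isomorphism that codes a state and a sequence of numbers as one state. -/
noncomputable def codeState (d : ℕ) :
    (EuclideanSpace ℝ (Fin d) × (ℕ → ℝ)) ≃ᵐ EuclideanSpace ℝ (Fin 1) :=
  PolishSpace.measurableEquivOfNotCountable (not_countable_extendedState d) not_countable_realLine

/-- The original states inside the extended state space. -/
noncomputable def embedState (d : ℕ) (z : EuclideanSpace ℝ (Fin d)) : EuclideanSpace ℝ (Fin 1) :=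
  codeState d (z, 0)

/-- For an embedding, integrals and L² norms against the image measure pull back for arbitrary
functions, with no measurability to check. -/
theorem measurableEmbedding_embedState (d : ℕ) : MeasurableEmbedding (embedState d) :=
  (codeState d).measurableEmbedding.comp (measurableEmbedding_prod_mk_right 0)

@[simp]
theorem codeState_symm_embedState (d : ℕ) (z : EuclideanSpace ℝ (Fin d)) :
    (codeState d).symm (embedState d z) = (z, 0) := by simp [embedState]

end StateExtension

namespace PanelModel

variable {Ξ : Type*} [MeasurableSpace Ξ] {N T : ℕ → ℕ} (θ : PanelModel Ξ N T) (K : ℕ → ℕ)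

theorem eLpNorm_φ (n r : ℕ) : eLpNorm (θ.φ n r) 2 (θ.ρ n) = 1 := by
  have h1 := θ.orthonormal_φ n r r
  rw [if_pos rfl] at h1
  have h2 := (θ.memLp_φ n r).eLpNorm_eq_integral_rpow_norm (by norm_num) (by norm_num)
  rw [h2]
  have h3 : ∫ z, ‖θ.φ n r z‖ ^ (ENNReal.toReal 2) ∂(θ.ρ n) = 1 := by
    rw [← h1]
    refine integral_congr_ae (ae_of_all _ fun z => ?_)
    simp [sq]
  rw [h3]
  simp

theorem integrable_mul_φ (n : ℕ) (t : Fin (T n)) (ξ : Ξ) (r : ℕ) :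
    Integrable (fun z => θ.h n t ξ z * θ.φ n r z) (θ.ρ n) :=
  (θ.memLp_h n t ξ).integrable_mul (θ.memLp_φ n r)

/-- The change of the functions of the latent state that adds `x` to the sieve coefficients. -/
noncomputable def sieveSum (n : ℕ) (x : Fin (K n) → ℝ) (z : EuclideanSpace ℝ (Fin θ.d)) : ℝ :=
  ∑ r : Fin (K n), x r * θ.φ n r z

theorem memLp_sieveSum (n : ℕ) (x : Fin (K n) → ℝ) : MemLp (θ.sieveSum K n x) 2 (θ.ρ n) :=
  memLp_finsetSum _ fun r _ => (θ.memLp_φ n r).const_mul (x r)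

theorem eLpNorm_sieveSum_le (n : ℕ) (x : Fin (K n) → ℝ) :
    eLpNorm (θ.sieveSum K n x) 2 (θ.ρ n) ≤ ENNReal.ofReal (∑ r, |x r|) := by
  have e : θ.sieveSum K n x = ∑ r : Fin (K n), x r • θ.φ n r := by
    funext z; simp [sieveSum]
  rw [e]
  have hm : ∀ r ∈ (Finset.univ : Finset (Fin (K n))),
      AEStronglyMeasurable (x r • θ.φ n r) (θ.ρ n) := fun r _ => (θ.memLp_φ n r).1.const_smul _
  refine (eLpNorm_sum_le hm one_le_two).trans ?_
  rw [ENNReal.ofReal_sum_of_nonneg fun _ _ => abs_nonneg _]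
  refine Finset.sum_le_sum fun r _ => ?_
  rw [eLpNorm_const_smul, eLpNorm_φ, mul_one, Real.enorm_eq_ofReal_abs]

theorem integral_sieveSum_mul_φ (n : ℕ) (x : Fin (K n) → ℝ) (q : ℕ) :
    ∫ z, θ.sieveSum K n x z * θ.φ n q z ∂(θ.ρ n) = if h : q < K n then x ⟨q, h⟩ else 0 := by
  simp_rw [sieveSum, Finset.sum_mul, mul_assoc]
  have hi : ∀ r ∈ (Finset.univ : Finset (Fin (K n))),
      Integrable (fun z => x r * (θ.φ n r z * θ.φ n q z)) (θ.ρ n) := fun r _ =>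
    ((θ.memLp_φ n r).integrable_mul (θ.memLp_φ n q)).const_mul (x r)
  rw [integral_finsetSum _ hi]
  simp_rw [integral_const_mul, θ.orthonormal_φ, mul_ite, mul_one, mul_zero]
  split_ifs with h
  · rw [Finset.sum_eq_single ⟨q, h⟩] <;> simp +contextual [Fin.ext_iff]
  · refine Finset.sum_eq_zero fun r _ => if_neg ?_
    rintro rfl
    exact h r.2

/-- Changes of the loadings and of the factors. -/
structure Shift where
  /-- The change of the loadings. -/
  δβ : (n : ℕ) → Ξ → Matrix (Fin (N n)) (Fin (K n)) ℝ
  /-- The change of the factors. -/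
  δF : (n : ℕ) → Ξ → Matrix (Fin (T n)) (Fin (K n)) ℝ
  measurable_δβ : ∀ n i r, Measurable fun ξ => δβ n ξ i r
  measurable_δF : ∀ n t r, Measurable fun ξ => δF n ξ t r
  δβ_le : ∀ n ξ i r, |δβ n ξ i r| ≤ 1

variable {K} (S : Shift (Ξ := Ξ) (N := N) (T := T) K)

/-- The function `h t` of the shifted model, on the pairs of a state and a shift of its loadings. -/
noncomputable def shiftedFun (n : ℕ) (t : Fin (T n)) (ξ : Ξ)
    (x : EuclideanSpace ℝ (Fin θ.d) × (ℕ → ℝ)) : ℝ :=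
  θ.h n t ξ x.1 + θ.sieveSum K n (S.δF n ξ t) x.1 +
    ∑ r : Fin (K n), (θ.F (K n) n ξ t r + S.δF n ξ t r) * x.2 r

/-- The image measure is carried by the states with zero shift, so this restriction determines every
L² quantity of the new model; the values elsewhere can be prescribed freely. -/
theorem shiftedFun_zero (n : ℕ) (t : Fin (T n)) (ξ : Ξ) (z : EuclideanSpace ℝ (Fin θ.d)) :
    θ.shiftedFun S n t ξ (z, 0) = θ.h n t ξ z + θ.sieveSum K n (S.δF n ξ t) z := by
  simp [shiftedFun]

/-- The basis functions of the shifted model. -/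
noncomputable def shiftedBasis (n r : ℕ) (x : EuclideanSpace ℝ (Fin 1)) : ℝ :=
  θ.φ n r ((codeState θ.d).symm x).1 + ((codeState θ.d).symm x).2 r

@[simp]
theorem shiftedBasis_embedState (n r : ℕ) (z : EuclideanSpace ℝ (Fin θ.d)) :
    θ.shiftedBasis n r (embedState θ.d z) = θ.φ n r z := by simp [shiftedBasis]

/-- The measure of the shifted model. -/
noncomputable def shiftedMeasure (n : ℕ) : Measure (EuclideanSpace ℝ (Fin 1)) :=
  (θ.ρ n).map (embedState θ.d)

theorem integral_shiftedMeasure (n : ℕ) (f : EuclideanSpace ℝ (Fin 1) → ℝ) :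
    ∫ x, f x ∂(θ.shiftedMeasure n) = ∫ z, f (embedState θ.d z) ∂(θ.ρ n) :=
  (measurableEmbedding_embedState θ.d).integral_map f

theorem integral_shiftedFun_mul_basis (n : ℕ) (t : Fin (T n)) (ξ : Ξ) (q : ℕ) :
    ∫ x, θ.shiftedFun S n t ξ ((codeState θ.d).symm x) * θ.shiftedBasis n q x
        ∂(θ.shiftedMeasure n) =
      (∫ z, θ.h n t ξ z * θ.φ n q z ∂(θ.ρ n)) +
        if h : q < K n then S.δF n ξ t ⟨q, h⟩ else 0 := by
  rw [integral_shiftedMeasure]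
  simp_rw [codeState_symm_embedState, shiftedBasis_embedState, shiftedFun_zero, add_mul]
  have hi : Integrable (fun z => θ.sieveSum K n (S.δF n ξ t) z * θ.φ n q z) (θ.ρ n) :=
    (θ.memLp_sieveSum K n _).integrable_mul (θ.memLp_φ n q)
  rw [integral_add (θ.integrable_mul_φ n t ξ q) hi, integral_sieveSum_mul_φ]

theorem shiftedFun_comp_embedState (n : ℕ) (t : Fin (T n)) (ξ : Ξ) :
    (fun x => θ.shiftedFun S n t ξ ((codeState θ.d).symm x)) ∘ embedState θ.d =
      θ.h n t ξ + θ.sieveSum K n (S.δF n ξ t) := by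
  funext z; simp [shiftedFun_zero]

theorem shiftedBasis_comp_embedState (n r : ℕ) :
    θ.shiftedBasis n r ∘ embedState θ.d = θ.φ n r := by funext z; simp

theorem eLpNorm_shiftedMeasure (n : ℕ) (f : EuclideanSpace ℝ (Fin 1) → ℝ) :
    eLpNorm f 2 (θ.shiftedMeasure n) = eLpNorm (f ∘ embedState θ.d) 2 (θ.ρ n) :=
  (measurableEmbedding_embedState θ.d).eLpNorm_map_measure

theorem memLp_shiftedMeasure_iff (n : ℕ) (f : EuclideanSpace ℝ (Fin 1) → ℝ) :
    MemLp f 2 (θ.shiftedMeasure n) ↔ MemLp (f ∘ embedState θ.d) 2 (θ.ρ n) :=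
  (measurableEmbedding_embedState θ.d).memLp_map_measure_iff

theorem eLpNorm_shiftedFun_le (n : ℕ) (t : Fin (T n)) (ξ : Ξ) :
    eLpNorm (fun x => θ.shiftedFun S n t ξ ((codeState θ.d).symm x)) 2 (θ.shiftedMeasure n) ≤
      eLpNorm (θ.h n t ξ) 2 (θ.ρ n) + ENNReal.ofReal (∑ r, |S.δF n ξ t r|) := by
  rw [eLpNorm_shiftedMeasure, shiftedFun_comp_embedState]
  exact (eLpNorm_add_le (θ.memLp_h n t ξ).1 (θ.memLp_sieveSum K n _).1 one_le_two).trans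
    (by gcongr; exact θ.eLpNorm_sieveSum_le K n _)

/-- The shift of the loadings of a unit, as a sequence. -/
noncomputable def shiftSeq (n : ℕ) (i : Fin (N n)) (ξ : Ξ) (r : ℕ) : ℝ :=
  if h : r < K n then S.δβ n ξ i ⟨r, h⟩ else 0

theorem measurable_shiftSeq (n : ℕ) (i : Fin (N n)) : Measurable (shiftSeq S n i) := by
  refine measurable_pi_lambda _ fun r => ?_
  unfold shiftSeq
  by_cases h : r < K n
  · simpa [h] using S.measurable_δβ n i ⟨r, h⟩
  · simp [h]

/-- The model with shifted loadings and factors. The states are extended by a `ρ`-null set. -/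
noncomputable def shifted : PanelModel Ξ N T where
  d := 1
  -- Restricting the shifts to [-1, 1] keeps the new basis functions bounded, by C + 1.
  Z n := (codeState θ.d).symm ⁻¹' {x | x.1 ∈ θ.Z n ∧ ∀ r, |x.2 r| ≤ 1}
  measurableSet_Z n := by
    refine (codeState θ.d).symm.measurable (MeasurableSet.inter ?_ ?_)
    · exact measurable_fst (θ.measurableSet_Z n)
    · have : {x : EuclideanSpace ℝ (Fin θ.d) × (ℕ → ℝ) | ∀ r, |x.2 r| ≤ 1} =
          ⋂ r, {x | |x.2 r| ≤ 1} := by ext; simp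
      change MeasurableSet {x : EuclideanSpace ℝ (Fin θ.d) × (ℕ → ℝ) | ∀ r, |x.2 r| ≤ 1}
      rw [this]
      exact MeasurableSet.iInter fun r => measurableSet_le (by fun_prop) measurable_const
  ρ := θ.shiftedMeasure
  ρ_compl n := by
    rw [shiftedMeasure, (measurableEmbedding_embedState θ.d).map_apply]
    refine measure_mono_null (t := (θ.Z n)ᶜ) (fun z hz (hzZ : z ∈ θ.Z n) => hz ?_) (θ.ρ_compl n)
    simpa using hzZ
  φ := θ.shiftedBasis
  measurable_φ n r := by
    refine Measurable.add ?_ ?_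
    · exact (θ.measurable_φ n r).comp (measurable_fst.comp (codeState θ.d).symm.measurable)
    · exact (measurable_pi_apply r).comp (measurable_snd.comp (codeState θ.d).symm.measurable)
  memLp_φ n r := by
    rw [memLp_shiftedMeasure_iff, shiftedBasis_comp_embedState]
    exact θ.memLp_φ n r
  orthonormal_φ n r s := by
    simpa [integral_shiftedMeasure] using θ.orthonormal_φ n r s
  ζ n i ξ := codeState θ.d (θ.ζ n i ξ, shiftSeq S n i ξ)
  measurable_ζ n i := (codeState θ.d).measurable.comp
    ((θ.measurable_ζ n i).prodMk (measurable_shiftSeq S n i))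
  ζ_mem n i ξ := by
    refine ⟨by simpa using θ.ζ_mem n i ξ, fun r => ?_⟩
    rw [MeasurableEquiv.symm_apply_apply]
    change |shiftSeq S n i ξ r| ≤ 1
    unfold shiftSeq
    split_ifs with h
    · exact S.δβ_le n ξ i _
    · simp
  h n t ξ x := θ.shiftedFun S n t ξ ((codeState θ.d).symm x)
  memLp_h n t ξ := by
    rw [memLp_shiftedMeasure_iff, shiftedFun_comp_embedState]
    exact (θ.memLp_h n t ξ).add (θ.memLp_sieveSum K n (S.δF n ξ t))
  h_expansion n t ξ := by
    refine (θ.h_expansion n t ξ).congr' ?_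
    -- Once m ≥ K the partial sum contains the whole sieve shift, and the remainder is that of the
    -- original expansion.
    filter_upwards [eventually_ge_atTop (K n)] with m hm
    rw [eLpNorm_shiftedMeasure]
    congr 1
    funext z
    simp only [Function.comp_apply, integral_shiftedFun_mul_basis, shiftedBasis_embedState,
      codeState_symm_embedState, shiftedFun_zero]
    have e : ∑ r ∈ Finset.range m, (if h : r < K n then S.δF n ξ t ⟨r, h⟩ else 0) * θ.φ n r z =
        θ.sieveSum K n (S.δF n ξ t) z := by
      rw [sieveSum, ← Finset.sum_subset (Finset.range_mono hm) fun r _ hr => by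
        rw [dif_neg (by simpa using hr), zero_mul]]
      rw [Finset.sum_range]
      exact Finset.sum_congr rfl fun r _ => by rw [dif_pos r.2]
    simp_rw [add_mul]
    rw [Finset.sum_add_distrib, e]
    ring
  measurable_coeff n t r := by
    simp only [integral_shiftedFun_mul_basis]
    refine (θ.measurable_coeff n t r).add ?_
    by_cases h : r < K n
    · simpa [h] using S.measurable_δF n t ⟨r, h⟩
    · simp [h]
  measurable_M n i t := by
    simp only [MeasurableEquiv.symm_apply_apply, shiftedFun, sieveSum]
    refine ((θ.measurable_M n i t).add ?_).add ?_
    · exact Finset.measurable_sum _ fun r _ => (S.measurable_δF n t r).mul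
        ((θ.measurable_φ n r).comp (θ.measurable_ζ n i))
    · exact Finset.measurable_sum _ fun r _ => ((θ.measurable_coeff n t r).add
        (S.measurable_δF n t r)).mul
        ((measurable_pi_apply (r : ℕ)).comp (measurable_shiftSeq S n i))
  p := θ.p
  σ := θ.σ

theorem shifted_β (n : ℕ) (ξ : Ξ) : (θ.shifted S).β (K n) n ξ = θ.β (K n) n ξ + S.δβ n ξ := by
  ext i r
  simp [β, shifted, shiftedBasis, shiftSeq]

theorem shifted_F (n : ℕ) (ξ : Ξ) : (θ.shifted S).F (K n) n ξ = θ.F (K n) n ξ + S.δF n ξ := by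
  ext t r
  have h := θ.integral_shiftedFun_mul_basis S n t ξ r
  rw [dif_pos r.2] at h
  exact h

/-- At unit i the shift of h contributes β δF', and the term of `shiftedFun` linear in x contributes
δβ (F + δF)'. Together they make up the change of the product. -/
theorem shifted_M (n : ℕ) (ξ : Ξ) : (θ.shifted S).M n ξ = θ.M n ξ +
    ((θ.β (K n) n ξ + S.δβ n ξ) * (θ.F (K n) n ξ + S.δF n ξ).transpose -
      θ.β (K n) n ξ * (θ.F (K n) n ξ).transpose) := by
  ext i t
  simp only [M, shifted, Matrix.of_apply, MeasurableEquiv.symm_apply_apply, shiftedFun, sieveSum,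
    Matrix.add_apply, Matrix.sub_apply, Matrix.mul_apply, Matrix.transpose_apply]
  rw [add_assoc, ← Finset.sum_add_distrib, ← Finset.sum_sub_distrib]
  congr 1
  refine Finset.sum_congr rfl fun r _ => ?_
  have : shiftSeq S n i ξ r = S.δβ n ξ i r := by simp [shiftSeq]
  rw [this]
  simp only [β, Matrix.of_apply]
  ring

/-- M and the sieve product change by the same matrix, so the condition on the approximation error
carries over. -/
theorem shifted_MR (n : ℕ) (ξ : Ξ) : (θ.shifted S).MR (K n) n ξ = θ.MR (K n) n ξ := by
  rw [MR, MR, shifted_M, shifted_β, shifted_F]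
  abel

theorem eLpNorm_shifted_h_le (n : ℕ) (t : Fin (T n)) (ξ : Ξ) :
    eLpNorm ((θ.shifted S).h n t ξ) 2 ((θ.shifted S).ρ n) ≤
      eLpNorm (θ.h n t ξ) 2 (θ.ρ n) + ENNReal.ofReal (∑ r, |S.δF n ξ t r|) :=
  θ.eLpNorm_shiftedFun_le S n t ξ

theorem shifted_φ_le {C : ℝ} {n r : ℕ} (h : ∀ z ∈ θ.Z n, |θ.φ n r z| ≤ C) :
    ∀ z ∈ (θ.shifted S).Z n, |(θ.shifted S).φ n r z| ≤ C + 1 := fun _ hz =>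
  (abs_add_le _ _).trans (add_le_add (h _ hz.1) (hz.2 r))

end PanelModel

/-! ### Rates that follow from the conditions on the parameters -/

section Rates

variable {N T K a b : ℕ → ℕ} {p η ψ : ℕ → ℝ} {ν δ g : ℝ}

/-- The logarithmic factor in the condition on the sample size. -/
noncomputable def logFactor (N T : ℕ → ℕ) (n : ℕ) : ℝ := max 1 (Real.log (N n) + Real.log (T n))

theorem one_le_logFactor (n : ℕ) : 1 ≤ logFactor N T n := le_max_left _ _

theorem one_le_min_sqrt {x y : ℕ} (hx : 1 ≤ x) (hy : 1 ≤ y) : 1 ≤ min (√(x : ℝ)) (√(y : ℝ)) :=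
  le_min (Real.one_le_sqrt.2 (by exact_mod_cast hx)) (Real.one_le_sqrt.2 (by exact_mod_cast hy))

theorem sqrt_le_sqrt_mul_log {x : ℕ} (hx : 3 ≤ x) : √(x : ℝ) ≤ √((x : ℝ) * Real.log x) := by
  refine Real.sqrt_le_sqrt (le_mul_of_one_le_right (by positivity) ?_)
  have hx' : (3 : ℝ) ≤ x := by exact_mod_cast hx
  rw [Real.le_log_iff_exp_le (by linarith)]
  linarith [Real.exp_one_lt_d9]

theorem le_eps_sqrt_of_mul_sqrt_le {u v y : ℝ} {x : ℕ} (hx : 1 ≤ x) (hv : 0 ≤ v)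
    (hy : y ≤ x) (h : u * √(x : ℝ) ≤ v * y) : u ≤ v * √(x : ℝ) := by
  have h0 : 0 < √(x : ℝ) := Real.sqrt_pos.2 (by exact_mod_cast hx)
  refine le_of_mul_le_mul_right ?_ h0
  calc _ ≤ v * y := h
    _ ≤ v * x := by gcongr
    _ = v * √(x : ℝ) * √(x : ℝ) := by rw [mul_assoc, Real.mul_self_sqrt (by positivity)]

/-- The exponent of K in the sample-size condition is at least 4, the logarithms are at least one
from 3 on, and min(N, T)/√N ≤ √N. The remaining powers of K are not needed. -/
theorem ParameterSize.core (h : ParameterSize N T K a b p η ψ ν δ g)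
    (hN : Tendsto N atTop atTop) (hT : Tendsto T atTop atTop)
    (hδ : 0 ≤ δ) (hg : 0 ≤ g) (hp : ∀ n, 0 < p n)
    (hη : ∀ n, 0 < η n) (hK : ∀ᶠ n in atTop, 1 ≤ K n) {ε : ℝ} (hε : 0 < ε) :
    ∀ᶠ n in atTop, min (√(a n : ℝ)) (√(b n : ℝ)) * logFactor N T n * η n ^ 3 * (K n : ℝ) ^ 4 ≤
        ε * p n ^ (3 / 2 : ℝ) * √(N n : ℝ) ∧
      min (√(a n : ℝ)) (√(b n : ℝ)) * logFactor N T n * η n ^ 3 * (K n : ℝ) ^ 4 ≤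
        ε * p n ^ (3 / 2 : ℝ) * √(T n : ℝ) := by
  filter_upwards [h.sample.bound hε, hK, hN.eventually_ge_atTop 3, hT.eventually_ge_atTop 3]
    with n hn hKn hNn hTn
  set u := min (√(a n : ℝ)) (√(b n : ℝ)) * logFactor N T n * η n ^ 3 * (K n : ℝ) ^ 4 with hu
  have hP : 0 ≤ p n ^ (3 / 2 : ℝ) := Real.rpow_nonneg (hp n).le _
  have hη' := hη n
  have hL := one_le_logFactor (N := N) (T := T) n
  have hu0 : 0 ≤ u := by
    have : 0 ≤ min (√(a n : ℝ)) (√(b n : ℝ)) := by positivity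
    positivity
  have hK1 : (1 : ℝ) ≤ K n := by exact_mod_cast hKn
  have hKpow : (K n : ℝ) ^ 4 ≤ (K n : ℝ) ^ (4 + 2 * g + 13 / 2 * δ) := by
    rw [← Real.rpow_natCast]
    refine Real.rpow_le_rpow_of_exponent_le hK1 ?_
    push_cast
    nlinarith
  have hbound : u * max (√((N n : ℝ) * Real.log (N n))) (√((T n : ℝ) * Real.log (T n))) ≤
      ε * (p n ^ (3 / 2 : ℝ) * min (N n : ℝ) (T n : ℝ)) := by
    have h1 := (le_abs_self _).trans hn
    rw [Real.norm_of_nonneg (mul_nonneg hP (by positivity))] at h1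
    refine le_trans ?_ h1
    rw [hu]
    unfold logFactor
    gcongr
  constructor
  · refine le_eps_sqrt_of_mul_sqrt_le (y := min (N n : ℝ) (T n : ℝ)) (by omega) (by positivity)
      (min_le_left _ _) ?_
    calc _ ≤ u * max (√((N n : ℝ) * Real.log (N n))) (√((T n : ℝ) * Real.log (T n))) := by
          gcongr
          exact (sqrt_le_sqrt_mul_log hNn).trans (le_max_left _ _)
      _ ≤ _ := hbound.trans_eq (by ring)
  · refine le_eps_sqrt_of_mul_sqrt_le (y := min (N n : ℝ) (T n : ℝ)) (by omega) (by positivity)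
      (min_le_right _ _) ?_
    calc _ ≤ u * max (√((N n : ℝ) * Real.log (N n))) (√((T n : ℝ) * Real.log (T n))) := by
          gcongr
          exact (sqrt_le_sqrt_mul_log hTn).trans (le_max_right _ _)
      _ ≤ _ := hbound.trans_eq (by ring)

theorem rpow_three_halves_le {p : ℝ} (hp : 0 < p) (hp1 : p ≤ 1) :
    p ^ (3 / 2 : ℝ) ≤ p ∧ p ^ (3 / 2 : ℝ) ≤ √p ∧ (p ^ (3 / 2 : ℝ)) ^ 2 = p ^ 3 := by
  refine ⟨?_, ?_, ?_⟩
  · simpa using Real.rpow_le_rpow_of_exponent_ge hp hp1 (show (1 : ℝ) ≤ 3 / 2 by norm_num)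
  · rw [Real.sqrt_eq_rpow]
    exact Real.rpow_le_rpow_of_exponent_ge hp hp1 (by norm_num)
  · rw [← Real.rpow_natCast, ← Real.rpow_mul hp.le, ← Real.rpow_natCast]
    norm_num

/-- What the condition on the sample size says about one of the two dimensions `x`. -/
structure RateBound (ε m L e k p x : ℝ) : Prop where
  eta_le : e ≤ ε * (√p * √x)
  k_mul_eta_le : k * e ≤ ε * (p * x)
  min_mul_le : m ^ 2 * (e * k) ≤ ε * x
  log_add_le : L + k ≤ ε * (p ^ 2 * x / (e ^ 2 * k ^ 2))

/-- The first two bounds come from `hcore` and the last two from its square. Since e ≥ c, a missing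
power of e costs a power of c, at most five. The 1/2 absorbs L + k ≤ 2Lk, and the minimum with 1
lets the squared constant be bounded by the constant. -/
theorem RateBound.of_core {ε c m L e k p x : ℝ} (hε : 0 < ε) (hc : 0 < c) (hc1 : c ≤ 1) (hm : 1 ≤ m)
    (hL : 1 ≤ L) (hce : c ≤ e) (hk : 1 ≤ k) (hp : 0 < p) (hp1 : p ≤ 1) (hx : 1 ≤ x)
    (hcore : m * L * e ^ 3 * k ^ 4 ≤ min 1 (ε * c ^ 5 / 2) * p ^ (3 / 2 : ℝ) * √x) :
    RateBound ε m L e k p x := by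
  obtain ⟨hP1, hP2, hP3⟩ := rpow_three_halves_le hp hp1
  set P := p ^ (3 / 2 : ℝ)
  have hP : 0 < P := Real.rpow_pos_of_pos hp _
  have he : 0 < e := hc.trans_le hce
  set ε' := min 1 (ε * c ^ 5 / 2) with hε'
  have hε'0 : 0 < ε' := lt_min one_pos (by positivity)
  have hε'1 : ε' ≤ 1 := min_le_left _ _
  have hε'2 : ε' ≤ ε * c ^ 5 / 2 := min_le_right _ _
  have hsx : 1 ≤ √x := Real.one_le_sqrt.2 hx
  have hsxx : √x ≤ x := by nlinarith [Real.mul_self_sqrt (show 0 ≤ x by linarith)]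
  have hk4 : k ≤ k ^ 4 := le_self_pow₀ hk (by norm_num)
  have hmL : 1 ≤ m * L := one_le_mul_of_one_le_of_one_le hm hL
  have hc5 : c ^ 5 ≤ c ^ 2 := pow_le_pow_of_le_one hc.le hc1 (by norm_num)
  have hke : k * e ^ 3 ≤ ε' * P * √x := by
    refine le_trans ?_ hcore
    calc k * e ^ 3 = 1 * e ^ 3 * k := by ring
      _ ≤ m * L * e ^ 3 * k ^ 4 := by gcongr
  have hkec : c ^ 2 * (k * e) ≤ ε' * P * √x := by
    refine le_trans ?_ hke
    calc c ^ 2 * (k * e) ≤ e ^ 2 * (k * e) := by gcongr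
      _ = _ := by ring
  have hke2 : k * e ≤ ε * (P * √x) := by
    have h1 : c ^ 2 * (k * e) ≤ c ^ 2 * (ε * (P * √x)) := by
      refine hkec.trans ?_
      calc ε' * P * √x ≤ (ε * c ^ 2) * P * √x := by
            gcongr
            nlinarith
        _ = _ := by ring
    exact le_of_mul_le_mul_left h1 (by positivity)
  have hke1 : e ≤ k * e := le_mul_of_one_le_left he.le hk
  have hsq : m ^ 2 * L ^ 2 * e ^ 6 * k ^ 8 ≤ ε' ^ 2 * p ^ 3 * x := by
    have := pow_le_pow_left₀ (by positivity) hcore 2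
    rw [mul_pow (ε' * P), mul_pow ε', hP3, Real.sq_sqrt (by linarith)] at this
    calc _ = (m * L * e ^ 3 * k ^ 4) ^ 2 := by ring
      _ ≤ _ := this
  have hε'sq : ε' ^ 2 ≤ ε * c ^ 5 / 2 := by nlinarith
  refine ⟨?_, ?_, ?_, ?_⟩
  · calc e ≤ ε * (P * √x) := hke1.trans hke2
      _ ≤ _ := by gcongr
  · calc k * e ≤ ε * (P * √x) := hke2
      _ ≤ _ := by gcongr
  · have h1 : c ^ 5 * (m ^ 2 * (e * k)) ≤ c ^ 5 * (ε * x) := by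
      calc c ^ 5 * (m ^ 2 * (e * k)) ≤ e ^ 5 * (m ^ 2 * (e * k)) := by gcongr
        _ = m ^ 2 * 1 * e ^ 6 * k := by ring
        _ ≤ m ^ 2 * L ^ 2 * e ^ 6 * k ^ 8 := by
            gcongr
            · exact one_le_pow₀ hL
            · exact le_self_pow₀ hk (by norm_num)
        _ ≤ ε' ^ 2 * p ^ 3 * x := hsq
        _ ≤ (ε * c ^ 5) * 1 * x := by
            gcongr
            · nlinarith [show 0 < ε * c ^ 5 by positivity]
            · exact pow_le_one₀ hp.le hp1
        _ = _ := by ring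
    exact le_of_mul_le_mul_left h1 (by positivity)
  · rw [← mul_div_assoc, le_div_iff₀ (by positivity)]
    have h1 : c ^ 5 * ((L + k) * (e ^ 2 * k ^ 2)) ≤ c ^ 5 * (ε * (p ^ 2 * x)) := by
      have hLk : L + k ≤ 2 * (L * k) := by nlinarith
      calc c ^ 5 * ((L + k) * (e ^ 2 * k ^ 2)) ≤ c ^ 4 * (2 * (L * k) * (e ^ 2 * k ^ 2)) := by
            gcongr ?_ * (?_ * _)
            exact pow_le_pow_of_le_one hc.le hc1 (by norm_num)
        _ ≤ e ^ 4 * (2 * (L * k) * (e ^ 2 * k ^ 2)) := by gcongr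
        _ = 2 * (1 * L * e ^ 6 * k ^ 3) := by ring
        _ ≤ 2 * (m ^ 2 * L ^ 2 * e ^ 6 * k ^ 8) := by
            gcongr
            · exact one_le_pow₀ hm
            · exact le_self_pow₀ hL (by norm_num)
            · norm_num
        _ ≤ 2 * (ε' ^ 2 * p ^ 3 * x) := by gcongr
        _ ≤ 2 * ((ε * c ^ 5 / 2) * p ^ 2 * x) := by
            gcongr 2 * (?_ * ?_ * _)
            exact pow_le_pow_of_le_one hp.le hp1 (by norm_num)
        _ = _ := by ring
    exact le_of_mul_le_mul_left h1 (by positivity)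

theorem ParameterSize.rates (h : ParameterSize N T K a b p η ψ ν δ g)
    (hN : Tendsto N atTop atTop) (hT : Tendsto T atTop atTop) (ha : ∀ n, 1 ≤ a n)
    (hb : ∀ n, 1 ≤ b n) (hδ : 0 ≤ δ) (hg : 0 ≤ g) (hp : ∀ n, 0 < p n) (hp1 : ∀ n, p n ≤ 1)
    (hη : ∀ n, 0 < η n) (hK : ∀ᶠ n in atTop, 1 ≤ K n) {c : ℝ} (hc : 0 < c)
    (hcη : ∀ᶠ n in atTop, c ≤ η n) {ε : ℝ} (hε : 0 < ε) :
    ∀ᶠ n in atTop,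
      RateBound ε (min (√(a n : ℝ)) (√(b n : ℝ))) (logFactor N T n) (η n) (K n) (p n) (N n) ∧
      RateBound ε (min (√(a n : ℝ)) (√(b n : ℝ))) (logFactor N T n) (η n) (K n) (p n) (T n) := by
  have hc' : 0 < min c 1 := lt_min hc one_pos
  filter_upwards [h.core hN hT hδ hg hp hη hK
    (show 0 < min 1 (ε * min c 1 ^ 5 / 2) from lt_min one_pos (by positivity)), hK, hcη,
    hN.eventually_ge_atTop 1, hT.eventually_ge_atTop 1] with n hn hKn hcn hNn hTn
  have hm := one_le_min_sqrt (ha n) (hb n)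
  have hk : (1 : ℝ) ≤ K n := by exact_mod_cast hKn
  exact ⟨.of_core hε hc' (min_le_right _ _) hm (one_le_logFactor n) ((min_le_left _ _).trans hcn) hk
    (hp n) (hp1 n) (by exact_mod_cast hNn) hn.1,
    .of_core hε hc' (min_le_right _ _) hm (one_le_logFactor n) ((min_le_left _ _).trans hcn) hk
    (hp n) (hp1 n) (by exact_mod_cast hTn) hn.2⟩

/-- On the left of the signal condition every factor is at least one except η^{1/2}, which is at
least c^{1/2}; on the right p^{3/2} ≤ p. So pψ² diverges, which makes a perturbation of norm of
order σ/√p negligible against M. -/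
theorem ParameterSize.signal_rate (h : ParameterSize N T K a b p η ψ ν δ g)
    (hN : Tendsto N atTop atTop) (ha : ∀ n, 1 ≤ a n)
    (hb : ∀ n, 1 ≤ b n) (hδ : 0 ≤ δ) (hg : 0 ≤ g) (hp : ∀ n, 0 < p n) (hp1 : ∀ n, p n ≤ 1)
    (hK : ∀ᶠ n in atTop, 1 ≤ K n) {c : ℝ} (hc : 0 < c)
    (hcη : ∀ᶠ n in atTop, c ≤ η n) {ε : ℝ} (hε : 0 < ε) :
    ∀ᶠ n in atTop, 1 ≤ ε * (p n * ψ n ^ 2) := by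
  have hc0 : 0 < c ^ (1 / 2 : ℝ) := Real.rpow_pos_of_pos hc _
  filter_upwards [h.signal.bound (show 0 < ε * c ^ (1 / 2 : ℝ) by positivity), hK, hcη,
    hN.eventually_ge_atTop 1] with n hn hKn hcn hNn
  have hm := one_le_min_sqrt (ha n) (hb n)
  have hk : (1 : ℝ) ≤ K n := by exact_mod_cast hKn
  have hNr : (1 : ℝ) ≤ N n := by exact_mod_cast hNn
  have hP := Real.rpow_nonneg (hp n).le (3 / 2 : ℝ)
  rw [Real.norm_of_nonneg (mul_nonneg hP (sq_nonneg (ψ n)))] at hn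
  have h1 := (le_abs_self _).trans hn
  have e1 : c ^ (1 / 2 : ℝ) ≤ η n ^ (1 / 2 : ℝ) := Real.rpow_le_rpow hc.le hcn (by norm_num)
  have e2 : (1 : ℝ) ≤ (K n : ℝ) ^ (1 + g + 7 / 2 * δ) := Real.one_le_rpow hk (by positivity)
  have e3 : (1 : ℝ) ≤ max ((N n : ℝ) ^ (3 / 2 : ℝ)) ((T n : ℝ) ^ (3 / 2 : ℝ)) :=
    le_max_of_le_left (Real.one_le_rpow hNr (by norm_num))
  have h2 : c ^ (1 / 2 : ℝ) ≤ min (√(a n : ℝ)) (√(b n : ℝ)) * η n ^ (1 / 2 : ℝ) *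
      (K n : ℝ) ^ (1 + g + 7 / 2 * δ) *
      max ((N n : ℝ) ^ (3 / 2 : ℝ)) ((T n : ℝ) ^ (3 / 2 : ℝ)) := by
    calc c ^ (1 / 2 : ℝ) = 1 * c ^ (1 / 2 : ℝ) * 1 * 1 := by ring
      _ ≤ _ := by
        have e0 : 0 ≤ min (√(a n : ℝ)) (√(b n : ℝ)) := by positivity
        have e4 : 0 ≤ η n ^ (1 / 2 : ℝ) := hc0.le.trans e1
        gcongr
  refine le_of_mul_le_mul_left ?_ hc0
  calc c ^ (1 / 2 : ℝ) * 1 ≤ _ := by rw [mul_one]; exact h2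
    _ ≤ _ := h1
    _ ≤ ε * c ^ (1 / 2 : ℝ) * (p n * ψ n ^ 2) := by
        gcongr
        exact (rpow_three_halves_le (hp n) (hp1 n)).1
    _ = _ := by ring

end Rates

/-! ### Regularity of loadings and factors with high probability. -/

namespace PanelModel

variable {Ξ : Type*} [MeasurableSpace Ξ] {N T : ℕ → ℕ} (θ : PanelModel Ξ N T) {P : Measure Ξ}
  {K : ℕ → ℕ} {I : (n : ℕ) → Finset (Fin (N n))} {J : (n : ℕ) → Finset (Fin (T n))}

theorem abs_coeff_le {n : ℕ} {t : Fin (T n)} {ξ : Ξ} {C : ℝ} (hC : 0 ≤ C)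
    (h : eLpNorm (θ.h n t ξ) 2 (θ.ρ n) ≤ ENNReal.ofReal C) (r : ℕ) :
    |∫ w, θ.h n t ξ w * θ.φ n r w ∂(θ.ρ n)| ≤ C := by
  have h1 : eLpNorm (θ.h n t ξ • θ.φ n r) 1 (θ.ρ n) ≤
      eLpNorm (θ.h n t ξ) 2 (θ.ρ n) * eLpNorm (θ.φ n r) 2 (θ.ρ n) :=
    eLpNorm_smul_le_mul_eLpNorm (θ.memLp_φ n r).1 (θ.memLp_h n t ξ).1
  rw [eLpNorm_φ, mul_one, eLpNorm_one_eq_lintegral_enorm] at h1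
  have h2 := enorm_integral_le_lintegral_enorm (μ := θ.ρ n) fun w => θ.h n t ξ w * θ.φ n r w
  have h3 := h2.trans (h1.trans h)
  rw [Real.enorm_eq_ofReal_abs] at h3
  exact (ENNReal.ofReal_le_ofReal_iff hC).1 h3

/-- The properties that the loadings and the factors have with probability converging to one. -/
structure Good (K : ℕ → ℕ) (I : (n : ℕ) → Finset (Fin (N n))) (J : (n : ℕ) → Finset (Fin (T n)))
    (C c : ℝ) (η : ℕ → ℝ) (n : ℕ) (ξ : Ξ) : Prop where
  one_le_K : 1 ≤ K n
  abs_β : ∀ i r, |θ.β (K n) n ξ i r| ≤ C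
  abs_F : ∀ t r, |θ.F (K n) n ξ t r| ≤ C
  lowerBdd_β : LowerBdd (θ.β (K n) n ξ) (η n / N n)
  lowerBdd_F : LowerBdd (θ.F (K n) n ξ) (η n / T n)
  le_β : c ^ 2 ≤ N n * leverage (θ.β (K n) n ξ) (I n)
  le_F : c ^ 2 ≤ T n * leverage (θ.F (K n) n ξ) (J n)

/-- Test the lower bound on a coordinate vector: a column of loadings bounded by C has squared norm
at most NC². Hence η is bounded away from zero, which the rate lemmas require. -/
theorem Good.one_le_eta {C c : ℝ} {η : ℕ → ℝ} {n : ℕ} {ξ : Ξ} (h : θ.Good K I J C c η n ξ)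
    (hη : 0 < η n) (hN : 0 < N n) : 1 ≤ C ^ 2 * η n := by
  have hN' : (0 : ℝ) < N n := by exact_mod_cast hN
  have h1 := h.lowerBdd_β (Pi.single ⟨0, h.one_le_K⟩ 1)
  rw [Matrix.mulVec_single_one, single_one_dotProduct, Pi.single_eq_same] at h1
  have h2 : (θ.β (K n) n ξ).col ⟨0, h.one_le_K⟩ ⬝ᵥ (θ.β (K n) n ξ).col ⟨0, h.one_le_K⟩ ≤
      N n * C ^ 2 := by
    calc _ ≤ ∑ _i : Fin (N n), C ^ 2 := by
          refine Finset.sum_le_sum fun i _ => ?_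
          have := h.abs_β i ⟨0, h.one_le_K⟩
          rw [← sq, Matrix.col_apply, ← sq_abs]
          exact pow_le_pow_left₀ (abs_nonneg _) this 2
      _ = _ := by simp
  calc (1 : ℝ) ≤ η n / N n * (N n * C ^ 2) := h1.trans (by gcongr)
    _ = _ := by field_simp

theorem psi_zero_dim {k : ℕ} (hk : k = 0) (A : Matrix (Fin k) (Fin k) ℝ) (r : ℕ) : psi A r = 0 := by
  subst hk
  exact LinearMap.singularValues_of_finrank_le _ (by simp)

theorem SieveAssumption.good {C ν δ g c c₀ : ℝ} {η : ℕ → ℝ}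
    (h : θ.SieveAssumption P K C ν δ g c η) (hN : Tendsto N atTop atTop)
    (hT : Tendsto T atTop atTop) (hc₀ : 0 < c₀)
    (hβ : WithProbToOne P fun n ξ => c₀ ≤ √((N n : ℝ) * θ.leverageβ (K n) n (I n) ξ))
    (hF : WithProbToOne P fun n ξ => c₀ ≤ √((T n : ℝ) * θ.leverageF (K n) n (J n) ξ)) :
    WithProbToOne P fun n ξ => θ.Good K I J (max C 1) c₀ η n ξ := by
  have h1 : WithProbToOne P fun n ξ => ∀ t, eLpNorm (θ.h n t ξ) 2 (θ.ρ n) ≤ ENNReal.ofReal C :=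
    .of_ae h.norm_h
  refine (h1.and (h.min_eig_β.and (h.min_eig_F.and (hβ.and hF)))).mono ?_
  filter_upwards [hN.eventually_gt_atTop 0, hT.eventually_gt_atTop 0] with n hNn hTn ξ hξ
  obtain ⟨ha, ⟨hb0, hb⟩, ⟨hd0, hd⟩, he, hf⟩ := hξ
  have sq_le : ∀ x : ℝ, c₀ ≤ √x → c₀ ^ 2 ≤ x := fun x hx => by
    have hx0 : 0 < x := Real.sqrt_pos.1 (hc₀.trans_le hx)
    rw [← Real.sq_sqrt hx0.le]
    exact pow_le_pow_left₀ hc₀.le hx 2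
  refine ⟨?_, fun i r => ?_, fun t r => ?_, ?_, ?_, sq_le _ he, sq_le _ hf⟩
  -- In dimension zero every singular value is 0, against the assumed positivity.
  · by_contra hK
    rw [psi_zero_dim (by omega)] at hb0
    exact lt_irrefl _ hb0
  · exact (h.basis_bounded n r r.2 _ (θ.ζ_mem n i ξ)).trans (le_max_left _ _)
  · exact θ.abs_coeff_le (by positivity)
      ((ha t).trans (ENNReal.ofReal_le_ofReal (le_max_left _ _))) r
  · exact lowerBdd_of_psi hNn _ hb0 hb
  · exact lowerBdd_of_psi hTn _ hd0 hd

variable {θ} in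
/-- The class gives constants for which the conditions, the good events and the rates hold. -/
theorem InClass.exists_data [IsProbabilityMeasure P] (h : θ.InClass P K I J)
    (hN : Tendsto N atTop atTop) (hT : Tendsto T atTop atTop) (hI : ∀ n, (I n).Nonempty)
    (hJ : ∀ n, (J n).Nonempty) :
    ∃ (C ν δ g c c₀ : ℝ) (η ψ : ℕ → ℝ), 0 < ν ∧ 0 ≤ δ ∧ 0 ≤ g ∧ 0 < c ∧ 0 < c₀ ∧ (∀ n, 0 < η n) ∧
      (∀ n, 0 < ψ n) ∧ θ.SieveAssumption P K C ν δ g c η ∧ θ.SignalStrength P K δ ψ ∧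
      ParameterSize N T K (fun n => (I n).card) (fun n => (J n).card) (fun n => (θ.p n : ℝ))
        η ψ ν δ g ∧
      (WithProbToOne P fun n ξ => θ.Good K I J (max C 1) c₀ η n ξ) ∧
      (∀ ε : ℝ, 0 < ε → ∀ᶠ n in atTop,
        RateBound ε (min (√((I n).card : ℝ)) (√((J n).card : ℝ))) (logFactor N T n) (η n) (K n)
          (θ.p n) (N n) ∧
        RateBound ε (min (√((I n).card : ℝ)) (√((J n).card : ℝ))) (logFactor N T n) (η n) (K n)
          (θ.p n) (T n)) ∧
      (∀ ε : ℝ, 0 < ε → ∀ᶠ n in atTop, 1 ≤ ε * ((θ.p n : ℝ) * ψ n ^ 2)) := by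
  obtain ⟨C, ν, δ, g, c, η, ψ, hν, hδ, hg, hc, hη, hψ, hs, hsig, hpar⟩ := h.sieve
  obtain ⟨c₀, hc₀, hβ, hF⟩ := h.nondegenerate
  have hgood := SieveAssumption.good θ hs hN hT hc₀ hβ hF
  have hK : ∀ᶠ n in atTop, 1 ≤ K n := hgood.eventually_of_const fun n ξ hξ => hξ.one_le_K
  have hC : (0 : ℝ) < max C 1 := lt_max_of_lt_right one_pos
  have hcη : ∀ᶠ n in atTop, (max C 1 ^ 2)⁻¹ ≤ η n := by
    have h1 : ∀ᶠ n in atTop, 0 < N n → 1 ≤ max C 1 ^ 2 * η n :=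
      hgood.eventually_of_const fun n ξ hξ hNn => Good.one_le_eta θ hξ (hη n) hNn
    filter_upwards [h1, hN.eventually_gt_atTop 0] with n hn hNn
    rw [inv_le_iff_one_le_mul₀ (by positivity), mul_comm]
    exact hn hNn
  have hp1 : ∀ n, (θ.p n : ℝ) ≤ 1 := fun n => (θ.p n).2.2
  have hI1 : ∀ n, 1 ≤ (I n).card := fun n => (hI n).card_pos
  have hJ1 : ∀ n, 1 ≤ (J n).card := fun n => (hJ n).card_pos
  exact ⟨C, ν, δ, g, c, c₀, η, ψ, hν, hδ, hg, hc, hc₀, hη, hψ, hs, hsig, hpar, hgood,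
    fun ε hε => hpar.rates hN hT hI1 hJ1 hδ hg h.p_pos hp1 hη hK (by positivity) hcη hε,
    fun ε hε => hpar.signal_rate hN hI1 hJ1 hδ hg h.p_pos hp1 hK (by positivity) hcη hε⟩

end PanelModel

/-! ### The asymptotic variance -/

theorem nat_sq_le_two_mul_exp (k : ℕ) : (k : ℝ) ^ 2 ≤ 2 * Real.exp k := by
  have := Real.quadratic_le_exp_of_nonneg (Nat.cast_nonneg (α := ℝ) k)
  nlinarith [Nat.cast_nonneg (α := ℝ) k]

/-- The constant ε²/(4C⁴) makes the Hoeffding exponent at least 2(L + k). One e^{-L} absorbs l,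
e^{-k} absorbs k² up to a factor 2, and one e^{-L} remains. -/
theorem RateBound.tail_le {l k m : ℕ} {b L e p ε C : ℝ} (hl : (l : ℝ) ≤ Real.exp L) (hε : 0 < ε)
    (hC : 0 < C) (he : 0 < e) (hp : 0 < p) (hm : 0 < m) (hk : 0 < k)
    (h : RateBound (ε ^ 2 / (4 * C ^ 4)) b L e k p m) :
    ((l * (k * k) : ℕ) : ℝ) *
      (2 * Real.exp (-(ε * p * m / (e * k)) ^ 2 / (2 * (m * (C ^ 2) ^ 2)))) ≤
      4 * Real.exp (-L) := by
  have hm' : (0 : ℝ) < m := by exact_mod_cast hm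
  have hk' : (0 : ℝ) < k := by exact_mod_cast hk
  have h1 : -(ε * p * m / (e * k)) ^ 2 / (2 * (m * (C ^ 2) ^ 2)) ≤ -L + (-L) + -k := by
    have h2 := h.log_add_le
    have h3 : (ε * p * m / (e * k)) ^ 2 / (2 * (m * (C ^ 2) ^ 2)) =
        2 * (ε ^ 2 / (4 * C ^ 4) * (p ^ 2 * m / (e ^ 2 * k ^ 2))) := by
      field_simp
      ring
    rw [neg_div, h3]
    linarith
  have h4 : Real.exp (-L + (-L) + -k) = Real.exp (-L) * Real.exp (-L) * Real.exp (-k) := by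
    rw [Real.exp_add, Real.exp_add]
  have h5 : (l : ℝ) * Real.exp (-L) ≤ 1 := by
    rw [Real.exp_neg, ← div_eq_mul_inv, div_le_one (Real.exp_pos _)]
    exact hl
  have h6 : (k : ℝ) ^ 2 * Real.exp (-k) ≤ 2 := by
    rw [Real.exp_neg, ← div_eq_mul_inv, div_le_iff₀ (Real.exp_pos _)]
    exact nat_sq_le_two_mul_exp k
  calc _ ≤ ((l * (k * k) : ℕ) : ℝ) *
        (2 * (Real.exp (-L) * Real.exp (-L) * Real.exp (-k))) := by
        rw [← h4]; gcongr
    _ = 2 * Real.exp (-L) * ((l * Real.exp (-L)) * (k ^ 2 * Real.exp (-k))) := by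
        push_cast; ring
    _ ≤ 2 * Real.exp (-L) * (1 * 2) := by gcongr
    _ = _ := by ring

theorem natCast_le_exp_logFactor {N T : ℕ → ℕ} {n : ℕ} (hN : 0 < N n) (hT : 0 < T n) :
    (N n : ℝ) ≤ Real.exp (logFactor N T n) ∧ (T n : ℝ) ≤ Real.exp (logFactor N T n) := by
  have hN' : (0 : ℝ) < N n := by exact_mod_cast hN
  have hT' : (0 : ℝ) < T n := by exact_mod_cast hT
  have h1 : 0 ≤ Real.log (N n) := Real.log_natCast_nonneg _
  have h2 : 0 ≤ Real.log (T n) := Real.log_natCast_nonneg _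
  have h3 : Real.log (N n) + Real.log (T n) ≤ logFactor N T n := le_max_right _ _
  exact ⟨(Real.log_le_iff_le_exp hN').1 (by linarith), (Real.log_le_iff_le_exp hT').1 (by linarith)⟩

theorem measure_prod_le_of_forall {α β : Type*} [MeasurableSpace α] [MeasurableSpace β]
    {μ : Measure α} [IsProbabilityMeasure μ] {ν : Measure β} [SFinite ν] {s : Set (α × β)}
    (hs : MeasurableSet s) {c : ENNReal} (h : ∀ x, ν (Prod.mk x ⁻¹' s) ≤ c) : μ.prod ν s ≤ c := by
  rw [Measure.prod_apply hs]
  calc _ ≤ ∫⁻ _, c ∂μ := lintegral_mono h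
    _ = c := by simp

namespace PanelModel

variable {Ξ : Type*} [MeasurableSpace Ξ] {N T : ℕ → ℕ} (θ : PanelModel Ξ N T) {P : Measure Ξ}
  {K : ℕ → ℕ} {I : (n : ℕ) → Finset (Fin (N n))} {J : (n : ℕ) → Finset (Fin (T n))}

theorem measurable_β (k n : ℕ) (i : Fin (N n)) (r : Fin k) :
    Measurable fun ξ => θ.β k n ξ i r := (θ.measurable_φ n r).comp (θ.measurable_ζ n i)

theorem measurable_F (k n : ℕ) (t : Fin (T n)) (r : Fin k) :
    Measurable fun ξ => θ.F k n ξ t r := θ.measurable_coeff n t r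

theorem sStarSq_eq (k n : ℕ) (I : Finset (Fin (N n))) (J : Finset (Fin (T n))) (ξ : Ξ) :
    θ.sStarSq k n I J ξ =
      θ.σ n ^ 2 / (θ.p n : ℝ) * totalLev (θ.β k n ξ) (θ.F k n ξ) I J := by
  rw [sStarSq, totalLev]
  change _ * leverage (θ.β k n ξ) I + _ * leverage (θ.F k n ξ) J = _
  ring

/-- With a = η/N the entrywise threshold x = εpN/(ηK) is exactly what makes xKa = εp in the thinning
lemma. The relative error is then the same for every period and every unit, so averaging preserves
it. -/
theorem Good.abs_asympVar_sub_le {C c : ℝ} {η : ℕ → ℝ} {n : ℕ} {ξ : Ξ}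
    (h : θ.Good K I J C c η n ξ) (hη : 0 < η n) (hN : 0 < N n) (hT : 0 < T n)
    (hI : (I n).Nonempty) (hJ : (J n).Nonempty) (hp : 0 < (θ.p n : ℝ)) {ε : ℝ} (hε : 0 < ε)
    (hε2 : ε ≤ 1 / 2) {x : Fin (N n) → Fin (T n) → Bool × ℝ}
    (hβ : ∀ (t : Fin (T n)) (r s : Fin (K n)), |∑ j, (omegaVal x j t - θ.p n) *
      (θ.β (K n) n ξ j r * θ.β (K n) n ξ j s)| ≤ ε * θ.p n * N n / (η n * K n))
    (hF : ∀ (i : Fin (N n)) (r s : Fin (K n)), |∑ t, (omegaVal x i t - θ.p n) *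
      (θ.F (K n) n ξ t r * θ.F (K n) n ξ t s)| ≤ ε * θ.p n * T n / (η n * K n)) :
    |θ.asympVar (K n) n (I n) (J n) ξ x - θ.sStarSq (K n) n (I n) (J n) ξ| ≤
      2 * ε * θ.sStarSq (K n) n (I n) (J n) ξ := by
  have hN' : (0 : ℝ) < N n := by exact_mod_cast hN
  have hT' : (0 : ℝ) < T n := by exact_mod_cast hT
  have hK' : (0 : ℝ) < K n := by exact_mod_cast h.one_le_K
  have hI' : (0 : ℝ) < (I n).card := by exact_mod_cast hI.card_pos
  have hJ' : (0 : ℝ) < (J n).card := by exact_mod_cast hJ.card_pos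
  have hsq : ∀ i t, omegaVal x i t * omegaVal x i t = omegaVal x i t := fun i t => by
    unfold omegaVal; split_ifs <;> simp
  have h1 : ∀ t, _ := fun t => h.lowerBdd_β.abs_quadForm_thinned_sub_le (by positivity) hp hε.le
    hε2 (fun j => omegaVal x j t) (fun j => hsq j t) (hβ t) (by field_simp; rfl)
    (rowMean (θ.β (K n) n ξ) (I n))
  have h2 : ∀ i, _ := fun i => h.lowerBdd_F.abs_quadForm_thinned_sub_le (by positivity) hp hε.le
    hε2 (fun t => omegaVal x i t) (fun t => hsq i t) (hF i) (by field_simp; rfl)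
    (rowMean (θ.F (K n) n ξ) (J n))
  have average : ∀ {ι : Type} (s : Finset ι) (q : ι → ℝ) (L : ℝ), 0 < (s.card : ℝ) →
      (∀ t, |q t - (θ.p n : ℝ)⁻¹ * L| ≤ 2 * ε * ((θ.p n : ℝ)⁻¹ * L)) →
      |θ.σ n ^ 2 / (s.card : ℝ) ^ 2 * ∑ t ∈ s, q t - θ.σ n ^ 2 / θ.p n * (1 / s.card) * L| ≤
        2 * ε * (θ.σ n ^ 2 / θ.p n * (1 / s.card) * L) := by
    intro ι s q L hs hq
    have e1 : θ.σ n ^ 2 / (s.card : ℝ) ^ 2 * ∑ t ∈ s, q t - θ.σ n ^ 2 / θ.p n * (1 / s.card) * L =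
        θ.σ n ^ 2 / (s.card : ℝ) ^ 2 * ∑ t ∈ s, (q t - (θ.p n : ℝ)⁻¹ * L) := by
      rw [Finset.sum_sub_distrib, Finset.sum_const, nsmul_eq_mul]
      field_simp
    rw [e1, abs_mul, abs_of_nonneg (by positivity)]
    calc _ ≤ θ.σ n ^ 2 / (s.card : ℝ) ^ 2 * ∑ t ∈ s, 2 * ε * ((θ.p n : ℝ)⁻¹ * L) := by
          gcongr
          exact (Finset.abs_sum_le_sum_abs _ _).trans (Finset.sum_le_sum fun t _ => hq t)
      _ = _ := by
          rw [Finset.sum_const, nsmul_eq_mul]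
          field_simp
  have h3 := average (J n) _ _ hJ' h1
  have h4 := average (I n) _ _ hI' h2
  have e : θ.asympVar (K n) n (I n) (J n) ξ x - θ.sStarSq (K n) n (I n) (J n) ξ = _ :=
    add_sub_add_comm _ _ _ _
  rw [e]
  refine (abs_add_le _ _).trans ((add_le_add h3 h4).trans (le_of_eq ?_))
  rw [← mul_add]
  rfl

/-- The bound on the loadings is part of the event, so the conditional tail bound holds for every ξ
and integrates by Fubini. -/
theorem prod_noiseLaw_tail_β [IsProbabilityMeasure P] {C x : ℝ} (hx : 0 ≤ x) (k n : ℕ) :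
    (P.prod (noiseLaw (N n) (T n) (θ.p n) (θ.σ n))) {y | (∀ j r, |θ.β k n y.1 j r| ≤ C) ∧
      ∃ a : Fin (T n) × Fin k × Fin k, x ≤ |∑ j, (omegaVal y.2 j a.1 - θ.p n) *
        (θ.β k n y.1 j a.2.1 * θ.β k n y.1 j a.2.2)|} ≤
      ENNReal.ofReal ((T n * (k * k) : ℕ) *
        (2 * Real.exp (-x ^ 2 / (2 * (N n * (C ^ 2) ^ 2))))) := by
  have hm : ∀ i r, Measurable fun y : Ξ × (Fin (N n) → Fin (T n) → Bool × ℝ) => θ.β k n y.1 i r :=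
    fun i r => (θ.measurable_β k n i r).comp measurable_fst
  refine measure_prod_le_of_forall ?_ fun ξ => ?_
  · refine measurableSet_setOfPred.2 (Measurable.and ?_ ?_)
    · exact Measurable.forall fun j => Measurable.forall fun r =>
        measurableSet_setOfPred.1 (measurableSet_le (hm j r).abs measurable_const)
    · refine Measurable.exists fun a => measurableSet_setOfPred.1
        (measurableSet_le measurable_const (Measurable.abs ?_))
      exact Finset.measurable_sum _ fun j _ => ((((measurable_omegaVal j a.1).comp
        measurable_snd).sub measurable_const).mul ((hm j _).mul (hm j _)))
  · by_cases hξ : ∀ j r, |θ.β k n ξ j r| ≤ C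
    · exact (measure_mono fun z hz => hz.2).trans (noiseLaw_col_tail hξ hx)
    · refine (measure_mono (t := ∅) fun z hz => hξ hz.1).trans ?_
      simp

theorem prod_noiseLaw_tail_F [IsProbabilityMeasure P] {C x : ℝ} (hx : 0 ≤ x) (k n : ℕ) :
    (P.prod (noiseLaw (N n) (T n) (θ.p n) (θ.σ n))) {y | (∀ t r, |θ.F k n y.1 t r| ≤ C) ∧
      ∃ a : Fin (N n) × Fin k × Fin k, x ≤ |∑ t, (omegaVal y.2 a.1 t - θ.p n) *
        (θ.F k n y.1 t a.2.1 * θ.F k n y.1 t a.2.2)|} ≤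
      ENNReal.ofReal ((N n * (k * k) : ℕ) *
        (2 * Real.exp (-x ^ 2 / (2 * (T n * (C ^ 2) ^ 2))))) := by
  have hm : ∀ t r, Measurable fun y : Ξ × (Fin (N n) → Fin (T n) → Bool × ℝ) => θ.F k n y.1 t r :=
    fun t r => (θ.measurable_F k n t r).comp measurable_fst
  refine measure_prod_le_of_forall ?_ fun ξ => ?_
  · refine measurableSet_setOfPred.2 (Measurable.and ?_ ?_)
    · exact Measurable.forall fun j => Measurable.forall fun r =>
        measurableSet_setOfPred.1 (measurableSet_le (hm j r).abs measurable_const)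
    · refine Measurable.exists fun a => measurableSet_setOfPred.1
        (measurableSet_le measurable_const (Measurable.abs ?_))
      exact Finset.measurable_sum _ fun j _ => ((((measurable_omegaVal a.1 j).comp
        measurable_snd).sub measurable_const).mul ((hm j _).mul (hm j _)))
  · by_cases hξ : ∀ j r, |θ.F k n ξ j r| ≤ C
    · exact (measure_mono fun z hz => hz.2).trans (noiseLaw_row_tail hξ hx)
    · refine (measure_mono (t := ∅) fun z hz => hξ hz.1).trans ?_
      simp

variable {θ} in
/-- The asymptotic variance is equivalent to `s_*²`. -/
theorem InClass.asympVar_sub_sStarSq [IsProbabilityMeasure P] (h : θ.InClass P K I J)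
    (hN : Tendsto N atTop atTop) (hT : Tendsto T atTop atTop) (hI : ∀ n, (I n).Nonempty)
    (hJ : ∀ n, (J n).Nonempty) {ε : ℝ} (hε : 0 < ε) :
    Tendsto (fun n => (P.prod (noiseLaw (N n) (T n) (θ.p n) (θ.σ n)))
      {y | ¬ |θ.asympVar (K n) n (I n) (J n) y.1 y.2 - θ.sStarSq (K n) n (I n) (J n) y.1| ≤
        ε * θ.sStarSq (K n) n (I n) (J n) y.1}) atTop (𝓝 0) := by
  obtain ⟨C, ν, δ, g, c, c₀, η, ψ, hν, hδ, hg, hc, hc₀, hη, hψ, hs, hsig, hpar, hgood, hrate, -⟩ :=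
    h.exists_data hN hT hI hJ
  set D := max C 1 with hD
  have hD0 : 0 < D := lt_max_of_lt_right one_pos
  set ε' := min (ε / 2) (1 / 2) with hε'
  have hε'0 : 0 < ε' := lt_min (by positivity) (by norm_num)
  have hexp : Tendsto (fun n => ENNReal.ofReal (4 * Real.exp (-logFactor N T n))) atTop (𝓝 0) := by
    have h1 : Tendsto (logFactor N T) atTop atTop := by
      have hlog := Real.tendsto_log_atTop.comp (tendsto_natCast_atTop_atTop.comp hN)
      refine tendsto_atTop_mono (fun n => ?_) hlog
      refine le_trans ?_ (le_max_right _ _)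
      exact le_add_of_nonneg_right (Real.log_natCast_nonneg _)
    have h2 := (Real.tendsto_exp_neg_atTop_nhds_zero.comp h1).const_mul 4
    simpa using ENNReal.tendsto_ofReal h2
  -- Three sources of failure: irregular loadings or factors, a deviation in some period, a
  -- deviation for some unit.
  have hlim : Tendsto (fun n => P {ξ | ¬ θ.Good K I J D c₀ η n ξ} +
      ENNReal.ofReal (4 * Real.exp (-logFactor N T n)) +
      ENNReal.ofReal (4 * Real.exp (-logFactor N T n))) atTop (𝓝 0) := by
    simpa using (Tendsto.add (show Tendsto _ _ _ from hgood) hexp).add hexp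
  refine tendsto_of_tendsto_of_tendsto_of_le_of_le' tendsto_const_nhds hlim
    (Eventually.of_forall fun _ => zero_le) ?_
  filter_upwards [hrate (ε' ^ 2 / (4 * D ^ 4)) (by positivity), hN.eventually_gt_atTop 0,
    hT.eventually_gt_atTop 0, hgood.eventually_of_const fun n ξ hξ => hξ.one_le_K]
    with n hn hNn hTn hKn
  have hp := h.p_pos n
  obtain ⟨hNe, hTe⟩ := natCast_le_exp_logFactor (N := N) (T := T) hNn hTn
  have hK' : (0 : ℝ) < K n := by exact_mod_cast hKn
  have hηn := hη n
  have tβ := (θ.prod_noiseLaw_tail_β (P := P) (C := D)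
    (x := ε' * θ.p n * N n / (η n * K n)) (by positivity) (K n) n).trans
    (ENNReal.ofReal_le_ofReal (hn.1.tail_le hTe hε'0 hD0 hηn hp hNn hKn))
  have tF := (θ.prod_noiseLaw_tail_F (P := P) (C := D)
    (x := ε' * θ.p n * T n / (η n * K n)) (by positivity) (K n) n).trans
    (ENNReal.ofReal_le_ofReal (hn.2.tail_le hNe hε'0 hD0 hηn hp hTn hKn))
  have tG : (P.prod (noiseLaw (N n) (T n) (θ.p n) (θ.σ n)))
      ({ξ | ¬ θ.Good K I J D c₀ η n ξ} ×ˢ Set.univ) = P {ξ | ¬ θ.Good K I J D c₀ η n ξ} := by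
    rw [Measure.prod_prod, measure_univ, mul_one]
  rw [← tG]
  refine le_trans ?_ (add_le_add (add_le_add le_rfl tβ) tF)
  refine le_trans (measure_mono ?_) ((measure_union_le _ _).trans
    (add_le_add (measure_union_le _ _) le_rfl))
  intro y hy
  by_contra hcon
  simp only [Set.mem_union, not_or, Set.mem_prod, Set.mem_univ, and_true, Set.mem_ofPred_eq,
    not_not, not_and, not_exists, not_le] at hcon
  obtain ⟨⟨hG, hb⟩, hf⟩ := hcon
  refine hy ?_
  refine (hG.abs_asympVar_sub_le θ hηn hNn hTn (hI n) (hJ n) hp hε'0 (min_le_right _ _)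
    (fun t r s => (hb hG.abs_β (t, r, s)).le) (fun i r s => (hf hG.abs_F (i, r, s)).le)).trans ?_
  refine mul_le_mul_of_nonneg_right ?_ ?_
  · linarith [min_le_left (ε / 2) (1 / 2 : ℝ)]
  · rw [sStarSq_eq]
    have := hG.lowerBdd_β.leverage_nonneg (I n)
    have := hG.lowerBdd_F.leverage_nonneg (J n)
    unfold totalLev
    positivity

end PanelModel

/-! ### Measurability of the perturbations -/

section MeasurableEntries

open Matrix

variable {Ξ : Type*} [MeasurableSpace Ξ] {m l k : ℕ}

theorem measurable_mulVec_apply {A : Ξ → Matrix (Fin m) (Fin l) ℝ} {v : Ξ → Fin l → ℝ}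
    (hA : ∀ i j, Measurable fun ξ => A ξ i j) (hv : ∀ j, Measurable fun ξ => v ξ j) (i : Fin m) :
    Measurable fun ξ => (A ξ *ᵥ v ξ) i := by
  simp only [mulVec, dotProduct]
  exact Finset.measurable_sum _ fun j _ => (hA i j).mul (hv j)

theorem measurable_dotProduct {v w : Ξ → Fin l → ℝ} (hv : ∀ j, Measurable fun ξ => v ξ j)
    (hw : ∀ j, Measurable fun ξ => w ξ j) : Measurable fun ξ => v ξ ⬝ᵥ w ξ := by
  simp only [dotProduct]
  exact Finset.measurable_sum _ fun j _ => (hv j).mul (hw j)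

theorem measurable_det {A : Ξ → Matrix (Fin m) (Fin m) ℝ}
    (hA : ∀ i j, Measurable fun ξ => A ξ i j) : Measurable fun ξ => (A ξ).det := by
  simp_rw [det_apply]
  exact Finset.measurable_sum _ fun s _ =>
    (Finset.measurable_prod _ fun i _ => hA (s i) i).const_smul _

theorem measurable_inv_apply {A : Ξ → Matrix (Fin m) (Fin m) ℝ}
    (hA : ∀ i j, Measurable fun ξ => A ξ i j) (i j : Fin m) :
    Measurable fun ξ => (A ξ)⁻¹ i j := by
  simp_rw [inv_def, Matrix.smul_apply, Ring.inverse_eq_inv', adjugate_apply, smul_eq_mul]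
  refine (measurable_det hA).inv.mul (measurable_det fun a b => ?_)
  by_cases h : a = j
  · subst h; simp
  · simpa [updateRow_ne h] using hA a b

variable {B : Ξ → Matrix (Fin m) (Fin k) ℝ} {F : Ξ → Matrix (Fin l) (Fin k) ℝ}
  (hB : ∀ i r, Measurable fun ξ => B ξ i r) (hF : ∀ i r, Measurable fun ξ => F ξ i r)

include hB

theorem measurable_gram_inv_apply (r s : Fin k) : Measurable fun ξ => (gramMat (B ξ))⁻¹ r s := by
  refine measurable_inv_apply (A := fun ξ => gramMat (B ξ)) (fun a b => ?_) r s
  simp only [mul_apply, transpose_apply]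
  exact Finset.measurable_sum _ fun i _ => (hB i a).mul (hB i b)

theorem measurable_rowMean (I : Finset (Fin m)) (r : Fin k) :
    Measurable fun ξ => rowMean (B ξ) I r :=
  (Finset.measurable_sum _ fun i _ => hB i r).div_const _

theorem measurable_coefVec (I : Finset (Fin m)) (r : Fin k) :
    Measurable fun ξ => coefVec (B ξ) I r :=
  measurable_mulVec_apply (measurable_gram_inv_apply hB) (measurable_rowMean hB I) r

theorem measurable_leverage (I : Finset (Fin m)) : Measurable fun ξ => leverage (B ξ) I :=
  measurable_dotProduct (measurable_rowMean hB I) (measurable_coefVec hB I)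

theorem measurable_residVec (I : Finset (Fin m)) (i : Fin m) :
    Measurable fun ξ => residVec (B ξ) I i :=
  measurable_const.sub (measurable_mulVec_apply hB (measurable_coefVec hB I) i)

include hF

theorem measurable_rotStep (R : ℝ) (I : Finset (Fin m)) (J : Finset (Fin l)) :
    Measurable fun ξ => rotStep R (B ξ) (F ξ) I J :=
  measurable_const.div (((measurable_leverage hB I).div_const _).add
    ((measurable_leverage hF J).div_const _)).sqrt

theorem measurable_rotPert (R : ℝ) (I : Finset (Fin m)) (J : Finset (Fin l)) (i : Fin m)
    (r : Fin k) : Measurable fun ξ => rotPert R (B ξ) (F ξ) I J i r := by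
  have hc := measurable_coefVec hF J
  have hb := measurable_residVec hB I
  have hw : ∀ i, Measurable fun ξ => liftVec (B ξ) (coefVec (F ξ) J) i :=
    measurable_mulVec_apply hB (measurable_mulVec_apply (measurable_gram_inv_apply hB) hc)
  have hs := measurable_rotStep hB hF R I J
  have hww := measurable_dotProduct hw hw
  have hbb := measurable_dotProduct hb hb
  refine Measurable.mul ((hs.mul (hb i)).sub (Measurable.mul ?_ (hw i))) (hc r)
  exact (measurable_const.sub
    (measurable_const.sub (((hs.pow_const 2).mul hww).mul hbb)).sqrt).div hww

end MeasurableEntries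

/-! ### Size of the perturbations -/

/-- The smallness of the perturbation of size `R` of loadings and factors with lower bounds `a` and
`a'`, with `x` units and `y` periods, and groups of at least `b` units or periods. -/
structure SmallStep (ε b k a a' R x y : ℝ) : Prop where
  left : √a * √a' * R * √x ≤ ε
  right : √a * √a' * R * √y ≤ ε
  linear : √k * (√a * R) ≤ ε
  linear' : √k * (√a' * R) ≤ ε
  lev : b * (a * k) ≤ ε
  lev' : b * (a' * k) ≤ ε

/-- Substituting a = e/x, a' = e/y and R = q/√p turns each smallness condition into a rate bound.
The conditions involving √k use the square root of the bound on k e, hence √ε. -/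
theorem SmallStep.of_rateBound {ε ε' b L e k p x y q : ℝ} (he : 0 < e) (hk : 0 ≤ k)
    (hp : 0 < p) (hx : 0 < x) (hy : 0 < y) (hq : 0 ≤ q) (hN : RateBound ε b L e k p x)
    (hT : RateBound ε b L e k p y) (h1 : ε ≤ ε') (h2 : q * ε ≤ ε') (h3 : q * √ε ≤ ε') :
    SmallStep ε' (b ^ 2) k (e / x) (e / y) (q / √p) x y := by
  have hpp := Real.sqrt_pos.2 hp
  have hxx := Real.sqrt_pos.2 hx
  have hyy := Real.sqrt_pos.2 hy
  have hee : √e * √e = e := Real.mul_self_sqrt he.le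
  have lin : ∀ z : ℝ, 0 < z → k * e ≤ ε * (p * z) → √k * (√(e / z) * (q / √p)) ≤ ε' := by
    intro z hz h
    refine le_trans ?_ h3
    have e1 : √k * (√(e / z) * (q / √p)) = q * √(k * e / (p * z)) := by
      rw [Real.sqrt_div he.le, Real.sqrt_div (by positivity), Real.sqrt_mul hk, Real.sqrt_mul hp.le]
      have := Real.sqrt_pos.2 hz
      field_simp
    rw [e1]
    refine mul_le_mul_of_nonneg_left (Real.sqrt_le_sqrt ?_) hq
    rw [div_le_iff₀ (by positivity)]
    exact h
  have lev : ∀ z : ℝ, 0 < z → b ^ 2 * (e * k) ≤ ε * z → b ^ 2 * (e / z * k) ≤ ε' := by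
    intro z hz h
    refine le_trans ?_ h1
    rw [div_mul_eq_mul_div, ← mul_div_assoc, div_le_iff₀ hz]
    exact h
  refine ⟨?_, ?_, lin x hx hN.k_mul_eta_le, lin y hy hT.k_mul_eta_le, lev x hx hN.min_mul_le,
    lev y hy hT.min_mul_le⟩
  · refine le_trans ?_ h2
    have e1 : √(e / x) * √(e / y) * (q / √p) * √x = q * (e / (√p * √y)) := by
      rw [Real.sqrt_div he.le, Real.sqrt_div he.le]
      field_simp
      rw [sq, hee, mul_comm]
    rw [e1]
    refine mul_le_mul_of_nonneg_left ?_ hq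
    rw [div_le_iff₀ (by positivity)]
    exact hT.eta_le
  · refine le_trans ?_ h2
    have e1 : √(e / x) * √(e / y) * (q / √p) * √y = q * (e / (√p * √x)) := by
      rw [Real.sqrt_div he.le, Real.sqrt_div he.le]
      field_simp
      rw [sq, hee, mul_comm]
    rw [e1]
    refine mul_le_mul_of_nonneg_left ?_ hq
    rw [div_le_iff₀ (by positivity)]
    exact hN.eta_le

theorem SmallStep.symm {ε b k a a' R x y : ℝ} (h : SmallStep ε b k a a' R x y) :
    SmallStep ε b k a' a R y x :=
  ⟨by rw [mul_comm √a']; exact h.right, by rw [mul_comm √a']; exact h.left, h.linear', h.linear,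
    h.lev', h.lev⟩

section SmallStepBounds

open Matrix

variable {m l k : ℕ} {B : Matrix (Fin m) (Fin k) ℝ} {F : Matrix (Fin l) (Fin k) ℝ}
  {I : Finset (Fin m)} {J : Finset (Fin l)} {a a' R ε D c : ℝ}

/-- Loadings and factors to which the least favourable perturbation of size `R` applies. -/
structure PertSetup (B : Matrix (Fin m) (Fin k) ℝ) (F : Matrix (Fin l) (Fin k) ℝ)
    (I : Finset (Fin m)) (J : Finset (Fin l)) (a a' R ε D c : ℝ) : Prop where
  lowerBdd_left : LowerBdd B a
  lowerBdd_right : LowerBdd F a'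
  nonneg_left : 0 ≤ a
  nonneg_right : 0 ≤ a'
  nonempty_left : I.Nonempty
  nonempty_right : J.Nonempty
  nonneg_R : 0 ≤ R
  pos_D : 0 < D
  pos_c : 0 < c
  abs_left : ∀ i r, |B i r| ≤ D
  abs_right : ∀ t r, |F t r| ≤ D
  le_left : c ^ 2 ≤ m * leverage B I
  le_right : c ^ 2 ≤ l * leverage F J
  one_le_k : 1 ≤ k
  le_half : ε ≤ 1 / 2
  small : SmallStep ε (min √(I.card : ℝ) √(J.card : ℝ) ^ 2) k a a' R m l

namespace PertSetup

variable (h : PertSetup B F I J a a' R ε D c)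

include h

theorem symm : PertSetup F B J I a' a R ε D c :=
  ⟨h.lowerBdd_right, h.lowerBdd_left, h.nonneg_right, h.nonneg_left, h.nonempty_right,
    h.nonempty_left, h.nonneg_R, h.pos_D, h.pos_c, h.abs_right, h.abs_left, h.le_right, h.le_left,
    h.one_le_k, h.le_half, by rw [min_comm]; exact h.small.symm⟩

theorem leverage_pos : 0 < leverage B I := by
  by_contra hcon
  have h1 := h.le_left
  have h2 := pow_pos h.pos_c 2
  have h3 : (m : ℝ) * leverage B I ≤ 0 := mul_nonpos_of_nonneg_of_nonpos (by positivity)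
    (not_lt.1 hcon)
  linarith

theorem totalLev_pos : 0 < totalLev B F I J := by
  have h1 := h.leverage_pos
  have h2 := h.symm.leverage_pos
  have h3 : (0 : ℝ) < I.card := by exact_mod_cast h.nonempty_left.card_pos
  have h4 : (0 : ℝ) < J.card := by exact_mod_cast h.nonempty_right.card_pos
  unfold totalLev; positivity

theorem one_le_m : (1 : ℝ) ≤ m := by
  obtain ⟨i, -⟩ := h.nonempty_left
  exact_mod_cast Nat.one_le_of_lt i.2

theorem angle_nonneg : 0 ≤ √a * √a' * R :=
  mul_nonneg (by positivity) h.nonneg_R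

theorem angle_le : √a * √a' * R ≤ ε := by
  refine le_trans ?_ h.small.left
  exact le_mul_of_one_le_right h.angle_nonneg (Real.one_le_sqrt.2 h.one_le_m)

theorem angle_le_one : √a * √a' * R ≤ 1 := h.angle_le.trans (h.le_half.trans (by norm_num))

theorem eps_nonneg : 0 ≤ ε := h.angle_nonneg.trans h.angle_le

theorem gram_eq : gramMat (B + rotPert R B F I J) = gramMat B :=
  gram_add_rotPert h.lowerBdd_left h.lowerBdd_right h.nonneg_left h.nonneg_right h.nonempty_left
    h.nonneg_R h.totalLev_pos h.angle_le_one

theorem sum_abs_le (i : Fin m) : ∑ r, |rotPert R B F I J i r| ≤ 1 := by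
  refine (sum_abs_rotPert_le h.lowerBdd_left h.lowerBdd_right h.nonneg_left h.nonneg_right
    h.nonempty_left h.nonneg_R h.totalLev_pos h.angle_le_one i).trans ?_
  linarith [h.small.linear', h.le_half,
    show √(k : ℝ) * (2 * (√a' * R)) = 2 * (√(k : ℝ) * (√a' * R)) by ring]

theorem abs_le (i : Fin m) (r : Fin k) : |rotPert R B F I J i r| ≤ 1 :=
  (Finset.single_le_sum (f := fun r => |rotPert R B F I J i r|) (fun _ _ => abs_nonneg _)
    (Finset.mem_univ r)).trans (h.sum_abs_le i)

theorem sq_inv_le_leverage : c / √(m : ℝ) ≤ √(leverage B I) := by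
  have hm : (0 : ℝ) < m := zero_lt_one.trans_le h.one_le_m
  refine Real.le_sqrt_of_sq_le ?_
  rw [div_pow, Real.sq_sqrt hm.le, div_le_iff₀ hm, mul_comm]
  exact h.le_left

/-- Nondegeneracy enters here: √leverage ≥ c/√m, while `small.left` bounds the angle by ε/√m. The
rotation is therefore small relative to the leverage itself. -/
theorem angle_le_sqrt_leverage : √a * √a' * R ≤ ε / c * √(leverage B I) := by
  have hm : 0 < √(m : ℝ) := Real.sqrt_pos.2 (zero_lt_one.trans_le h.one_le_m)
  have hc := h.pos_c
  calc _ ≤ ε / √(m : ℝ) := by rw [le_div_iff₀ hm]; exact h.small.left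
    _ = ε / c * (c / √(m : ℝ)) := by field_simp
    _ ≤ _ := mul_le_mul_of_nonneg_left h.sq_inv_le_leverage (div_nonneg h.eps_nonneg hc.le)

theorem abs_sqrt_leverage_sub_le' :
    |√(leverage (B + rotPert R B F I J) I) - √(leverage B I)| ≤ 2 * (√a * √a' * R) :=
  abs_sqrt_leverage_sub_le h.lowerBdd_left h.lowerBdd_right h.nonneg_left h.nonneg_right
    h.nonempty_left h.nonneg_R h.totalLev_pos h.angle_le_one

/-- The root of the leverage moves by at most 2ε/c times itself, so it at most doubles. This keeps
the tolerated bias of the neighbouring model of order s_*. -/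
theorem leverage_add_le (hεc : ε ≤ c / 2) :
    leverage (B + rotPert R B F I J) I ≤ 4 * leverage B I := by
  have h1 := (abs_sub_le_iff.1 h.abs_sqrt_leverage_sub_le').1
  have h2 := h.angle_le_sqrt_leverage
  have h3 : ε / c ≤ 1 / 2 := by rw [div_le_iff₀ h.pos_c]; linarith
  have h4 : √(leverage (B + rotPert R B F I J) I) ≤ 2 * √(leverage B I) := by
    nlinarith [Real.sqrt_nonneg (leverage B I)]
  calc _ ≤ √(leverage (B + rotPert R B F I J) I) ^ 2 := by
        by_cases hn : 0 ≤ leverage (B + rotPert R B F I J) I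
        · rw [Real.sq_sqrt hn]
        · exact (not_le.1 hn).le.trans (sq_nonneg _)
    _ ≤ (2 * √(leverage B I)) ^ 2 := pow_le_pow_left₀ (Real.sqrt_nonneg _) h4 2
    _ = _ := by rw [mul_pow, Real.sq_sqrt h.leverage_pos.le]; norm_num

theorem le_sqrt_leverage_add (hεc : ε ≤ c / 4) :
    c / 2 ≤ √((m : ℝ) * leverage (B + rotPert R B F I J) I) := by
  have hm : 0 < √(m : ℝ) := Real.sqrt_pos.2 (zero_lt_one.trans_le h.one_le_m)
  have h1 := (abs_sub_le_iff.1 h.abs_sqrt_leverage_sub_le').2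
  have h2 := h.small.left
  have h3 := h.sq_inv_le_leverage
  rw [div_le_iff₀ hm] at h3
  rw [Real.sqrt_mul (by positivity)]
  nlinarith

theorem leverage_le_bound : leverage B I ≤ a * k * D ^ 2 := by
  refine (h.lowerBdd_left.quadForm_le h.nonneg_left _).trans ?_
  have h1 : ∀ r, |rowMean B I r| ≤ D := fun r => by
    have hI : (0 : ℝ) < I.card := by exact_mod_cast h.nonempty_left.card_pos
    rw [rowMean, abs_div, abs_of_pos hI, div_le_iff₀ hI]
    refine (Finset.abs_sum_le_sum_abs _ _).trans ((Finset.sum_le_sum fun i _ =>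
      h.abs_left i r).trans ?_)
    simp [mul_comm]
  have h2 := vnorm_le_of_abs_le h.pos_D.le h1
  rw [mul_assoc]
  refine mul_le_mul_of_nonneg_left ?_ h.nonneg_left
  refine (pow_le_pow_left₀ (vnorm_nonneg _) h2 2).trans (le_of_eq ?_)
  rw [mul_pow, Real.sq_sqrt (by positivity), Fintype.card_fin]

/-- For |I| ≤ |J| the bound `small.lev` says |I| · leverage B I ≤ εD², and leverage F J/|I| is a
summand of L. Using the smaller group is why only min(|I|, |J|) enters the rates. -/
theorem leverage_mul_le_of_card_le (hIJ : I.card ≤ J.card) :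
    leverage B I * leverage F J ≤ ε * D ^ 2 * totalLev B F I J := by
  have hI : (0 : ℝ) < I.card := by exact_mod_cast h.nonempty_left.card_pos
  have hJ : (0 : ℝ) < J.card := by exact_mod_cast h.nonempty_right.card_pos
  have hmin : min √(I.card : ℝ) √(J.card : ℝ) ^ 2 = I.card := by
    rw [min_eq_left (Real.sqrt_le_sqrt (by exact_mod_cast hIJ)), Real.sq_sqrt hI.le]
  have h1 := h.small.lev
  rw [hmin] at h1
  have h2 : I.card * leverage B I ≤ ε * D ^ 2 := by
    calc _ ≤ I.card * (a * k * D ^ 2) := by gcongr; exact h.leverage_le_bound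
      _ = I.card * (a * k) * D ^ 2 := by ring
      _ ≤ _ := by gcongr
  have h3 := h.symm.leverage_pos
  have h4 := h.leverage_pos
  calc _ = I.card * leverage B I * (leverage F J / I.card) := by field_simp
    _ ≤ ε * D ^ 2 * (leverage F J / I.card) := by gcongr
    _ ≤ _ := by
      refine mul_le_mul_of_nonneg_left ?_ (mul_nonneg h.eps_nonneg (sq_nonneg D))
      exact le_add_of_nonneg_left (by positivity)

theorem leverage_mul_le : leverage B I * leverage F J ≤ ε * D ^ 2 * totalLev B F I J := by
  rcases le_total I.card J.card with hIJ | hIJ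
  · exact h.leverage_mul_le_of_card_le hIJ
  · rw [totalLev_comm, mul_comm (leverage B I)]
    exact h.symm.leverage_mul_le_of_card_le hIJ

theorem vnorm_prodPert_le' :
    vnorm (fun z : Fin m × Fin l => prodPert R B F I J z.1 z.2) ≤ R * (1 + 6 * ε) := by
  refine (vnorm_prodPert_le h.lowerBdd_left h.lowerBdd_right h.nonneg_left h.nonneg_right
    h.nonempty_left h.nonempty_right h.nonneg_R h.totalLev_pos h.angle_le_one).trans ?_
  have := h.angle_le
  have := h.nonneg_R
  gcongr

/-- Rows of B and F have norm at most √k D, so the first-order terms are of size D√k√a R and D√k√a'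
R, which the linear smallness conditions control. -/
theorem abs_prodPert_le' (i : Fin m) (t : Fin l) :
    |prodPert R B F I J i t| ≤ (4 * D + 2) * ε := by
  have hk : (1 : ℝ) ≤ √(k : ℝ) := Real.one_le_sqrt.2 (by exact_mod_cast h.one_le_k)
  have hrow : ∀ {m : ℕ} {B : Matrix (Fin m) (Fin k) ℝ}, (∀ i r, |B i r| ≤ D) → ∀ i,
      vnorm (B i) ≤ √(k : ℝ) * D := fun hB i => by
    simpa using vnorm_le_of_abs_le h.pos_D.le (hB i)
  refine (abs_prodPert_le h.lowerBdd_left h.lowerBdd_right h.nonneg_left h.nonneg_right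
    h.nonempty_left h.nonempty_right h.nonneg_R h.totalLev_pos h.angle_le_one
    (hrow h.abs_left) (hrow h.abs_right) i t).trans ?_
  have hR := h.nonneg_R
  have hD := h.pos_D
  have hε := h.eps_nonneg
  have h1 := h.small.linear
  have h2 := h.small.linear'
  have ha : 0 ≤ √a * R := by positivity
  have ha' : 0 ≤ √a' * R := by positivity
  have h3 : √a * R ≤ ε := (le_mul_of_one_le_left ha hk).trans h1
  have h4 : √a' * R ≤ ε := (le_mul_of_one_le_left ha' hk).trans h2
  have h5 : √a * R * (√a' * R) ≤ ε * (1 / 2) := mul_le_mul h3 (h4.trans h.le_half) ha' hε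
  calc _ = 2 * D * (√(k : ℝ) * (√a' * R)) + 2 * D * (√(k : ℝ) * (√a * R)) +
        4 * (√a * R * (√a' * R)) := by ring
    _ ≤ 2 * D * ε + 2 * D * ε + 4 * (ε * (1 / 2)) := by gcongr
    _ = _ := by ring

theorem le_blockMean_prodPert' :
    R * √(totalLev B F I J) * (1 - (2 * D ^ 2 + 1 + 4 / c) * ε) ≤
      blockMean (prodPert R B F I J) I J := by
  refine le_trans ?_ (le_blockMean_prodPert h.lowerBdd_left h.lowerBdd_right h.nonneg_left
    h.nonneg_right h.nonempty_left h.nonempty_right h.nonneg_R h.totalLev_pos h.angle_le_one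
    h.leverage_mul_le h.leverage_pos)
  refine mul_le_mul_of_nonneg_left ?_ (mul_nonneg h.nonneg_R (Real.sqrt_nonneg _))
  have h1 : √a * √a' * R / √(leverage B I) ≤ ε / c := by
    rw [div_le_iff₀ (Real.sqrt_pos.2 h.leverage_pos)]
    exact h.angle_le_sqrt_leverage
  have h2 := h.angle_le
  have e : (2 * D ^ 2 + 1 + 4 / c) * ε = 2 * (ε * D ^ 2) + ε + 4 * (ε / c) := by
    have := h.pos_c
    field_simp
  rw [e, mul_div_assoc]
  linarith

end PertSetup

end SmallStepBounds

open Classical in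
theorem measurable_ite_zero_apply {Ξ : Type*} [MeasurableSpace Ξ] {m k : ℕ} {s : Set Ξ}
    (hs : MeasurableSet s) {A : Ξ → Matrix (Fin m) (Fin k) ℝ}
    (hA : ∀ i r, Measurable fun ξ => A ξ i r) (i : Fin m) (r : Fin k) :
    Measurable fun ξ => (if ξ ∈ s then A ξ else 0) i r := by
  have h : (fun ξ => (if ξ ∈ s then A ξ else 0) i r) =
      s.piecewise (fun ξ => A ξ i r) fun _ => 0 := by
    funext ξ
    by_cases hξ : ξ ∈ s <;> simp [hξ]
  rw [h]
  exact (hA i r).piecewise hs measurable_const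

namespace PanelModel

variable {Ξ : Type*} [MeasurableSpace Ξ] {N T : ℕ → ℕ} (θ : PanelModel Ξ N T) {P : Measure Ξ}
  {K : ℕ → ℕ} {I : (n : ℕ) → Finset (Fin (N n))} {J : (n : ℕ) → Finset (Fin (T n))}

/-! ### The least favourable model -/

/-- The size of the least favourable perturbation. -/
noncomputable def pertSize (τ : ℝ) (n : ℕ) : ℝ := τ * θ.σ n / √(θ.p n : ℝ)

/-- The states at which the perturbation is bounded, as the class requires. -/
def pertEvent (K : ℕ → ℕ) (I : (n : ℕ) → Finset (Fin (N n))) (J : (n : ℕ) → Finset (Fin (T n)))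
    (τ : ℝ) (n : ℕ) : Set Ξ :=
  {ξ | (∀ i r, |rotPert (θ.pertSize τ n) (θ.β (K n) n ξ) (θ.F (K n) n ξ) (I n) (J n) i r| ≤ 1) ∧
    ∀ t, ∑ r, |rotPert (θ.pertSize τ n) (θ.F (K n) n ξ) (θ.β (K n) n ξ) (J n) (I n) t r| ≤ 1}

theorem measurableSet_pertEvent (τ : ℝ) (n : ℕ) : MeasurableSet (θ.pertEvent K I J τ n) := by
  have hβ := θ.measurable_β (K n) n
  have hF := θ.measurable_F (K n) n
  refine measurableSet_setOfPred.2 (Measurable.and ?_ ?_)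
  · exact Measurable.forall fun i => Measurable.forall fun r => measurableSet_setOfPred.1
      (measurableSet_le (measurable_rotPert hβ hF _ _ _ i r).abs measurable_const)
  · exact Measurable.forall fun t => measurableSet_setOfPred.1 (measurableSet_le
      (Finset.measurable_sum _ fun r _ => (measurable_rotPert hF hβ _ _ _ t r).abs)
      measurable_const)

open Classical in
/-- The least favourable shift of the loadings and the factors. -/
noncomputable def leastFavShift (K : ℕ → ℕ) (I : (n : ℕ) → Finset (Fin (N n)))
    (J : (n : ℕ) → Finset (Fin (T n))) (τ : ℝ) : Shift (Ξ := Ξ) (N := N) (T := T) K where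
  -- The cut-off keeps the bounds on the basis and on h valid for every ξ; off this event the model
  -- is left as it is.
  δβ n ξ := if ξ ∈ θ.pertEvent K I J τ n then
    rotPert (θ.pertSize τ n) (θ.β (K n) n ξ) (θ.F (K n) n ξ) (I n) (J n) else 0
  δF n ξ := if ξ ∈ θ.pertEvent K I J τ n then
    rotPert (θ.pertSize τ n) (θ.F (K n) n ξ) (θ.β (K n) n ξ) (J n) (I n) else 0
  measurable_δβ n i r := measurable_ite_zero_apply (θ.measurableSet_pertEvent τ n)
    (measurable_rotPert (θ.measurable_β (K n) n) (θ.measurable_F (K n) n) _ _ _) i r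
  measurable_δF n t r := measurable_ite_zero_apply (θ.measurableSet_pertEvent τ n)
    (measurable_rotPert (θ.measurable_F (K n) n) (θ.measurable_β (K n) n) _ _ _) t r
  δβ_le n ξ i r := by
    split_ifs with h
    · exact h.1 i r
    · simp

theorem sum_abs_leastFavShift_le (τ : ℝ) (n : ℕ) (ξ : Ξ) (t : Fin (T n)) :
    ∑ r, |(θ.leastFavShift K I J τ).δF n ξ t r| ≤ 1 := by
  simp only [leastFavShift]
  split_ifs with h
  · exact h.2 t
  · simp

/-- The model in which the loadings and the factors are perturbed in the least favourable
direction. -/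
noncomputable def leastFav (K : ℕ → ℕ) (I : (n : ℕ) → Finset (Fin (N n)))
    (J : (n : ℕ) → Finset (Fin (T n))) (τ : ℝ) : PanelModel Ξ N T :=
  θ.shifted (θ.leastFavShift K I J τ)

/-- The states at which the perturbation of the loadings and the factors is well behaved. -/
def GoodPert (K : ℕ → ℕ) (I : (n : ℕ) → Finset (Fin (N n))) (J : (n : ℕ) → Finset (Fin (T n)))
    (τ ε D c : ℝ) (η : ℕ → ℝ) (n : ℕ) (ξ : Ξ) : Prop :=
  PertSetup (θ.β (K n) n ξ) (θ.F (K n) n ξ) (I n) (J n) (η n / N n) (η n / T n) (θ.pertSize τ n)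
    ε D c

namespace GoodPert

variable {θ} {τ ε D c : ℝ} {η : ℕ → ℝ} {n : ℕ} {ξ : Ξ} (h : θ.GoodPert K I J τ ε D c η n ξ)

include h

theorem mem_pertEvent : ξ ∈ θ.pertEvent K I J τ n :=
  ⟨h.abs_le, (PertSetup.symm h).sum_abs_le⟩

theorem β_eq : (θ.leastFav K I J τ).β (K n) n ξ = θ.β (K n) n ξ +
    rotPert (θ.pertSize τ n) (θ.β (K n) n ξ) (θ.F (K n) n ξ) (I n) (J n) := by
  rw [leastFav, shifted_β]
  simp only [leastFavShift, if_pos h.mem_pertEvent]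

theorem F_eq : (θ.leastFav K I J τ).F (K n) n ξ = θ.F (K n) n ξ +
    rotPert (θ.pertSize τ n) (θ.F (K n) n ξ) (θ.β (K n) n ξ) (J n) (I n) := by
  rw [leastFav, shifted_F]
  simp only [leastFavShift, if_pos h.mem_pertEvent]

theorem M_eq : (θ.leastFav K I J τ).M n ξ = θ.M n ξ +
    prodPert (θ.pertSize τ n) (θ.β (K n) n ξ) (θ.F (K n) n ξ) (I n) (J n) := by
  rw [leastFav, shifted_M]
  simp only [leastFavShift, if_pos h.mem_pertEvent]
  rfl

theorem Sβ_eq : (θ.leastFav K I J τ).Sβ (K n) n ξ = θ.Sβ (K n) n ξ := by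
  rw [Sβ, Sβ, h.β_eq]
  exact congrArg _ h.gram_eq

theorem SF_eq : (θ.leastFav K I J τ).SF (K n) n ξ = θ.SF (K n) n ξ := by
  rw [SF, SF, h.F_eq]
  exact congrArg _ (PertSetup.symm h).gram_eq

theorem Q_eq : (θ.leastFav K I J τ).Q (K n) n ξ = θ.Q (K n) n ξ := by
  rw [Q, Q, h.Sβ_eq, h.SF_eq]

theorem leverageβ_eq : (θ.leastFav K I J τ).leverageβ (K n) n (I n) ξ =
    leverage (θ.β (K n) n ξ +
      rotPert (θ.pertSize τ n) (θ.β (K n) n ξ) (θ.F (K n) n ξ) (I n) (J n)) (I n) := by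
  rw [← h.β_eq]; rfl

theorem leverageF_eq : (θ.leastFav K I J τ).leverageF (K n) n (J n) ξ =
    leverage (θ.F (K n) n ξ +
      rotPert (θ.pertSize τ n) (θ.F (K n) n ξ) (θ.β (K n) n ξ) (J n) (I n)) (J n) := by
  rw [← h.F_eq]; rfl

theorem sStarSq_le (hεc : ε ≤ c / 2) :
    (θ.leastFav K I J τ).sStarSq (K n) n (I n) (J n) ξ ≤
      4 * θ.sStarSq (K n) n (I n) (J n) ξ := by
  have h1 := PertSetup.leverage_add_le h hεc
  have h2 := PertSetup.leverage_add_le (PertSetup.symm h) hεc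
  rw [← h.leverageβ_eq] at h1
  rw [← h.leverageF_eq] at h2
  change _ ≤ 4 * θ.leverageβ (K n) n (I n) ξ at h1
  change _ ≤ 4 * θ.leverageF (K n) n (J n) ξ at h2
  have hp : 0 ≤ (θ.p n : ℝ) := (θ.p n).2.1
  have e : ∀ b : ℝ, 0 ≤ b → 0 ≤ θ.σ n ^ 2 / (θ.p n : ℝ) * (1 / b) := fun b hb => by positivity
  have h3 := mul_le_mul_of_nonneg_left h1 (e ((J n).card) (by positivity))
  have h4 := mul_le_mul_of_nonneg_left h2 (e ((I n).card) (by positivity))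
  rw [sStarSq, sStarSq]
  change θ.σ n ^ 2 / (θ.p n : ℝ) * (1 / _) * _ + θ.σ n ^ 2 / (θ.p n : ℝ) * (1 / _) * _ ≤ _
  linarith

end GoodPert

/-- The Frobenius norm of `M`. -/
noncomputable def normM (n : ℕ) (ξ : Ξ) : ℝ :=
  vnorm fun z : Fin (N n) × Fin (T n) => θ.M n ξ z.1 z.2

theorem normM_nonneg (n : ℕ) (ξ : Ξ) : 0 ≤ θ.normM n ξ := vnorm_nonneg _

theorem normM_sq (n : ℕ) (ξ : Ξ) : θ.normM n ξ ^ 2 = ∑ i, ∑ t, θ.M n ξ i t ^ 2 := by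
  rw [normM, vnorm_sq', Fintype.sum_prod_type]

/-- M changes by at most R(1 + 6ε) ≤ 2R ≤ ‖M‖/2, so the two norms are within a factor 2 of each
other. -/
theorem GoodPert.normM_le {τ ε D c : ℝ} {η : ℕ → ℝ} {n : ℕ} {ξ : Ξ}
    (h : θ.GoodPert K I J τ ε D c η n ξ) (hε : ε ≤ 1 / 6)
    (hR : 4 * θ.pertSize τ n ≤ θ.normM n ξ) :
    (θ.leastFav K I J τ).normM n ξ ≤ 2 * θ.normM n ξ ∧
      θ.normM n ξ ≤ 2 * (θ.leastFav K I J τ).normM n ξ := by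
  have h1 := PertSetup.vnorm_prodPert_le' h
  have hR0 : 0 ≤ θ.pertSize τ n := PertSetup.nonneg_R h
  have h2 : θ.pertSize τ n * (1 + 6 * ε) ≤ θ.normM n ξ / 2 := by nlinarith
  have e : (fun z : Fin (N n) × Fin (T n) => (θ.leastFav K I J τ).M n ξ z.1 z.2) =
      (fun z : Fin (N n) × Fin (T n) => θ.M n ξ z.1 z.2) + fun z : Fin (N n) × Fin (T n) =>
        prodPert (θ.pertSize τ n) (θ.β (K n) n ξ) (θ.F (K n) n ξ) (I n) (J n) z.1 z.2 := by
    rw [h.M_eq]; rfl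
  constructor
  · have h3 := vnorm_add_le (fun z : Fin (N n) × Fin (T n) => θ.M n ξ z.1 z.2)
      fun z : Fin (N n) × Fin (T n) =>
        prodPert (θ.pertSize τ n) (θ.β (K n) n ξ) (θ.F (K n) n ξ) (I n) (J n) z.1 z.2
    rw [← e] at h3
    change (θ.leastFav K I J τ).normM n ξ ≤ θ.normM n ξ + _ at h3
    linarith [vnorm_nonneg fun z : Fin (N n) × Fin (T n) => θ.M n ξ z.1 z.2]
  · have h3 := vnorm_sub_le
      (fun z : Fin (N n) × Fin (T n) => (θ.leastFav K I J τ).M n ξ z.1 z.2)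
      fun z : Fin (N n) × Fin (T n) =>
        prodPert (θ.pertSize τ n) (θ.β (K n) n ξ) (θ.F (K n) n ξ) (I n) (J n) z.1 z.2
    rw [e, add_sub_cancel_right, ← e] at h3
    change θ.normM n ξ ≤ (θ.leastFav K I J τ).normM n ξ + _ at h3
    linarith

/-- For K ≥ 1 the signal strength ψ is O_P(‖M‖). As √p ψ diverges, √p ‖M‖ exceeds any constant with
high probability, in particular q > 4τS. -/
theorem SignalStrength.le_normM {δ τ S : ℝ} {ψ : ℕ → ℝ} (h : θ.SignalStrength P K δ ψ)
    (hδ : 0 ≤ δ) (hK : ∀ᶠ n in atTop, 1 ≤ K n) (hp : ∀ n, 0 < (θ.p n : ℝ)) (hψ : ∀ n, 0 < ψ n)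
    (hτ : 0 ≤ τ) (hσ : ∀ n, 0 ≤ θ.σ n ∧ θ.σ n ≤ S)
    (hrate : ∀ ε : ℝ, 0 < ε → ∀ᶠ n in atTop, 1 ≤ ε * ((θ.p n : ℝ) * ψ n ^ 2)) :
    WithProbToOne P fun n ξ => 4 * θ.pertSize τ n ≤ θ.normM n ξ := by
  have hS : 0 ≤ S := (hσ 0).1.trans (hσ 0).2
  set q := 4 * τ * S + 1 with hq
  have hq0 : 0 < q := by positivity
  have hr : Tendsto (fun n => √(θ.p n : ℝ) * ψ n / q) atTop atTop := by
    refine tendsto_atTop.2 fun b => ?_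
    filter_upwards [hrate (1 / ((|b| + 1) * q) ^ 2) (by positivity)] with n hn
    rw [one_div_mul_eq_div, le_div_iff₀ (by positivity), one_mul] at hn
    rw [le_div_iff₀ hq0]
    have h1 : (|b| + 1) * q ≤ √(θ.p n : ℝ) * ψ n := by
      refine abs_le_of_sq_le_sq' ?_ (mul_nonneg (Real.sqrt_nonneg _) (hψ n).le) |>.2
      rwa [mul_pow (√_), Real.sq_sqrt (hp n).le]
    exact le_trans (by gcongr; linarith [le_abs_self b]) h1
  refine (h.1.exists_bound hr).mono ?_
  filter_upwards [hK] with n hKn ξ hξ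
  have hpn := Real.sqrt_pos.2 (hp n)
  have hψn := hψ n
  have hM : √((K n : ℝ) ^ (-(2 * δ + 1)) * ∑ i, ∑ t, θ.M n ξ i t ^ 2) ≤ θ.normM n ξ := by
    refine Real.sqrt_le_iff.2 ⟨vnorm_nonneg _, ?_⟩
    rw [← normM_sq]
    refine mul_le_of_le_one_left (sq_nonneg _) ?_
    exact Real.rpow_le_one_of_one_le_of_nonpos (by exact_mod_cast hKn) (by linarith)
  rw [abs_of_pos hψn, abs_of_nonneg (Real.sqrt_nonneg _)] at hξ
  have h1 : ψ n ≤ √(θ.p n : ℝ) * ψ n / q * θ.normM n ξ := hξ.trans (by gcongr)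
  have h2 : q ≤ √(θ.p n : ℝ) * θ.normM n ξ := by
    refine le_of_mul_le_mul_right ?_ (div_pos hψn hq0)
    calc _ = ψ n := by field_simp
      _ ≤ _ := h1
      _ = _ := by ring
  rw [pertSize, mul_div_assoc', div_le_iff₀ hpn]
  have h3 : τ * θ.σ n ≤ τ * S := mul_le_mul_of_nonneg_left (hσ n).2 hτ
  linarith

/-- The perturbation is well behaved with probability converging to one. -/
theorem InClass.goodPert [IsProbabilityMeasure P] (h : θ.InClass P K I J) {C c₀ τ ε S : ℝ}
    {η : ℕ → ℝ}
    (hN : Tendsto N atTop atTop) (hT : Tendsto T atTop atTop) (hI : ∀ n, (I n).Nonempty)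
    (hJ : ∀ n, (J n).Nonempty) (hC : 0 < C) (hc₀ : 0 < c₀) (hη : ∀ n, 0 < η n) (hτ : 0 ≤ τ)
    (hσ : ∀ n, 0 ≤ θ.σ n ∧ θ.σ n ≤ S) (hε : 0 < ε) (hε2 : ε ≤ 1 / 2)
    (hgood : WithProbToOne P fun n ξ => θ.Good K I J C c₀ η n ξ)
    (hrate : ∀ ε : ℝ, 0 < ε → ∀ᶠ n in atTop,
        RateBound ε (min (√((I n).card : ℝ)) (√((J n).card : ℝ))) (logFactor N T n) (η n) (K n)
          (θ.p n) (N n) ∧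
        RateBound ε (min (√((I n).card : ℝ)) (√((J n).card : ℝ))) (logFactor N T n) (η n) (K n)
          (θ.p n) (T n)) :
    WithProbToOne P fun n ξ => θ.GoodPert K I J τ ε C c₀ η n ξ := by
  have hS : 0 ≤ S := (hσ 0).1.trans (hσ 0).2
  have hq0 : 0 ≤ τ * S := mul_nonneg hτ hS
  set r := ε / (τ * S + 1) with hr
  have hr0 : 0 < r := by positivity
  have hrle : r * (τ * S + 1) = ε := div_mul_cancel₀ _ (by positivity)
  refine hgood.mono ?_
  -- The factor τS of the perturbation size is built into r; r² is needed because the linear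
  -- conditions take a square root of the rate constant.
  filter_upwards [hrate (min r (r ^ 2)) (lt_min hr0 (by positivity)), hN.eventually_gt_atTop 0,
    hT.eventually_gt_atTop 0] with n hn hNn hTn ξ hξ
  have hN' : (0 : ℝ) < N n := by exact_mod_cast hNn
  have hT' : (0 : ℝ) < T n := by exact_mod_cast hTn
  have hηn := hη n
  have hq : τ * θ.σ n ≤ τ * S := mul_le_mul_of_nonneg_left (hσ n).2 hτ
  have hqn : 0 ≤ τ * θ.σ n := mul_nonneg hτ (hσ n).1
  have hsq : √(min r (r ^ 2)) ≤ r := Real.sqrt_le_iff.2 ⟨hr0.le, min_le_right _ _⟩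
  have hmin : min r (r ^ 2) ≤ r := min_le_left _ _
  have key : τ * θ.σ n * r ≤ ε := by nlinarith
  exact ⟨hξ.lowerBdd_β, hξ.lowerBdd_F, by positivity, by positivity, hI n, hJ n,
    div_nonneg hqn (Real.sqrt_nonneg _), hC, hc₀, hξ.abs_β, hξ.abs_F, hξ.le_β, hξ.le_F,
    hξ.one_le_K, hε2, SmallStep.of_rateBound hηn (by positivity) (h.p_pos n) hN' hT' hqn hn.1 hn.2
      (by nlinarith) (le_trans (by gcongr) key) (le_trans (by gcongr) key)⟩

end PanelModel

/-! ### The class is closed under the least favourable perturbation. -/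

namespace PanelModel

variable {Ξ : Type*} [MeasurableSpace Ξ] {N T : ℕ → ℕ} {θ : PanelModel Ξ N T} {P : Measure Ξ}
  {K : ℕ → ℕ} {I : (n : ℕ) → Finset (Fin (N n))} {J : (n : ℕ) → Finset (Fin (T n))}

theorem InClass.exists_sigma_bounds (h : θ.InClass P K I J) :
    ∃ s S : ℝ, 0 < s ∧ (∀ n, s ≤ θ.σ n) ∧ ∀ n, 0 ≤ θ.σ n ∧ θ.σ n ≤ S := by
  obtain ⟨s, S, hs, hσ⟩ := h.noise_level
  exact ⟨s, S, hs, fun n => (hσ n).1, fun n => ⟨hs.le.trans (hσ n).1, (hσ n).2⟩⟩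

/-- The class contains the least favourable model of each of its members. -/
theorem InClass.leastFav [IsProbabilityMeasure P] (h : θ.InClass P K I J)
    (hN : Tendsto N atTop atTop) (hT : Tendsto T atTop atTop) (hI : ∀ n, (I n).Nonempty)
    (hJ : ∀ n, (J n).Nonempty) {τ : ℝ} (hτ : 0 ≤ τ) :
    (θ.leastFav K I J τ).InClass P K I J := by
  obtain ⟨C, ν, δ, g, c, c₀, η, ψ, hν, hδ, hg, hc, hc₀, hη, hψ, hs, hsig, hpar, hgood, hrate,
    hrate'⟩ := h.exists_data hN hT hI hJ
  obtain ⟨s, S, -, -, hσ⟩ := h.exists_sigma_bounds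
  set ε := min (1 / 6) (c₀ / 4) with hεd
  have hε : 0 < ε := lt_min (by norm_num) (by positivity)
  have hε6 : ε ≤ 1 / 6 := min_le_left _ _
  have hεc : ε ≤ c₀ / 4 := min_le_right _ _
  have hpert := InClass.goodPert θ h (τ := τ) hN hT hI hJ (lt_max_of_lt_right one_pos) hc₀ hη hτ hσ
    hε (hε6.trans (by norm_num)) hgood hrate
  have hnorm := hpert.and (hsig.le_normM θ hδ (hgood.eventually_of_const fun n ξ hξ => hξ.one_le_K)
    h.p_pos hψ hτ hσ hrate')
  have hnorm' : WithProbToOne P fun n ξ => (θ.leastFav K I J τ).normM n ξ ≤ 2 * θ.normM n ξ ∧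
      θ.normM n ξ ≤ 2 * (θ.leastFav K I J τ).normM n ξ :=
    hnorm.mono (.of_forall fun n ξ hξ => hξ.1.normM_le θ hε6 hξ.2)
  have sqrt_eq : ∀ (θ : PanelModel Ξ N T) n ξ,
      √((K n : ℝ) ^ (-(2 * δ + 1)) * ∑ i, ∑ t, θ.M n ξ i t ^ 2) =
        √((K n : ℝ) ^ (-(2 * δ + 1))) * θ.normM n ξ := fun θ n ξ => by
    rw [← normM_sq, Real.sqrt_mul (by positivity), Real.sqrt_sq (normM_nonneg _ _ _)]
  -- Only two constants change. C becomes `max C 0 + 1`, since the shifts add at most 1 and C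
  -- carries no sign assumption; c₀ is halved. The exponents, η, ψ and the parameter conditions stay
  -- the same.
  refine ⟨h.p_pos, h.noise_level, ⟨max C 0 + 1, ν, δ, g, c, η, ψ, hν, hδ, hg, hc, hη, hψ,
    ⟨?_, ?_, ?_, ?_, ?_, ?_, ?_, ?_⟩, ⟨?_, ?_⟩, hpar⟩, ⟨c₀ / 2, by positivity, ?_, ?_⟩⟩
  · intro n
    filter_upwards [hs.norm_h n] with ξ hξ t
    refine (θ.eLpNorm_shifted_h_le (θ.leastFavShift K I J τ) n t ξ).trans ?_
    rw [ENNReal.ofReal_add (le_max_right _ _) zero_le_one]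
    exact add_le_add ((hξ t).trans (ENNReal.ofReal_le_ofReal (le_max_left _ _)))
      (ENNReal.ofReal_le_ofReal (θ.sum_abs_leastFavShift_le τ n ξ t))
  · intro n
    filter_upwards [hs.approx_error n] with ξ hξ i t
    rw [PanelModel.leastFav, shifted_MR]
    refine (hξ i t).trans (mul_le_mul_of_nonneg_right ?_ (by positivity))
    linarith [le_max_left C 0]
  · intro n r hr z hz
    refine (θ.shifted_φ_le (θ.leastFavShift K I J τ) (hs.basis_bounded n r hr) z hz).trans ?_
    linarith [le_max_left C 0]
  -- Equality of the Gram matrices transfers the conditions on singular values without loss.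
  · exact (hs.min_eig_β.and hpert).mono (.of_forall fun n ξ hξ => by rw [hξ.2.Sβ_eq]; exact hξ.1)
  · exact (hs.min_eig_F.and hpert).mono (.of_forall fun n ξ hξ => by rw [hξ.2.SF_eq]; exact hξ.1)
  · refine hs.mean_sq.mono (c := 4) (by norm_num) (hnorm'.mono (.of_forall fun n ξ hξ => ?_))
    refine ⟨?_, by norm_num⟩
    simp only [← normM_sq]
    rw [abs_of_nonneg (by positivity), abs_of_nonneg (by positivity), mul_left_comm]
    refine mul_le_mul_of_nonneg_left ?_ (by positivity)
    refine (pow_le_pow_left₀ (normM_nonneg _ _ _) hξ.1 2).trans (le_of_eq ?_)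
    ring
  · refine hs.condition_number.mono (c := 1) zero_le_one (hpert.mono (.of_forall fun n ξ hξ => ?_))
    rw [hξ.Q_eq, one_mul, one_mul]
    exact ⟨le_rfl, le_rfl⟩
  · exact (hs.gap.and hpert).mono (.of_forall fun n ξ hξ => by rw [hξ.2.Q_eq]; exact hξ.1)
  · refine hsig.1.mono (c := 2) (by norm_num) (hnorm'.mono (.of_forall fun n ξ hξ => ?_))
    refine ⟨by linarith [abs_nonneg (ψ n)], ?_⟩
    rw [sqrt_eq, sqrt_eq, abs_of_nonneg (mul_nonneg (Real.sqrt_nonneg _) (normM_nonneg _ _ _)),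
      abs_of_nonneg (mul_nonneg (Real.sqrt_nonneg _) (normM_nonneg _ _ _)), mul_left_comm]
    exact mul_le_mul_of_nonneg_left hξ.2 (Real.sqrt_nonneg _)
  · refine hsig.2.mono (c := 2) (by norm_num) (hnorm'.mono (.of_forall fun n ξ hξ => ?_))
    refine ⟨?_, by linarith [abs_nonneg (ψ n)]⟩
    rw [sqrt_eq, sqrt_eq, abs_of_nonneg (mul_nonneg (Real.sqrt_nonneg _) (normM_nonneg _ _ _)),
      abs_of_nonneg (mul_nonneg (Real.sqrt_nonneg _) (normM_nonneg _ _ _)), mul_left_comm]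
    exact mul_le_mul_of_nonneg_left hξ.1 (Real.sqrt_nonneg _)
  · refine hpert.mono (.of_forall fun n ξ hξ => ?_)
    rw [hξ.leverageβ_eq]
    exact PertSetup.le_sqrt_leverage_add hξ hεc
  · refine hpert.mono (.of_forall fun n ξ hξ => ?_)
    rw [hξ.leverageF_eq]
    exact PertSetup.le_sqrt_leverage_add (PertSetup.symm hξ) hεc

/-! ### The lower bound on the mean squared error -/

theorem exp_sub_one_le {x y : ℝ} (hx : 0 ≤ x) (hxy : x ≤ y) (hy : y ≤ 1) :
    Real.exp x - 1 ≤ x * (1 + y) := by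
  have h := (abs_le.1 (Real.abs_exp_sub_one_sub_id_le
    (show |x| ≤ 1 by rw [abs_of_nonneg hx]; linarith))).2
  nlinarith

/-- The bound on the divergence of the laws of the data in two models. -/
theorem exp_divergence_le {m l : ℕ} {Δ : Matrix (Fin m) (Fin l) ℝ} {p σ u : ℝ} (hp : 0 < p)
    (hσ : 0 < σ) (hu : 0 ≤ u) (hu1 : u ≤ 1 / 8) (hΔ : ∀ i t, Δ i t ^ 2 / σ ^ 2 ≤ u / 4)
    (hnorm : vnorm (fun z : Fin m × Fin l => Δ z.1 z.2) ≤ u * σ / √p * (1 + u / 4)) :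
    Real.exp (p * ∑ i, ∑ t, (Real.exp (Δ i t ^ 2 / σ ^ 2) - 1)) ≤ 1 + u ^ 2 * (1 + u) ^ 2 := by
  have h1 : ∑ i, ∑ t, Δ i t ^ 2 ≤ u ^ 2 * σ ^ 2 / p * (1 + u / 4) ^ 2 := by
    have := pow_le_pow_left₀ (vnorm_nonneg _) hnorm 2
    rw [vnorm_sq', Fintype.sum_prod_type] at this
    refine this.trans (le_of_eq ?_)
    rw [mul_pow, div_pow, Real.sq_sqrt hp.le, mul_pow]
  -- One factor 1 + u/4 comes from linearising the exponential and two from the norm; their product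
  -- is at most 1 + u for u ≤ 1/8.
  have h2 : p * ∑ i, ∑ t, (Real.exp (Δ i t ^ 2 / σ ^ 2) - 1) ≤ u ^ 2 * (1 + u) := by
    calc _ ≤ p * ∑ i, ∑ t, Δ i t ^ 2 / σ ^ 2 * (1 + u / 4) := by
          gcongr with i _ t _
          exact exp_sub_one_le (by positivity) (hΔ i t) (by linarith)
      _ = p * (1 + u / 4) / σ ^ 2 * ∑ i, ∑ t, Δ i t ^ 2 := by
          rw [Finset.mul_sum, Finset.mul_sum]
          refine Finset.sum_congr rfl fun i _ => ?_
          rw [Finset.mul_sum, Finset.mul_sum]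
          refine Finset.sum_congr rfl fun t _ => ?_
          ring
      _ ≤ p * (1 + u / 4) / σ ^ 2 * (u ^ 2 * σ ^ 2 / p * (1 + u / 4) ^ 2) := by gcongr
      _ = u ^ 2 * (1 + u / 4) ^ 3 := by field_simp
      _ ≤ _ := by
          gcongr
          nlinarith [sq_nonneg u, mul_nonneg hu (sq_nonneg u)]
  have h3 : u ^ 2 * (1 + u) ≤ u := by nlinarith [mul_nonneg hu hu]
  have h4 := exp_sub_one_le (x := u ^ 2 * (1 + u)) (by positivity) h3 (by linarith)
  calc _ ≤ Real.exp (u ^ 2 * (1 + u)) := Real.exp_le_exp.2 h2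
    _ ≤ _ := by linarith [show u ^ 2 * (1 + u) * (1 + u) = u ^ 2 * (1 + u) ^ 2 by ring]

/-- The perturbation moves the target by at least u s_*(1 - u), while the biases in the two models
are of order u² s_*. The mean of U thus moves by nearly u s_*, against a divergence of nearly u². -/
theorem GoodPert.le_mse {u ε D c : ℝ} {η : ℕ → ℝ} {n : ℕ} {ξ : Ξ}
    {U : (Fin (N n) → Fin (T n) → ℝ) × (Fin (N n) → Fin (T n) → Bool) → ℝ} (hU : Measurable U)
    (h : θ.GoodPert K I J u ε D c η n ξ) (hσ : 0 < θ.σ n) (hp : 0 < (θ.p n : ℝ)) (hu : 0 < u)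
    (hu1 : u ≤ 1 / 8) (hεc : ε ≤ c / 2) (hε1 : 24 * ε ≤ u)
    (hε2 : ((4 * D + 2) * ε) ^ 2 ≤ u / 4 * θ.σ n ^ 2) (hε3 : (2 * D ^ 2 + 1 + 4 / c) * ε ≤ u)
    (h1 : |θ.meanU n U ξ - blockMean (θ.M n ξ) (I n) (J n)| ≤
      u ^ 2 / 3 * √(θ.sStarSq (K n) n (I n) (J n) ξ))
    (h2 : |(θ.leastFav K I J u).meanU n U ξ -
      blockMean ((θ.leastFav K I J u).M n ξ) (I n) (J n)| ≤
      u ^ 2 / 3 * √((θ.leastFav K I J u).sStarSq (K n) n (I n) (J n) ξ)) :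
    ENNReal.ofReal ((1 - 8 * u) * θ.sStarSq (K n) n (I n) (J n) ξ) ≤ θ.mse n U (I n) (J n) ξ := by
  set Δ := prodPert (θ.pertSize u n) (θ.β (K n) n ξ) (θ.F (K n) n ξ) (I n) (J n) with hΔ
  set L := totalLev (θ.β (K n) n ξ) (θ.F (K n) n ξ) (I n) (J n)
  have hL : 0 < L := PertSetup.totalLev_pos h
  set s := √(θ.sStarSq (K n) n (I n) (J n) ξ) with hs
  have hs0 : 0 ≤ s := Real.sqrt_nonneg _
  have hspos : 0 ≤ θ.sStarSq (K n) n (I n) (J n) ξ := by rw [sStarSq_eq]; positivity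
  have hsR : θ.pertSize u n * √L = u * s := by
    rw [hs, sStarSq_eq, Real.sqrt_mul (by positivity), Real.sqrt_div (by positivity),
      Real.sqrt_sq hσ.le, pertSize]
    ring
  have hs' : √((θ.leastFav K I J u).sStarSq (K n) n (I n) (J n) ξ) ≤ 2 * s := by
    rw [Real.sqrt_le_iff, mul_pow, Real.sq_sqrt hspos]
    exact ⟨by positivity, (h.sStarSq_le hεc).trans_eq (by norm_num)⟩
  have hblock : u * s * (1 - u) ≤ blockMean Δ (I n) (J n) := by
    refine le_trans ?_ (PertSetup.le_blockMean_prodPert' h)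
    rw [hsR]
    gcongr
  have hdiff : blockMean ((θ.leastFav K I J u).M n ξ) (I n) (J n) =
      blockMean (θ.M n ξ) (I n) (J n) + blockMean Δ (I n) (J n) := by
    rw [h.M_eq, blockMean_eq, blockMean_eq, blockMean_eq, Matrix.add_mulVec, dotProduct_add]
  -- The biases cost u²s/3 and u²(2s)/3, in total u²s; this is where the tolerance u²/3 comes from.
  have hgap : u * s * (1 - 2 * u) ≤ (θ.leastFav K I J u).meanU n U ξ - θ.meanU n U ξ := by
    have e1 := (abs_le.1 h1).2
    have e2 := (abs_le.1 h2).1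
    have e3 : u ^ 2 / 3 * √((θ.leastFav K I J u).sStarSq (K n) n (I n) (J n) ξ) ≤
        u ^ 2 / 3 * (2 * s) := by gcongr
    rw [hdiff] at e2
    linarith [show u * s * (1 - 2 * u) = u * s * (1 - u) - u ^ 2 / 3 * (2 * s) - u ^ 2 / 3 * s by
      ring]
  have hdiv := exp_divergence_le (Δ := Δ) hp hσ hu.le hu1 (fun i t => by
      rw [div_le_iff₀ (by positivity)]
      refine le_trans ?_ hε2
      rw [← sq_abs]
      exact pow_le_pow_left₀ (abs_nonneg _) (PertSetup.abs_prodPert_le' h i t) 2)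
    ((PertSetup.vnorm_prodPert_le' h).trans (by
      refine mul_le_mul_of_nonneg_left (by linarith) (PertSetup.nonneg_R h)))
  have hV : 0 < u ^ 2 * (1 + u) ^ 2 := by positivity
  have hmse := sq_mean_sub_le_mse (p := θ.p n) hσ (θ.M n ξ) Δ hU hV hdiv
    (blockMean (θ.M n ξ) (I n) (J n))
  rw [hΔ, ← h.M_eq] at hmse
  change ENNReal.ofReal (((θ.leastFav K I J u).meanU n U ξ - θ.meanU n U ξ) ^ 2) ≤
    θ.mse n U (I n) (J n) ξ * _ at hmse
  have hV' : ENNReal.ofReal (u ^ 2 * (1 + u) ^ 2) ≠ 0 := by simpa using hV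
  refine (ENNReal.mul_le_mul_iff_left hV' ENNReal.ofReal_ne_top).1 (le_trans ?_ hmse)
  rw [← ENNReal.ofReal_mul' hV.le]
  refine ENNReal.ofReal_le_ofReal ?_
  have hgap0 : 0 ≤ u * s * (1 - 2 * u) := mul_nonneg (by positivity) (by linarith)
  refine le_trans ?_ (pow_le_pow_left₀ hgap0 hgap 2)
  rw [← Real.sq_sqrt hspos, ← hs]
  have e : (1 - 8 * u) * (1 + u) ^ 2 ≤ (1 - 2 * u) ^ 2 := by
    nlinarith [mul_nonneg hu.le hu.le, mul_nonneg hu.le (mul_nonneg hu.le hu.le)]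
  calc (1 - 8 * u) * s ^ 2 * (u ^ 2 * (1 + u) ^ 2) = (u * s) ^ 2 * ((1 - 8 * u) * (1 + u) ^ 2) := by ring
    _ ≤ (u * s) ^ 2 * (1 - 2 * u) ^ 2 := by gcongr
    _ = _ := by ring

/-- The lower bound on the mean squared error of asymptotically unbiased functions. -/
theorem InClass.le_mse [IsProbabilityMeasure P] (h : θ.InClass P K I J)
    (hN : Tendsto N atTop atTop) (hT : Tendsto T atTop atTop) (hI : ∀ n, (I n).Nonempty)
    (hJ : ∀ n, (J n).Nonempty)
    {U : (n : ℕ) → (Fin (N n) → Fin (T n) → ℝ) × (Fin (N n) → Fin (T n) → Bool) → ℝ}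
    (hU : ∀ n, Measurable (U n))
    (hunb : ∀ θ : PanelModel Ξ N T, θ.InClass P K I J → θ.AsympUnbiased P K I J U) {ε : ℝ}
    (hε : 0 < ε) :
    WithProbToOne P fun n ξ =>
      ENNReal.ofReal ((1 - ε) * θ.sStarSq (K n) n (I n) (J n) ξ) ≤ θ.mse n (U n) (I n) (J n) ξ := by
  obtain ⟨C, ν, δ, g, c, c₀, η, ψ, hν, hδ, hg, hc, hc₀, hη, hψ, hs, hsig, hpar, hgood, hrate,
    hrate'⟩ := h.exists_data hN hT hI hJ
  obtain ⟨s, S, hs0, hσs, hσ⟩ := h.exists_sigma_bounds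
  set D := max C 1 with hDd
  have hD : 0 < D := lt_max_of_lt_right one_pos
  set u := min (ε / 8) (1 / 8) with hud
  have hu : 0 < u := lt_min (by positivity) (by norm_num)
  have hu1 : u ≤ 1 / 8 := min_le_right _ _
  have huε : 8 * u ≤ ε := by linarith [min_le_left (ε / 8) (1 / 8 : ℝ)]
  -- The angle u is fixed by ε alone. The smallness e of the perturbation is chosen afterwards,
  -- relative to u, and is reached as n grows.
  obtain ⟨e, he, he1, he2, he3, he4⟩ : ∃ e : ℝ, 0 < e ∧ e ≤ c₀ / 2 ∧ 24 * e ≤ u ∧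
      ((4 * D + 2) * e) ^ 2 ≤ u / 4 * s ^ 2 ∧ (2 * D ^ 2 + 1 + 4 / c₀) * e ≤ u := by
    refine ⟨min (min (c₀ / 2) (u / 24)) (min (√u / 2 * s / (4 * D + 2))
      (u / (2 * D ^ 2 + 1 + 4 / c₀))), by positivity, (min_le_left _ _).trans (min_le_left _ _),
      ?_, ?_, ?_⟩
    · linarith [(min_le_left (min (c₀ / 2) (u / 24)) (min (√u / 2 * s / (4 * D + 2))
        (u / (2 * D ^ 2 + 1 + 4 / c₀)))).trans (min_le_right _ _)]
    · have h1 := (min_le_right (min (c₀ / 2) (u / 24)) (min (√u / 2 * s / (4 * D + 2))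
        (u / (2 * D ^ 2 + 1 + 4 / c₀)))).trans (min_le_left _ _)
      rw [le_div_iff₀ (by positivity)] at h1
      calc _ ≤ (√u / 2 * s) ^ 2 := by
            refine pow_le_pow_left₀ (by positivity) ?_ 2
            rw [mul_comm]
            exact h1
        _ = _ := by rw [mul_pow, div_pow, Real.sq_sqrt hu.le]; norm_num
    · have h1 := (min_le_right (min (c₀ / 2) (u / 24)) (min (√u / 2 * s / (4 * D + 2))
        (u / (2 * D ^ 2 + 1 + 4 / c₀)))).trans (min_le_right _ _)
      rw [le_div_iff₀ (by positivity)] at h1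
      rw [mul_comm]
      exact h1
  have hpert := InClass.goodPert θ h (τ := u) hN hT hI hJ hD hc₀ hη hu.le hσ he (by linarith)
    hgood hrate
  have hun := hunb θ h (u ^ 2 / 3) (by positivity)
  -- Unbiasedness over the whole class is used here, at the perturbed model.
  have hun' := hunb _ (h.leastFav hN hT hI hJ hu.le) (u ^ 2 / 3) (by positivity)
  refine (hpert.and (hun.and hun')).mono (.of_forall fun n ξ hξ => ?_)
  obtain ⟨h1, ⟨-, h2⟩, -, h3⟩ := hξ
  have hσn : 0 < θ.σ n := hs0.trans_le (hσs n)
  refine le_trans (ENNReal.ofReal_le_ofReal ?_) (h1.le_mse (hU n) hσn (h.p_pos n) hu hu1 he1 he2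
    (he3.trans ?_) he4 h2 h3)
  · refine mul_le_mul_of_nonneg_right (by linarith) ?_
    rw [sStarSq_eq]
    have := PertSetup.totalLev_pos h1
    have := h.p_pos n
    positivity
  · have := hσs n
    gcongr

end PanelModel

theorem mainTheorem3 {Ξ : Type*} [MeasurableSpace Ξ] (P : Measure Ξ) [IsProbabilityMeasure P]
    (N T K : ℕ → ℕ) (hN : Tendsto N atTop atTop) (hT : Tendsto T atTop atTop)
    (I : (n : ℕ) → Finset (Fin (N n))) (J : (n : ℕ) → Finset (Fin (T n)))
    (hI : ∀ n, (I n).Nonempty) (hJ : ∀ n, (J n).Nonempty)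
    (hNJ : (fun n => (N n : ℝ) * ((J n).card : ℝ)) =o[atTop]
      fun n => (T n : ℝ) ^ 2 * ((I n).card : ℝ) ^ 2)
    (hTI : (fun n => (T n : ℝ) * ((I n).card : ℝ)) =o[atTop]
      fun n => (N n : ℝ) ^ 2 * ((J n).card : ℝ) ^ 2) :
    (∀ U : (n : ℕ) → (Fin (N n) → Fin (T n) → ℝ) × (Fin (N n) → Fin (T n) → Bool) → ℝ,
      (∀ n, Measurable (U n)) →
      (∀ θ : PanelModel Ξ N T, θ.InClass P K I J → θ.AsympUnbiased P K I J U) →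
      ∀ θ : PanelModel Ξ N T, θ.InClass P K I J →
        ∀ ε : ℝ, 0 < ε → WithProbToOne P fun n ξ =>
          ENNReal.ofReal ((1 - ε) * θ.sStarSq (K n) n (I n) (J n) ξ) ≤
            θ.mse n (U n) (I n) (J n) ξ) ∧
    (∀ θ : PanelModel Ξ N T, θ.InClass P K I J →
      ∀ ε : ℝ, 0 < ε → Tendsto (fun n =>
        (P.prod (noiseLaw (N n) (T n) (θ.p n) (θ.σ n)))
          {y | ¬ |θ.asympVar (K n) n (I n) (J n) y.1 y.2 -
              θ.sStarSq (K n) n (I n) (J n) y.1| ≤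
            ε * θ.sStarSq (K n) n (I n) (J n) y.1})
        atTop (𝓝 0)) := by
  exact ⟨fun _ hU hunb _ hθ _ hε => hθ.le_mse hN hT hI hJ hU hunb hε,
    fun _ hθ _ hε => hθ.asympVar_sub_sStarSq hN hT hI hJ hε⟩
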